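/- Let $F$ be a totally real number field of even degree, $I$ its set of real embeddings, $\mathcal O_F$ its ring of integers, $\hat F$ its ring of finite adeles and $\hat{\mathcal O}_F\subset\hat F$ the integral ones; no condition is put on the class number of $F$. Let $B$ be the quaternion algebra over $F$ ramified exactly at the infinite places, $\mathrm{nr}$ its reduced norm, $R\subset B$ a maximal order, $\hat B=B\otimes_F\hat F$, and fix an isomorphism $\hat B\cong M_2(\hat F)$ of $\hat F$-algebras under which $\hat R\cong M_2(\hat{\mathcal O}_F)$. Let $N\neq 0$ be an ideal of $\mathcal O_F$ and $U_0(N)=\{\begin{pmatrix}a&b\\c&d\end{pmatrix}\in GL_2(\hat{\mathcal O}_F): c\equiv 0 \ (N)\}\subset\hat B^\times$. For each $\tau\in I$ fix a ring homomorphism $j_\tau:B\to M_2(\mathbb C)$ that extends $\tau$ (with $F$ acting by scalars). Let $k\in\mathbb Z^I$ with all $k_\tau\ge 2$ and of the same parity, and let $v\in\mathbb Z_{\ge 0}^I$, with $v_\tau=0$ for some $\tau$, be such that $k_\tau-2+2v_\tau=\mu$ does not depend on $\tau$. Let $L_k=\bigotimes_{\tau\in I}\mathrm{Sym}^{k_\tau-2}(\mathbb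 C^2)$, on which $B^\times$ acts on the right: on the $\tau$-th factor, $u$ acts through $m=j_\tau(u)$ by $x\mapsto(\det m)^{v_\tau}\,x\,\mathrm{Sym}^{k_\tau-2}(m)$. Put $$M_k^B(N)=\{f:\hat B^\times/U_0(N)\to L_k:\ f(\gamma x)\gamma=f(x)\ \text{ for all }\gamma\in B^\times\}.$$ For a prime $\mathfrak p$ of $F$ let $\varpi\in \hat B^\times$ be $\mathrm{diag}(1,\varpi_{\mathfrak p})$ at $\mathfrak p$, with $\varpi_{\mathfrak p}$ a uniformizer, and $1$ elsewhere. The double coset $U_0(N)\varpi U_0(N)=\coprod_i U_0(N)u_i$ is a finite disjoint union, and the Hecke operator $T(\mathfrak p)$ on $M_k^B(N)$ is $(T(\mathfrak p)f)(x)=\sum_i f(xu_i^{-1})$. Let $Cl_B$ be a complete set of representatives of the right ideal classes of $R$ that consists of ideals $\mathfrak a\subseteq R$ with $\mathrm{nr}(\mathfrak a)$ prime to $N$. Let $R_{\mathfrak a}$ be the left order of $\mathfrak a$. An element of $B$ that is integral at the primes dividing $N$ acts on column vectors over $\mathcal O_F/N$ through its reduction in $M_2(\mathcal O_F/N)$.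 For $u\in B^\times$ of this kind and $f:\mathbf P^1(\mathcal O_F/N)\to L_k$ put $(f\|u)(x)=f(ux)u$, read as $0$ where $ux$ is not a point of $\mathbf P^1(\mathcal O_F/N)$ (this can happen only if the reduction of $u$ is not invertible), and $$M_k(R_{\mathfrak a},N)=\{f:\mathbf P^1(\mathcal O_F/N)\to L_k:\ f\|\gamma=f\ \text{ for all }\gamma\in R_{\mathfrak a}^\times\}.$$ For $\mathfrak a,\mathfrak b\in Cl_B$ and a prime $\mathfrak p$ of $F$ put $$\Theta(\mathfrak p,\mathfrak a,\mathfrak b)=R_{\mathfrak a}^\times\backslash\{u\in\mathfrak a\mathfrak b^{-1}:\ (\mathrm{nr}(u))=\mathfrak p\,\mathrm{nr}(\mathfrak a)\,\mathrm{nr}(\mathfrak b)^{-1}\}.$$ Then the sets $\Theta(\mathfrak p,\mathfrak a,\mathfrak b)$ are finite, the formula $T_{\mathfrak a,\mathfrak b}(\mathfrak p)f=\sum_{u\in\Theta(\mathfrak p,\mathfrak a,\mathfrak b)}f\|u$ gives well-defined linear maps $T_{\mathfrak a,\mathfrak b}(\mathfrak p):M_k(R_{\mathfrak a},N)\to M_k(R_{\mathfrak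 b},N)$, and there is an isomorphism of Hecke modules $$\varphi:M_k^B(N)\to\bigoplus_{\mathfrak a\in Cl_B}M_k(R_{\mathfrak a},N),$$ where $T(\mathfrak p)$ acts on the right hand side by the collection $(T_{\mathfrak a,\mathfrak b}(\mathfrak p))_{\mathfrak a,\mathfrak b}$: for all primes $\mathfrak p$, all $f\in M_k^B(N)$ and all $\mathfrak b\in Cl_B$, $$\varphi(T(\mathfrak p)f)_{\mathfrak b}=\sum_{\mathfrak a\in Cl_B}T_{\mathfrak a,\mathfrak b}(\mathfrak p)\,\varphi(f)_{\mathfrak a}.$$ -/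

import Mathlib

open scoped TensorProduct DirectSum nonZeroDivisors Quaternion
open IsDedekindDomain NumberField

noncomputable section

namespace BrandtHecke

/-! ### Quaternion algebras, orders and ideals -/

section Algebra

variable (F : Type*) [Field F] [NumberField F] {B : Type*} [Ring B] [Algebra F B]

/-- `B` is ramified at every real place of `F`: for each real embedding `τ` the algebra
`ℝ ⊗_{F,τ} B` is isomorphic to Hamilton's quaternions. -/
def IsTotallyDefinite (F : Type*) [Field F] (B : Type*) [Ring B] [Algebra F B] : Prop :=
  ∀ τ : F →+* ℝ,
    letI : Algebra F ℝ := τ.toAlgebra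
    Nonempty ((ℝ ⊗[F] B) ≃ₐ[ℝ] ℍ[ℝ])

/-- Reduced trace of an element of a quaternion algebra in characteristic zero: half the trace of
the left regular representation. -/
def reducedTrace (x : B) : F := LinearMap.trace F B (LinearMap.mulLeft F x) / 2

/-- Reduced norm of an element of a quaternion algebra in characteristic zero, through the
identity `2 det M = (tr M)² - tr (M²)` of 2 by 2 matrices. -/
def reducedNorm (x : B) : F := (reducedTrace F x ^ 2 - reducedTrace F (x ^ 2)) / 2

variable {F}

/-- An order of `B` over the ring of integers of `F`. -/
structure IsOrder (R : Subalgebra (𝓞 F) B) : Prop where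
  fg : (Subalgebra.toSubmodule R).FG
  span_eq_top : Submodule.span F (R : Set B) = ⊤

/-- A maximal order. -/
def IsMaximalOrder (R : Subalgebra (𝓞 F) B) : Prop :=
  IsOrder R ∧ ∀ R' : Subalgebra (𝓞 F) B, IsOrder R' → R ≤ R' → R' = R

/-- A fractional right ideal of `R`: a full lattice in `B`, stable under right multiplication
by `R`. -/
structure IsRightFractionalIdeal (R : Subalgebra (𝓞 F) B) (I : Submodule (𝓞 F) B) : Prop where
  fg : I.FG
  span_eq_top : Submodule.span F (I : Set B) = ⊤
  mul_mem : ∀ x ∈ I, ∀ r ∈ R, x * r ∈ I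

/-- The lattice `u I`. -/
def leftTranslate (u : Bˣ) (I : Submodule (𝓞 F) B) : Submodule (𝓞 F) B :=
  I.map (LinearMap.mulLeft (𝓞 F) (u : B))

/-- `Cl` is a complete set of representatives of the right ideal classes of `R`, two ideals
being in one class if `I = u J` for some `u ∈ Bˣ`. -/
structure IsRightClassReps (R : Subalgebra (𝓞 F) B) (Cl : Set (Submodule (𝓞 F) B)) : Prop where
  isRightFractionalIdeal : ∀ a ∈ Cl, IsRightFractionalIdeal R a
  existsUnique : ∀ I, IsRightFractionalIdeal R I →
    ∃! a, a ∈ Cl ∧ ∃ u : Bˣ, I = leftTranslate u a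

/-- The left order `{x | x I ⊆ I}` of a lattice. -/
def leftOrder (I : Submodule (𝓞 F) B) : Subalgebra (𝓞 F) B where
  carrier := {x | ∀ y ∈ I, x * y ∈ I}
  mul_mem' := fun {x x'} hx hx' y hy => by
    rw [mul_assoc]
    exact hx _ (hx' _ hy)
  add_mem' := fun {x x'} hx hx' y hy => by
    rw [add_mul]
    exact I.add_mem (hx _ hy) (hx' _ hy)
  algebraMap_mem' := fun r y hy => by
    rw [← Algebra.smul_def]
    exact I.smul_mem r hy

/-- The unit group of the left order, as a subgroup of `Bˣ`. -/
def leftOrderUnits (I : Submodule (𝓞 F) B) : Subgroup Bˣ where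
  carrier := {u | (u : B) ∈ leftOrder I ∧ ((u⁻¹ : Bˣ) : B) ∈ leftOrder I}
  mul_mem' := fun {u w} hu hw => by
    refine ⟨?_, ?_⟩
    · rw [Units.val_mul]
      exact (leftOrder I).mul_mem hu.1 hw.1
    · rw [mul_inv_rev, Units.val_mul]
      exact (leftOrder I).mul_mem hw.2 hu.2
  one_mem' := by
    refine ⟨?_, ?_⟩
    · rw [Units.val_one]
      exact (leftOrder I).one_mem
    · rw [inv_one, Units.val_one]
      exact (leftOrder I).one_mem
  inv_mem' := fun {u} hu => ⟨hu.2, by rw [inv_inv]; exact hu.1⟩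

/-- The inverse `{x | I x I ⊆ I}` of a lattice. -/
def idealInv (I : Submodule (𝓞 F) B) : Submodule (𝓞 F) B where
  carrier := {x | ∀ y ∈ I, ∀ z ∈ I, y * x * z ∈ I}
  add_mem' := fun {x x'} hx hx' y hy z hz => by
    rw [mul_add, add_mul]
    exact I.add_mem (hx y hy z hz) (hx' y hy z hz)
  zero_mem' := fun y _ z _ => by
    rw [mul_zero, zero_mul]
    exact I.zero_mem
  smul_mem' := fun c x hx y hy z hz => by
    rw [mul_smul_comm, smul_mul_assoc]
    exact I.smul_mem c (hx y hy z hz)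

/-- The reduced norm of a lattice: the fractional ideal of `F` generated by the reduced norms
of its elements. -/
def idealNorm (I : Submodule (𝓞 F) B) : Submodule (𝓞 F) F :=
  Submodule.span (𝓞 F) (reducedNorm F '' (I : Set B))

/-- An integral ideal of `F`, viewed as a fractional ideal. -/
def toFrac (I : Ideal (𝓞 F)) : Submodule (𝓞 F) F := IsLocalization.coeSubmodule F I

/-- All `u ∈ Bˣ` with `u ∈ a b⁻¹` and `(nr u) = 𝔭 nr(a) nr(b)⁻¹`. -/
def thetaSet (p : HeightOneSpectrum (𝓞 F)) (a b : Submodule (𝓞 F) B) : Set Bˣ :=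
  {u | (u : B) ∈ a * idealInv b ∧
    Submodule.span (𝓞 F) {reducedNorm F (u : B)} * idealNorm b = toFrac p.asIdeal * idealNorm a}

/-- Equivalence of elements of `thetaSet` under left multiplication by the units of the left
order of `a`. -/
def thetaSetoid (p : HeightOneSpectrum (𝓞 F)) (a b : Submodule (𝓞 F) B) :
    Setoid (thetaSet p a b) where
  r u w := ∃ γ ∈ leftOrderUnits a, (w : Bˣ) = γ * u
  iseqv :=
    { refl := fun u => ⟨1, one_mem _, (one_mul _).symm⟩
      symm := fun {u w} ⟨γ, hγ, h⟩ => ⟨γ⁻¹, inv_mem hγ, by rw [h, inv_mul_cancel_left]⟩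
      trans := fun {u w z} ⟨γ, hγ, h⟩ ⟨δ, hδ, h'⟩ =>
        ⟨δ * γ, mul_mem hδ hγ, by rw [h', h, mul_assoc]⟩ }

/-- The set `Θ(𝔭, a, b)` of orbits of the units of the left order of `a` on `thetaSet`. -/
def Theta (p : HeightOneSpectrum (𝓞 F)) (a b : Submodule (𝓞 F) B) : Type _ :=
  Quotient (thetaSetoid p a b)

end Algebra

/-! ### The weight representation -/

section Weight

/-- The space `Sym^a(ℂ²)`: binary forms of degree `a`. -/
abbrev SymSpace (a : ℕ) : Type := MvPolynomial.homogeneousSubmodule (Fin 2) ℂ a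

/-- The right action `P ↦ (det M)^b · P(X M)` of a matrix `M` on `Sym^a(ℂ²)`, where `M` acts on
the basis vectors of `ℂ²` by `X_i ↦ ∑_j M_{ij} X_j` (row vectors). -/
def symAct (a b : ℕ) (M : Matrix (Fin 2) (Fin 2) ℂ) : SymSpace a →ₗ[ℂ] SymSpace a :=
  M.det ^ b •
    (MvPolynomial.aeval (fun i : Fin 2 =>
      ∑ j : Fin 2, MvPolynomial.C (M i j) * MvPolynomial.X j :
        Fin 2 → MvPolynomial (Fin 2) ℂ)).toLinearMap.restrict
      (fun P hP => by
        rw [MvPolynomial.mem_homogeneousSubmodule] at hP ⊢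
        have h := hP.aeval (R := ℂ) (n := 1)
          (fun i : Fin 2 => ∑ j : Fin 2, MvPolynomial.C (M i j) * MvPolynomial.X j :
            Fin 2 → MvPolynomial (Fin 2) ℂ)
          (fun i => MvPolynomial.IsHomogeneous.sum _ _ _ fun j _ => by
            simpa using (MvPolynomial.isHomogeneous_C (Fin 2) (M i j)).mul
              (MvPolynomial.isHomogeneous_X ℂ j))
        simpa using h)

variable (F : Type*) [Field F]

/-- The weight space `⊗_τ Sym^{k_τ - 2}(ℂ²)` over the real embeddings `τ` of `F`. -/
abbrev WeightSpace (k : (F →+* ℝ) → ℕ) : Type _ :=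
  ⨂[ℂ] τ : F →+* ℝ, SymSpace (k τ - 2)

variable {F} {B : Type*} [Ring B]

/-- The right action of `B` on the weight space, through the splittings `j` and with the
determinant twists `v`. -/
def weightAct (k v : (F →+* ℝ) → ℕ) (j : (F →+* ℝ) → B →+* Matrix (Fin 2) (Fin 2) ℂ) (u : B) :
    WeightSpace F k →ₗ[ℂ] WeightSpace F k :=
  PiTensorProduct.map (fun τ => symAct (k τ - 2) (v τ) (j τ u))

end Weight

/-! ### Adelic objects -/

section Adelic

variable (F : Type*) [Field F] [NumberField F]

/-- The finite adeles of `F`. -/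
abbrev Ad : Type _ := FiniteAdeleRing (𝓞 F) F

/-- The ring `B̂` of finite adeles of `B`. -/
abbrev AdB (B : Type*) [Ring B] [Algebra F B] : Type _ := Ad F ⊗[F] B

variable {F}

theorem adele_add_apply (x y : Ad F) (v : HeightOneSpectrum (𝓞 F)) : (x + y) v = x v + y v := rfl
theorem adele_mul_apply (x y : Ad F) (v : HeightOneSpectrum (𝓞 F)) : (x * y) v = x v * y v := rfl
theorem adele_neg_apply (x : Ad F) (v : HeightOneSpectrum (𝓞 F)) : (-x) v = -x v := rfl
theorem adele_one_apply (v : HeightOneSpectrum (𝓞 F)) : (1 : Ad F) v = 1 := rfl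
theorem adele_zero_apply (v : HeightOneSpectrum (𝓞 F)) : (0 : Ad F) v = 0 := rfl

/-- A finite adele is integral if all its components are. -/
def IsIntegralAdele (x : Ad F) : Prop :=
  ∀ v : HeightOneSpectrum (𝓞 F), x v ∈ v.adicCompletionIntegers F

/-- `x ∈ N 𝓞_v`, for `x` in the completion `F_v`. -/
def MemLocalIdeal (N : Ideal (𝓞 F)) (v : HeightOneSpectrum (𝓞 F))
    (x : v.adicCompletion F) : Prop :=
  ∃ y ∈ N.map (algebraMap (𝓞 F) (v.adicCompletionIntegers F)), (y : v.adicCompletion F) = x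

theorem isIntegralAdele_zero : IsIntegralAdele (0 : Ad F) := fun _ => zero_mem _
theorem isIntegralAdele_one : IsIntegralAdele (1 : Ad F) := fun _ => one_mem _

theorem IsIntegralAdele.add {x y : Ad F} (hx : IsIntegralAdele x) (hy : IsIntegralAdele y) :
    IsIntegralAdele (x + y) := fun v => add_mem (hx v) (hy v)

theorem IsIntegralAdele.mul {x y : Ad F} (hx : IsIntegralAdele x) (hy : IsIntegralAdele y) :
    IsIntegralAdele (x * y) := fun v => mul_mem (hx v) (hy v)

theorem IsIntegralAdele.neg {x : Ad F} (hx : IsIntegralAdele x) :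
    IsIntegralAdele (-x) := fun v => neg_mem (hx v)

theorem memLocalIdeal_zero (N : Ideal (𝓞 F)) (v : HeightOneSpectrum (𝓞 F)) :
    MemLocalIdeal N v 0 := ⟨0, zero_mem _, rfl⟩

theorem MemLocalIdeal.add {N : Ideal (𝓞 F)} {v : HeightOneSpectrum (𝓞 F)}
    {x y : v.adicCompletion F} (hx : MemLocalIdeal N v x) (hy : MemLocalIdeal N v y) :
    MemLocalIdeal N v (x + y) := by
  obtain ⟨a, ha, rfl⟩ := hx
  obtain ⟨b, hb, rfl⟩ := hy
  exact ⟨a + b, add_mem ha hb, rfl⟩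

theorem MemLocalIdeal.mul {N : Ideal (𝓞 F)} {v : HeightOneSpectrum (𝓞 F)}
    {x y : v.adicCompletion F} (hx : x ∈ v.adicCompletionIntegers F) (hy : MemLocalIdeal N v y) :
    MemLocalIdeal N v (x * y) := by
  obtain ⟨b, hb, rfl⟩ := hy
  exact ⟨⟨x, hx⟩ * b, Ideal.mul_mem_left _ _ hb, rfl⟩

theorem inv_lower_left {A : Type*} [CommRing A] (g : (Matrix (Fin 2) (Fin 2) A)ˣ) :
    (g⁻¹).1 1 0 = -((g⁻¹).1 0 0 * (g⁻¹).1 1 1 - (g⁻¹).1 0 1 * (g⁻¹).1 1 0) * g.1 1 0 := by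
  have h : g.1 * (g⁻¹).1 = 1 := g.mul_inv
  have h' := congrFun (congrFun h 1) 0
  have h'' := congrFun (congrFun h 1) 1
  rw [Matrix.mul_apply, Fin.sum_univ_two] at h' h''
  simp only [Matrix.one_apply, Fin.isValue, one_ne_zero, if_false, if_true] at h' h''
  linear_combination -(g⁻¹).1 1 0 * h'' + (g⁻¹).1 1 1 * h'

/-- The subgroup `U₀(N)` of `GL₂` of the integral finite adeles: lower left entry divisible
by `N`. -/
def gammaZero (N : Ideal (𝓞 F)) : Subgroup (Matrix (Fin 2) (Fin 2) (Ad F))ˣ where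
  carrier := {g | (∀ i j, IsIntegralAdele ((g : Matrix (Fin 2) (Fin 2) (Ad F)) i j)) ∧
    (∀ i j, IsIntegralAdele (((g⁻¹ : (Matrix (Fin 2) (Fin 2) (Ad F))ˣ) :
      Matrix (Fin 2) (Fin 2) (Ad F)) i j)) ∧
    ∀ v, MemLocalIdeal N v ((g : Matrix (Fin 2) (Fin 2) (Ad F)) 1 0 v)}
  mul_mem' := fun {g h} hg hh => by
    refine ⟨fun i j => ?_, fun i j => ?_, fun v => ?_⟩
    · rw [Units.val_mul, Matrix.mul_apply, Fin.sum_univ_two]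
      exact ((hg.1 _ _).mul (hh.1 _ _)).add ((hg.1 _ _).mul (hh.1 _ _))
    · rw [mul_inv_rev, Units.val_mul, Matrix.mul_apply, Fin.sum_univ_two]
      exact ((hh.2.1 _ _).mul (hg.2.1 _ _)).add ((hh.2.1 _ _).mul (hg.2.1 _ _))
    · rw [Units.val_mul, Matrix.mul_apply, Fin.sum_univ_two, adele_add_apply, adele_mul_apply,
        adele_mul_apply, mul_comm]
      exact (MemLocalIdeal.mul (hh.1 _ _ v) (hg.2.2 v)).add
        (MemLocalIdeal.mul (hg.1 _ _ v) (hh.2.2 v))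
  one_mem' := by
    have h : ∀ i j, IsIntegralAdele ((1 : Matrix (Fin 2) (Fin 2) (Ad F)) i j) := fun i j => by
      rw [Matrix.one_apply]
      split_ifs
      · exact isIntegralAdele_one
      · exact isIntegralAdele_zero
    refine ⟨fun i j => ?_, fun i j => ?_, fun v => ?_⟩
    · rw [Units.val_one]
      exact h i j
    · rw [inv_one, Units.val_one]
      exact h i j
    · rw [Units.val_one, Matrix.one_apply_ne (by decide)]
      exact memLocalIdeal_zero N v
  inv_mem' := fun {g} hg => by
    refine ⟨hg.2.1, by rw [inv_inv]; exact hg.1, fun v => ?_⟩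
    rw [inv_lower_left, adele_mul_apply]
    refine MemLocalIdeal.mul ?_ (hg.2.2 v)
    rw [sub_eq_add_neg]
    exact (((hg.2.1 _ _).mul (hg.2.1 _ _)).add ((hg.2.1 _ _).mul (hg.2.1 _ _)).neg).neg v

variable {B : Type*} [Ring B] [Algebra F B]

/-- The closure `R̂` of an order `R` in `B̂`: the sums of elements `c ⊗ r` with `c` an integral
finite adele and `r ∈ R`. -/
def adelicOrder (R : Subalgebra (𝓞 F) B) : AddSubgroup (AdB F B) :=
  AddSubgroup.closure {z | ∃ c : Ad F, IsIntegralAdele c ∧ ∃ r ∈ R, z = c ⊗ₜ[F] r}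

/-- The isomorphism `θ : B̂ ≃ M₂(F̂)` maps `R̂` onto the matrices with integral entries. -/
def SplitsOrder (R : Subalgebra (𝓞 F) B)
    (θ : AdB F B ≃ₐ[Ad F] Matrix (Fin 2) (Fin 2) (Ad F)) : Prop :=
  ∀ x : AdB F B, x ∈ adelicOrder R ↔ ∀ i j, IsIntegralAdele (θ x i j)

/-- The level subgroup `U₀(N)` of `B̂ˣ`. -/
def U0 (θ : AdB F B ≃ₐ[Ad F] Matrix (Fin 2) (Fin 2) (Ad F)) (N : Ideal (𝓞 F)) :
    Subgroup (AdB F B)ˣ :=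
  (gammaZero N).comap (Units.map (θ : AdB F B →* Matrix (Fin 2) (Fin 2) (Ad F)))

/-- The diagonal embedding of `Bˣ` in `B̂ˣ`. -/
def diagB : Bˣ →* (AdB F B)ˣ :=
  Units.map ((Algebra.TensorProduct.includeRight (R := F) (A := Ad F) (B := B) :
    B →ₐ[F] AdB F B) : B →* AdB F B)

/-- The space of automorphic forms of level `U₀(N)` and weight `k` on `B`: functions `f` on
`B̂ˣ / U₀(N)` with values in the weight space and `f(γ x) γ = f(x)` for all `γ ∈ Bˣ`. -/
def AutForm (θ : AdB F B ≃ₐ[Ad F] Matrix (Fin 2) (Fin 2) (Ad F)) (N : Ideal (𝓞 F))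
    (k v : (F →+* ℝ) → ℕ) (j : (F →+* ℝ) → B →+* Matrix (Fin 2) (Fin 2) ℂ) :
    Submodule ℂ ((AdB F B)ˣ ⧸ U0 θ N → WeightSpace F k) where
  carrier := {f | ∀ (γ : Bˣ) x, weightAct k v j (γ : B) (f ((diagB γ : (AdB F B)ˣ) • x)) = f x}
  add_mem' := fun {f g} hf hg γ x => by
    rw [Pi.add_apply, Pi.add_apply, map_add, hf, hg]
  zero_mem' := fun γ x => by
    rw [Pi.zero_apply, Pi.zero_apply, map_zero]
  smul_mem' := fun c f hf γ x => by
    rw [Pi.smul_apply, Pi.smul_apply, map_smul, hf]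

theorem uniformizer_ne_zero (p : HeightOneSpectrum (𝓞 F)) :
    (p.valuation_exists_uniformizer F).choose ≠ 0 := by
  intro h
  have h' := (p.valuation_exists_uniformizer F).choose_spec
  rw [h, map_zero] at h'
  exact WithZero.exp_ne_zero h'.symm

open scoped Classical in
/-- The finite adele with component `x` at `p` and `1` elsewhere. -/
def localAdele (p : HeightOneSpectrum (𝓞 F)) (x : F) : Ad F :=
  ⟨fun v => ((if v = p then x else 1 : F) : v.adicCompletion F), by
    refine Filter.eventually_cofinite.2 ((Set.finite_singleton p).subset fun v hv => ?_)
    by_contra hvp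
    refine hv ?_
    have hvp' : ¬ v = p := hvp
    simp only [if_neg hvp']
    exact one_mem (v.adicCompletionIntegers F)⟩

theorem localAdele_mul (p : HeightOneSpectrum (𝓞 F)) {x y : F} (h : x * y = 1) :
    localAdele p x * localAdele p y = 1 := by
  refine FiniteAdeleRing.ext _ fun v => ?_
  refine (HeightOneSpectrum.adicCompletion.coe_mul ..).symm.trans
    (Eq.trans ?_ (HeightOneSpectrum.adicCompletion.coe_one ..))
  refine congrArg (fun z : F => (z : v.adicCompletion F)) ?_
  split_ifs
  · exact h
  · exact mul_one 1

/-- The idele with component a uniformizer at `p` and `1` elsewhere. -/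
def uniformizerIdele (p : HeightOneSpectrum (𝓞 F)) : (Ad F)ˣ :=
  let π : F := (p.valuation_exists_uniformizer F).choose
  { val := localAdele p π
    inv := localAdele p π⁻¹
    val_inv := localAdele_mul p (mul_inv_cancel₀ (uniformizer_ne_zero p))
    inv_val := localAdele_mul p (inv_mul_cancel₀ (uniformizer_ne_zero p)) }

/-- The element `diag(1, ϖ)` of `GL₂(F̂)`, with `ϖ` a uniformizer at `p`. -/
def diagUniformizer (p : HeightOneSpectrum (𝓞 F)) : (Matrix (Fin 2) (Fin 2) (Ad F))ˣ where
  val := Matrix.diagonal ![1, (uniformizerIdele p : Ad F)]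
  inv := Matrix.diagonal ![1, ((uniformizerIdele p)⁻¹ : (Ad F)ˣ)]
  val_inv := by
    rw [Matrix.diagonal_mul_diagonal, ← Matrix.diagonal_one]
    congr 1
    funext i
    fin_cases i <;> simp
  inv_val := by
    rw [Matrix.diagonal_mul_diagonal, ← Matrix.diagonal_one]
    congr 1
    funext i
    fin_cases i <;> simp

/-- The element of `B̂ˣ` that defines the Hecke operator at `p`. -/
def heckeElement (θ : AdB F B ≃ₐ[Ad F] Matrix (Fin 2) (Fin 2) (Ad F))
    (p : HeightOneSpectrum (𝓞 F)) : (AdB F B)ˣ :=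
  Units.map (θ.symm : Matrix (Fin 2) (Fin 2) (Ad F) →* AdB F B) (diagUniformizer p)

/-- If `U ϖ U` is the disjoint union of the cosets `U u_i`, then `U ϖ⁻¹ U` is that of the cosets
`u_i⁻¹ U`; this is the set of the latter, for `U = U₀(N)`. -/
def heckeCosets (θ : AdB F B ≃ₐ[Ad F] Matrix (Fin 2) (Fin 2) (Ad F)) (N : Ideal (𝓞 F))
    (p : HeightOneSpectrum (𝓞 F)) : Set ((AdB F B)ˣ ⧸ U0 θ N) :=
  {c | ∃ u ∈ U0 θ N, c = ((u * (heckeElement θ p)⁻¹ : (AdB F B)ˣ) : (AdB F B)ˣ ⧸ U0 θ N)}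

/-- `T` is the Hecke operator `T(𝔭)`: the sum `(T f)(x) = ∑ f(x u_i⁻¹)` over the finitely many
cosets `U u_i` of `U = U₀(N)` in `U ϖ U`. -/
def IsHeckeOperator (θ : AdB F B ≃ₐ[Ad F] Matrix (Fin 2) (Fin 2) (Ad F)) (N : Ideal (𝓞 F))
    (k v : (F →+* ℝ) → ℕ) (j : (F →+* ℝ) → B →+* Matrix (Fin 2) (Fin 2) ℂ)
    (p : HeightOneSpectrum (𝓞 F)) (T : AutForm θ N k v j →ₗ[ℂ] AutForm θ N k v j) : Prop :=
  (heckeCosets θ N p).Finite ∧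
    ∀ (f : AutForm θ N k v j) (x : (AdB F B)ˣ),
      (T f).1 (x : (AdB F B)ˣ ⧸ U0 θ N) = ∑ᶠ c ∈ heckeCosets θ N p, f.1 (x • c)

end Adelic

/-! ### The projective line and forms on orders -/

section Orders

/-- Unimodular column vectors of length two are identified up to units. -/
def p1Setoid (A : Type*) [CommRing A] :
    Setoid {w : Fin 2 → A // IsCoprime (w 0) (w 1)} where
  r w w' := ∃ c : Aˣ, w'.1 = (c : A) • w.1
  iseqv :=
    { refl := fun w => ⟨1, by simp⟩
      symm := fun {w w'} ⟨c, h⟩ => ⟨c⁻¹, by rw [h, smul_smul, Units.inv_mul, one_smul]⟩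
      trans := fun {w w' w''} ⟨c, h⟩ ⟨d, h'⟩ => ⟨d * c, by rw [h', h, smul_smul, Units.val_mul]⟩ }

/-- The projective line `ℙ¹(A)`. -/
def P1 (A : Type*) [CommRing A] : Type _ := Quotient (p1Setoid A)

open scoped Classical in
/-- The function on all column vectors defined by a function on `ℙ¹(A)`, extended by zero to
the vectors that are not unimodular. -/
def P1.extend {A : Type*} [CommRing A] {L : Type*} [Zero L] (f : P1 A → L) (w : Fin 2 → A) : L :=
  if h : IsCoprime (w 0) (w 1) then f (Quotient.mk (p1Setoid A) ⟨w, h⟩) else 0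

theorem P1.extend_unit_smul {A : Type*} [CommRing A] {L : Type*} [Zero L] (f : P1 A → L) (c : Aˣ)
    (w : Fin 2 → A) : P1.extend f ((c : A) • w) = P1.extend f w := by
  have hc : IsCoprime (((c : A) • w) 0) (((c : A) • w) 1) ↔ IsCoprime (w 0) (w 1) := by
    rw [Pi.smul_apply, Pi.smul_apply, smul_eq_mul, smul_eq_mul]
    exact isCoprime_mul_unit_left c.isUnit _ _
  unfold P1.extend
  by_cases h : IsCoprime (w 0) (w 1)
  · rw [dif_pos h, dif_pos (hc.2 h)]
    exact congrArg f (Quotient.sound (s := p1Setoid A) ((p1Setoid A).symm ⟨c, rfl⟩))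
  · rw [dif_neg h, dif_neg fun h' => h (hc.1 h')]

theorem P1.extend_add {A : Type*} [CommRing A] {L : Type*} [AddZeroClass L] (f g : P1 A → L)
    (w : Fin 2 → A) : P1.extend (f + g) w = P1.extend f w + P1.extend g w := by
  unfold P1.extend
  split_ifs
  · rfl
  · exact (add_zero 0).symm

theorem P1.extend_smul {A : Type*} [CommRing A] {L : Type*} [AddCommMonoid L] [Module ℂ L] (c : ℂ)
    (f : P1 A → L) (w : Fin 2 → A) : P1.extend (c • f) w = c • P1.extend f w := by
  unfold P1.extend
  split_ifs
  · rfl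
  · exact (smul_zero c).symm

variable {F : Type*} [Field F] [NumberField F] {B : Type*} [Ring B] [Algebra F B]

open scoped Classical in
/-- The class in `𝓞_F / N` of a finite adele that is integral at all primes dividing `N`: it is
represented by any `m ∈ 𝓞_F` with `x ≡ m` modulo `N 𝓞_v` for all `v ∣ N`. The value at other adeles
is immaterial. -/
def reduceAdele (N : Ideal (𝓞 F)) (x : Ad F) : 𝓞 F ⧸ N :=
  if h : ∃ m : 𝓞 F, ∀ v : HeightOneSpectrum (𝓞 F), v.asIdeal ∣ N →
      MemLocalIdeal N v (x v - ((m : F) : v.adicCompletion F))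
  then Ideal.Quotient.mk N h.choose else 0

/-- The reduction modulo `N` of an element of `B`. -/
def reduceB (θ : AdB F B ≃ₐ[Ad F] Matrix (Fin 2) (Fin 2) (Ad F)) (N : Ideal (𝓞 F)) (u : B) :
    Matrix (Fin 2) (Fin 2) (𝓞 F ⧸ N) :=
  Matrix.of fun i j => reduceAdele N (θ ((1 : Ad F) ⊗ₜ[F] u) i j)

/-- The function `(f ‖ u)(x) = f(u x) u` on `ℙ¹(𝓞_F / N)`. Where `u x` is not a point of the
projective line, which can happen only if the reduction of `u` is not invertible, the value
is `0`. -/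
def slash (θ : AdB F B ≃ₐ[Ad F] Matrix (Fin 2) (Fin 2) (Ad F)) (N : Ideal (𝓞 F))
    (k v : (F →+* ℝ) → ℕ) (j : (F →+* ℝ) → B →+* Matrix (Fin 2) (Fin 2) ℂ) (u : B) :
    (P1 (𝓞 F ⧸ N) → WeightSpace F k) →ₗ[ℂ] (P1 (𝓞 F ⧸ N) → WeightSpace F k) where
  toFun f x := Quotient.liftOn x
    (fun w => weightAct k v j u (P1.extend f ((reduceB θ N u).mulVec w.1)))
    (fun w w' h => by
      obtain ⟨c, hc⟩ := h
      rw [hc, Matrix.mulVec_smul, P1.extend_unit_smul])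
  map_add' f g := funext fun x => Quotient.inductionOn x fun w =>
    (congrArg (weightAct k v j u) (P1.extend_add f g _)).trans (map_add _ _ _)
  map_smul' c f := funext fun x => Quotient.inductionOn x fun w =>
    (congrArg (weightAct k v j u) (P1.extend_smul c f _)).trans (map_smul _ _ _)

/-- The space `M_k(R_a, N)` of automorphic forms on the left order of `a`: functions `f` on
`ℙ¹(𝓞_F / N)` with `f ‖ γ = f` for all units `γ` of the left order of `a`. -/
def OrderForm (θ : AdB F B ≃ₐ[Ad F] Matrix (Fin 2) (Fin 2) (Ad F)) (N : Ideal (𝓞 F))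
    (k v : (F →+* ℝ) → ℕ) (j : (F →+* ℝ) → B →+* Matrix (Fin 2) (Fin 2) ℂ)
    (a : Submodule (𝓞 F) B) : Submodule ℂ (P1 (𝓞 F ⧸ N) → WeightSpace F k) where
  carrier := {f | ∀ γ ∈ leftOrderUnits a, slash θ N k v j (γ : B) f = f}
  add_mem' := fun {f g} hf hg γ hγ => by
    rw [(slash θ N k v j (γ : B)).map_add f g, hf γ hγ, hg γ hγ]
  zero_mem' := fun γ _ => (slash θ N k v j (γ : B)).map_zero
  smul_mem' := fun c f hf γ hγ => by
    rw [(slash θ N k v j (γ : B)).map_smul c f, hf γ hγ]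

/-- `T` is the linear map `T_{a,b}(𝔭) : M_k(R_a, N) → M_k(R_b, N)`: `Θ(𝔭, a, b)` is finite and
`T f = ∑ f ‖ u`, where `u` runs through any system of representatives of `Θ(𝔭, a, b)`. -/
def IsBrandtMap (θ : AdB F B ≃ₐ[Ad F] Matrix (Fin 2) (Fin 2) (Ad F)) (N : Ideal (𝓞 F))
    (k v : (F →+* ℝ) → ℕ) (j : (F →+* ℝ) → B →+* Matrix (Fin 2) (Fin 2) ℂ)
    (p : HeightOneSpectrum (𝓞 F)) (a b : Submodule (𝓞 F) B)
    (T : OrderForm θ N k v j a →ₗ[ℂ] OrderForm θ N k v j b) : Prop :=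
  Finite (Theta p a b) ∧
    ∀ (r : Theta p a b → thetaSet p a b),
      (∀ c, Quotient.mk (thetaSetoid p a b) (r c) = c) →
      ∀ f : OrderForm θ N k v j a,
        (T f).1 = ∑ᶠ c : Theta p a b, slash θ N k v j ((r c : Bˣ) : B) f.1

end Orders

end BrandtHecke

end

open BrandtHecke

/-!
The splitting `θ` turns the theory of right ideals of `R` into that of matrices over the finite
adeles `F̂`, with ring of integral adeles `Ô`. A right ideal is locally principal
(`exists_eq_latticeOf`), so it has the form `B ∩ α M₂(Ô)` for some `α ∈ GL₂(F̂)`, unique up to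
`GL₂(Ô)` (`latticeOf_eq_iff`); here strong approximation shows that a lattice in `B` and its
adelic closure determine each other (`mem_of_mem_adelicSpan`, `adelicSpan_preimage`). If `a` and
`b` correspond to `α` and `β`, then `R_aˣ = Bˣ ∩ α GL₂(Ô) α⁻¹`, the ideal `nr(a)` is generated
locally by `det α`, and `u ∈ a b⁻¹` has norm `𝔭 nr(a) nr(b)⁻¹` if and only if `α⁻¹ u β` is integral
with determinant a uniformizer at `𝔭` and a unit elsewhere (`mem_thetaSet_latticeOf`).

The ideals `a` in `Cl` are integral of norm prime to `N`, so their generators `α_a` can be chosen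
to be `1` at the primes dividing `N` (`exists_trivial_generator`). Then `u ∈ a b⁻¹` acts on
`ℙ¹(𝓞_F / N)` through the reduction of the integral matrix `α_a⁻¹ u α_b`. Now `GL₂(Ô)` acts
transitively on `ℙ¹(𝓞_F / N)`, and `U₀(N)` is the stabilizer of `(1 : 0)` (`pointOf_surjective`,
`pointOf_eq_iff_mem`), and since `Cl` represents the right ideal classes, `GL₂(F̂)` is the disjoint
union of the double cosets `Bˣ α_a GL₂(Ô)` (`exists_decomposition`, `decomposition_unique`).
Therefore the components `φ(f)_a (g (1 : 0)) = f(α_a g)` define an isomorphism of `M_k^B(N)` with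
the product of the `M_k(R_a, N)` (`component_injective`, `component_surjective`). This product is
a direct sum, because `Cl` is finite (`finite_classReps`): `B` is a division algebra, and an
element of minimal norm in an integral right ideal `a` divides all of `D a`, for an integer `D`
that depends on `R` only.

For the Hecke operators, `U₀(N) diag(1, ϖ) U₀(N)` consists of the integral matrices whose
determinant is a uniformizer at `𝔭` and a unit elsewhere, and which fix `(1 : 0)` modulo `N`
(`IsHeckeMatrix`, `isHeckeMatrix_iff`). The value of `T(𝔭) f` at `α_b g` is the sum of the
`f(α_b g x)` over the cosets `x U₀(N)` with `x⁻¹` in this set. Writing `α_b g x = u⁻¹ α_a h` with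
`h ∈ GL₂(Ô)` gives `h x⁻¹ = α_a⁻¹ u α_b g`, so that `u` belongs to `Θ(𝔭, a, b)` and
`u g (1 : 0) = h (1 : 0)`, and the term is `f(u⁻¹ α_a h) = φ(f)_a (u g (1 : 0)) u`. Every class in
some `Θ(𝔭, a, b)` for which `u g (1 : 0)` is a point of the projective line arises from exactly one
coset, and the other classes contribute zero to the Brandt operators (`sum_heckeCosets_eq`).
-/

noncomputable section

namespace BrandtHecke

/-! ### Finite adeles and strong approximation -/

section Adeles

variable {F : Type*} [Field F] [NumberField F]

/-- The component of a finite adele at a place, as a ring homomorphism. -/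
def evalAdele (v : HeightOneSpectrum (𝓞 F)) : Ad F →+* v.adicCompletion F where
  toFun x := x v
  map_one' := rfl
  map_mul' _ _ := rfl
  map_zero' := rfl
  map_add' _ _ := rfl

variable (F) in
/-- The ring `Ô` of integral finite adeles. -/
def integralAdeles : Subring (Ad F) where
  carrier := {x | IsIntegralAdele x}
  mul_mem' := IsIntegralAdele.mul
  one_mem' := isIntegralAdele_one
  add_mem' := IsIntegralAdele.add
  zero_mem' := isIntegralAdele_zero
  neg_mem' := IsIntegralAdele.neg

theorem mem_integralAdeles {x : Ad F} : x ∈ integralAdeles F ↔ IsIntegralAdele x := Iff.rfl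

theorem valued_algebraMap (x : F) (v : HeightOneSpectrum (𝓞 F)) :
    Valued.v ((algebraMap F (Ad F) x) v) = v.valuation F x :=
  HeightOneSpectrum.valuedAdicCompletion_eq_valuation' v x

theorem isIntegralAdele_algebraMap_iff {x : F} :
    IsIntegralAdele (algebraMap F (Ad F) x) ↔ ∃ m : 𝓞 F, (m : F) = x := by
  constructor
  · intro h
    refine HeightOneSpectrum.mem_integers_of_valuation_le_one F x fun v => ?_
    rw [← valued_algebraMap]
    exact h v
  · rintro ⟨m, rfl⟩ v
    change Valued.v ((algebraMap F (Ad F) m) v) ≤ 1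
    rw [valued_algebraMap]
    exact v.valuation_le_one m

theorem isIntegralAdele_algebraMap (m : 𝓞 F) : IsIntegralAdele (algebraMap F (Ad F) m) :=
  isIntegralAdele_algebraMap_iff.2 ⟨m, rfl⟩

/-- The finite adele with prescribed components. -/
def mkAdele (f : ∀ v : HeightOneSpectrum (𝓞 F), v.adicCompletion F)
    (h : {v | ¬ Valued.v (f v) ≤ 1}.Finite) : Ad F :=
  ⟨f, Filter.eventually_cofinite.2 h⟩

@[simp] theorem mkAdele_apply (f : ∀ v : HeightOneSpectrum (𝓞 F), v.adicCompletion F)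
    (h : {v | ¬ Valued.v (f v) ≤ 1}.Finite) (v : HeightOneSpectrum (𝓞 F)) :
    mkAdele f h v = f v := rfl

theorem finite_not_integral (x : Ad F) : {v | ¬ Valued.v (x v) ≤ 1}.Finite :=
  Filter.eventually_cofinite.1 x.2

theorem finite_dvd {I : Ideal (𝓞 F)} (hI : I ≠ ⊥) :
    {v : HeightOneSpectrum (𝓞 F) | v.asIdeal ∣ I}.Finite :=
  Ideal.finite_factors hI

/-- Finite adeles have denominators in `𝓞 F`. -/
theorem exists_mul_integral (x : Ad F) :
    ∃ n : 𝓞 F, n ≠ 0 ∧ IsIntegralAdele (algebraMap F (Ad F) n * x) := by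
  classical
  have hS := finite_not_integral x
  choose b hb0 hb using fun v : HeightOneSpectrum (𝓞 F) =>
    HeightOneSpectrum.adicCompletion.mul_nonZeroDivisor_mem_adicCompletionIntegers v (x v)
  refine ⟨∏ v ∈ hS.toFinset, b v, Finset.prod_ne_zero_iff.2 fun v _ =>
    nonZeroDivisors.ne_zero (hb0 v), fun v => ?_⟩
  rw [adele_mul_apply]
  by_cases hv : v ∈ hS.toFinset
  · rw [← Finset.mul_prod_erase _ _ hv, mul_comm (b v), RingOfIntegers.coe_eq_algebraMap, map_mul,
      map_mul, adele_mul_apply, mul_assoc]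
    refine mul_mem (isIntegralAdele_algebraMap _ v) ?_
    rw [mul_comm]
    exact hb v
  · refine mul_mem (isIntegralAdele_algebraMap _ v) ?_
    by_contra h
    exact hv (hS.mem_toFinset.2 h)

theorem exists_mul_integral_finite {ι : Type*} [Finite ι] (x : ι → Ad F) :
    ∃ n : 𝓞 F, n ≠ 0 ∧ ∀ i, IsIntegralAdele (algebraMap F (Ad F) n * x i) := by
  classical
  cases nonempty_fintype ι
  choose n hn h using fun i => exists_mul_integral (x i)
  refine ⟨∏ i, n i, Finset.prod_ne_zero_iff.2 fun i _ => hn i, fun i => ?_⟩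
  rw [← Finset.mul_prod_erase _ _ (Finset.mem_univ i), mul_comm (n i),
    RingOfIntegers.coe_eq_algebraMap, map_mul, map_mul, mul_assoc]
  exact (isIntegralAdele_algebraMap _).mul (h i)

/-- Integers are dense in the local integers. -/
theorem exists_valued_sub_lt (v : HeightOneSpectrum (𝓞 F)) (x z : v.adicCompletion F)
    (hx : Valued.v x ≤ 1) (hz : z ≠ 0) :
    ∃ a : 𝓞 F, Valued.v (x - ((a : F) : v.adicCompletion F)) < Valued.v z := by
  have key : ∀ w : v.adicCompletion F, w ≠ 0 →
      ∃ f : F, Valued.v ((f : v.adicCompletion F) - x) < Valued.v w := by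
    intro w hw
    have hmem : {y | Valued.v.restrict (y - x) < Valued.v.restrict w} ∈ nhds x :=
      Valued.mem_nhds.2 ⟨Units.mk0 _ ((Valuation.ne_zero_iff _).2 hw), subset_rfl⟩
    obtain ⟨f, hf⟩ := (HeightOneSpectrum.denseRange_algebraMap (K := F) v).mem_nhds hmem
    exact ⟨f, (Valuation.restrict_lt_iff _).1 hf⟩
  obtain ⟨w, hw, hw1, hwz⟩ : ∃ w : v.adicCompletion F, w ≠ 0 ∧ Valued.v w ≤ 1 ∧
      Valued.v w ≤ Valued.v z := by
    rcases le_total (Valued.v z) 1 with h | h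
    · exact ⟨z, hz, h, le_rfl⟩
    · exact ⟨1, one_ne_zero, (map_one _).le, (map_one _).trans_le h⟩
  obtain ⟨f, hf⟩ := key w hw
  have hf1 : v.valuation F f ≤ 1 := by
    rw [← HeightOneSpectrum.valuedAdicCompletion_eq_valuation' v f,
      ← sub_add_cancel (f : v.adicCompletion F) x]
    exact (Valuation.map_add _ _ _).trans (max_le (hf.le.trans hw1) hx)
  obtain ⟨a, ha⟩ := HeightOneSpectrum.exists_valuation_sub_lt_of_integer v hf1
    (Units.mk0 (Valued.v w) ((Valuation.ne_zero_iff _).2 hw))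
  refine ⟨a, lt_of_lt_of_le ?_ hwz⟩
  rw [Valuation.map_sub_swap]
  have h1 : (((a : F) : v.adicCompletion F) - x) =
      (algebraMap F (Ad F) ((a : F) - f)) v + ((f : v.adicCompletion F) - x) := by
    rw [map_sub]
    exact (sub_add_sub_cancel _ _ _).symm
  rw [h1]
  refine Valuation.map_add_lt _ ?_ hf
  rw [valued_algebraMap]
  exact ha

/-- Strong approximation for integral adeles: `Ô = 𝓞 + n Ô`. -/
theorem IsIntegralAdele.exists_eq_add {x : Ad F} (hx : IsIntegralAdele x) {n : 𝓞 F} (hn : n ≠ 0) :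
    ∃ (m : 𝓞 F) (y : Ad F), IsIntegralAdele y ∧
      x = algebraMap F (Ad F) m + algebraMap F (Ad F) n * y := by
  classical
  have hS := finite_dvd (F := F) (I := Ideal.span {n}) (by simpa using hn)
  have hn' : (n : F) ≠ 0 := by simpa using hn
  have hnv : ∀ v : HeightOneSpectrum (𝓞 F), (algebraMap F (Ad F) n) v ≠ 0 := fun v => by
    rw [← Valuation.ne_zero_iff Valued.v, valued_algebraMap]
    exact (Valuation.ne_zero_iff _).2 hn'
  choose a ha using fun v => exists_valued_sub_lt v (x v) _ (hx v) (hnv v)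
  choose e he using fun v => WithZero.exists_exp_neg_natCast_lt
    ((Valuation.ne_zero_iff Valued.v).2 (hnv v))
  obtain ⟨m, hm⟩ := IsDedekindDomain.exists_forall_sub_mem_ideal (s := hS.toFinset)
    (fun v : HeightOneSpectrum (𝓞 F) => v.asIdeal) e (fun v _ => v.prime)
    (fun v _ w _ h h' => h (HeightOneSpectrum.ext h')) (fun v => a v)
  refine ⟨m, algebraMap F (Ad F) (n : F)⁻¹ * (x - algebraMap F (Ad F) m), fun v => ?_, ?_⟩
  · change Valued.v ((algebraMap F (Ad F) (n : F)⁻¹) v * (x v - (algebraMap F (Ad F) m) v)) ≤ 1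
    rw [map_mul, valued_algebraMap, map_inv₀, ← valued_algebraMap]
    have hpos : 0 < Valued.v ((algebraMap F (Ad F) n) v) :=
      zero_lt_iff.2 ((Valuation.ne_zero_iff Valued.v).2 (hnv v))
    rw [inv_mul_le_one₀ hpos]
    by_cases hv : v ∈ hS.toFinset
    · have h1 : x v - (algebraMap F (Ad F) m) v =
          (x v - (algebraMap F (Ad F) (a v)) v) -
            (algebraMap F (Ad F) ((m - a v : 𝓞 F) : F)) v := by
        rw [show ((m - a v : 𝓞 F) : F) = (m : F) - (a v : F) from rfl, map_sub]
        change _ = _ - ((algebraMap F (Ad F) m) v - (algebraMap F (Ad F) (a v)) v)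
        ring
      rw [h1]
      refine (Valuation.map_sub _ _ _).trans (max_le (ha v).le ?_)
      rw [valued_algebraMap]
      refine le_trans ?_ (he v).le
      rw [RingOfIntegers.coe_eq_algebraMap, HeightOneSpectrum.valuation_of_algebraMap,
        HeightOneSpectrum.intValuation_le_pow_iff_mem]
      exact hm v hv
    · have h2 : Valued.v ((algebraMap F (Ad F) n) v) = 1 := by
        rw [valued_algebraMap, RingOfIntegers.coe_eq_algebraMap,
          HeightOneSpectrum.valuation_eq_one_iff_notMem]
        intro h
        exact hv (hS.mem_toFinset.2 (Ideal.dvd_iff_le.2 ((Ideal.span_singleton_le_iff_mem _).2 h)))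
      rw [h2]
      exact (Valuation.map_sub _ _ _).trans (max_le (hx v) (isIntegralAdele_algebraMap m v))
  · rw [← mul_assoc, ← map_mul, mul_inv_cancel₀ hn', map_one, one_mul, add_sub_cancel]

/-- Strong approximation: `F̂ = F + n Ô`. -/
theorem exists_eq_add (x : Ad F) {n : 𝓞 F} (hn : n ≠ 0) :
    ∃ (f : F) (y : Ad F), IsIntegralAdele y ∧
      x = algebraMap F (Ad F) f + algebraMap F (Ad F) n * y := by
  obtain ⟨d, hd, hdx⟩ := exists_mul_integral x
  have hd' : (d : F) ≠ 0 := by simpa using hd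
  obtain ⟨m, y, hy, h⟩ := hdx.exists_eq_add (mul_ne_zero hd hn)
  refine ⟨(d : F)⁻¹ * m, y, hy, ?_⟩
  have h' : x = algebraMap F (Ad F) (d : F)⁻¹ * (algebraMap F (Ad F) d * x) := by
    rw [← mul_assoc, ← map_mul, inv_mul_cancel₀ hd', map_one, one_mul]
  rw [h', h, mul_add, ← map_mul, show ((d * n : 𝓞 F) : F) = (d : F) * (n : F) from rfl,
    ← mul_assoc, ← map_mul, inv_mul_cancel_left₀ hd']

end Adeles

/-! ### Lattices and their adelic closures -/

section Lattices

variable {F : Type*} [Field F] [NumberField F]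

/-- A full lattice meets every line: each vector has a nonzero integral multiple in it. -/
theorem exists_smul_mem_of_span_eq_top {V : Type*} [AddCommGroup V] [Module F V] [Module (𝓞 F) V]
    [IsScalarTower (𝓞 F) F V] {Λ : Submodule (𝓞 F) V} (hΛ : Submodule.span F (Λ : Set V) = ⊤)
    (x : V) : ∃ n : 𝓞 F, n ≠ 0 ∧ n • x ∈ Λ := by
  have hx : x ∈ Submodule.span F (Λ : Set V) := hΛ ▸ Submodule.mem_top
  induction hx using Submodule.span_induction with
  | mem x hx => exact ⟨1, one_ne_zero, by rwa [one_smul]⟩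
  | zero => exact ⟨1, one_ne_zero, by rw [smul_zero]; exact Λ.zero_mem⟩
  | add x y _ _ hx hy =>
    obtain ⟨n, hn, hnx⟩ := hx
    obtain ⟨m, hm, hmy⟩ := hy
    refine ⟨n * m, mul_ne_zero hn hm, ?_⟩
    rw [smul_add]
    refine Λ.add_mem ?_ ?_
    · rw [mul_comm, mul_smul]
      exact Λ.smul_mem _ hnx
    · rw [mul_smul]
      exact Λ.smul_mem _ hmy
  | smul c x _ hx =>
    obtain ⟨n, hn, hnx⟩ := hx
    obtain ⟨a, b, hb, rfl⟩ := IsFractionRing.div_surjective (A := 𝓞 F) c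
    have hb0 : (algebraMap (𝓞 F) F b) ≠ 0 := by
      simpa using nonZeroDivisors.ne_zero hb
    refine ⟨b * n, mul_ne_zero (nonZeroDivisors.ne_zero hb) hn, ?_⟩
    have : (b * n) • (algebraMap (𝓞 F) F a / algebraMap (𝓞 F) F b) • x = a • n • x := by
      rw [← algebraMap_smul F (b * n), ← algebraMap_smul F a, ← algebraMap_smul F n, smul_smul,
        smul_smul, map_mul]
      congr 1
      field_simp
    rw [this]
    exact Λ.smul_mem _ hnx

theorem exists_smul_mem_finite {V ι : Type*} [Finite ι] [AddCommGroup V] [Module F V]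
    [Module (𝓞 F) V] [IsScalarTower (𝓞 F) F V] {Λ : Submodule (𝓞 F) V}
    (hΛ : Submodule.span F (Λ : Set V) = ⊤) (x : ι → V) :
    ∃ n : 𝓞 F, n ≠ 0 ∧ ∀ i, n • x i ∈ Λ := by
  classical
  cases nonempty_fintype ι
  choose n hn h using fun i => exists_smul_mem_of_span_eq_top hΛ (x i)
  refine ⟨∏ i, n i, Finset.prod_ne_zero_iff.2 fun i _ => hn i, fun i => ?_⟩
  rw [← Finset.mul_prod_erase _ _ (Finset.mem_univ i), mul_comm, mul_smul]
  exact Λ.smul_mem _ (h i)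

/-- The `Ô`-span of the image of a subset of `V` under an additive map `V → W`. -/
def adelicSpan {V W : Type*} [AddCommGroup V] [AddCommGroup W] [Module (Ad F) W]
    (ι : V →+ W) (Λ : Set V) : Submodule (integralAdeles F) W :=
  Submodule.span (integralAdeles F) (ι '' Λ)

theorem integral_smul_mem {W : Type*} [AddCommGroup W] [Module (Ad F) W]
    (X : Submodule (integralAdeles F) W) {c : Ad F} (hc : IsIntegralAdele c) {z : W} (hz : z ∈ X) :
    c • z ∈ X :=
  X.smul_mem (⟨c, hc⟩ : integralAdeles F) hz

variable {V W n : Type*} [Finite n] [AddCommGroup V] [Module F V] [AddCommGroup W]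
  [Module (Ad F) W] {ι : V →+ W} (hι : ∀ (c : F) x, ι (c • x) = algebraMap F (Ad F) c • ι x)
  (bV : Module.Basis n F V) (bW : Module.Basis n (Ad F) W) (hb : ∀ i, ι (bV i) = bW i)

include hι hb in
theorem repr_map_eq (x : V) (i : n) : bW.repr (ι x) i = algebraMap F (Ad F) (bV.repr x i) := by
  cases nonempty_fintype n
  have : ι x = ∑ i, algebraMap F (Ad F) (bV.repr x i) • bW i := by
    conv_lhs => rw [← bV.sum_repr x, map_sum]
    simp only [hι, hb]
  rw [this, bW.repr_sum_self]

include hι in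
/-- Up to `d` times an integral vector, every element of the `Ô`-span of a lattice already lies in
the lattice. -/
theorem exists_approx_of_mem_adelicSpan [Module (𝓞 F) V] [IsScalarTower (𝓞 F) F V]
    (Λ : Submodule (𝓞 F) V) {z : W} (hz : z ∈ adelicSpan (F := F) ι (Λ : Set V))
    (d : 𝓞 F) (hd : d ≠ 0) :
    ∃ x ∈ Λ, ∃ w : W, (∀ i, IsIntegralAdele (bW.repr w i)) ∧
      z = ι x + algebraMap F (Ad F) d • w := by
  induction hz using Submodule.span_induction generalizing d with
  | mem z hz =>
    obtain ⟨x, hx, rfl⟩ := hz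
    exact ⟨x, hx, 0, fun i => by simpa using isIntegralAdele_zero, by simp⟩
  | zero => exact ⟨0, Λ.zero_mem, 0, fun i => by simpa using isIntegralAdele_zero, by simp⟩
  | add z z' _ _ hz hz' =>
    obtain ⟨x, hx, w, hw, rfl⟩ := hz d hd
    obtain ⟨x', hx', w', hw', rfl⟩ := hz' d hd
    refine ⟨x + x', Λ.add_mem hx hx', w + w', fun i => ?_, ?_⟩
    · rw [map_add]
      exact (hw i).add (hw' i)
    · rw [map_add, smul_add]
      abel
  | smul c z _ hz =>
    obtain ⟨x, hx, w, hw, rfl⟩ := hz d hd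
    obtain ⟨e, he, hex⟩ := exists_mul_integral_finite (fun i => bW.repr (ι x) i)
    obtain ⟨m, y, hy, hc⟩ := IsIntegralAdele.exists_eq_add (mem_integralAdeles.1 c.2)
      (mul_ne_zero hd he)
    refine ⟨m • x, Λ.smul_mem _ hx, y • algebraMap F (Ad F) e • ι x + (c : Ad F) • w,
      fun i => ?_, ?_⟩
    · rw [map_add, map_smul, map_smul, map_smul]
      exact (hy.mul (hex i)).add (IsIntegralAdele.mul c.2 (hw i))
    · change (c : Ad F) • (ι x + algebraMap F (Ad F) d • w) = _
      rw [← algebraMap_smul F m x, hι, smul_add, smul_add]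
      rw [show ((d * e : 𝓞 F) : F) = (d : F) * (e : F) from rfl, map_mul] at hc
      rw [smul_comm (c : Ad F) _ w, ← add_assoc]
      congr 1
      rw [hc, add_smul]
      congr 1
      simp only [smul_smul]
      congr 1
      ring

include hι hb in
/-- A full lattice is recovered from its adelic closure. -/
theorem mem_of_mem_adelicSpan [Module (𝓞 F) V] [IsScalarTower (𝓞 F) F V]
    {Λ : Submodule (𝓞 F) V} (hΛ : Submodule.span F (Λ : Set V) = ⊤) {x : V}
    (hx : ι x ∈ adelicSpan (F := F) ι (Λ : Set V)) : x ∈ Λ := by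
  cases nonempty_fintype n
  obtain ⟨d, hd, hdΛ⟩ := exists_smul_mem_finite hΛ bV
  obtain ⟨y, hy, w, hw, h⟩ := exists_approx_of_mem_adelicSpan hι bW Λ hx d hd
  have hd' : (d : F) ≠ 0 := by simpa using hd
  have key : ∀ i, ∃ m : 𝓞 F, bV.repr (x - y) i = m * d := by
    intro i
    have h1 : ι (x - y) = algebraMap F (Ad F) d • w := by rw [map_sub, h, add_sub_cancel_left]
    have h2 := repr_map_eq hι bV bW hb (x - y) i
    rw [h1, map_smul, Finsupp.smul_apply, smul_eq_mul] at h2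
    have h3 : bW.repr w i = algebraMap F (Ad F) ((d : F)⁻¹ * bV.repr (x - y) i) := by
      rw [map_mul, ← h2, ← mul_assoc, ← map_mul, inv_mul_cancel₀ hd', map_one, one_mul]
    obtain ⟨m, hm⟩ := isIntegralAdele_algebraMap_iff.1 (h3 ▸ hw i)
    exact ⟨m, by rw [hm]; field_simp⟩
  choose m hm using key
  have h4 : x - y ∈ Λ := by
    rw [← bV.sum_repr (x - y)]
    refine Λ.sum_mem fun i _ => ?_
    rw [hm, mul_smul]
    have := Λ.smul_mem (m i) (hdΛ i)
    rwa [← algebraMap_smul F (m i), ← algebraMap_smul F d] at this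
  simpa using Λ.add_mem h4 hy

include hι hb in
/-- Density of `V` in `W`. -/
theorem exists_approx (z : W) (d : 𝓞 F) (hd : d ≠ 0) :
    ∃ (x : V) (w : W), (∀ i, IsIntegralAdele (bW.repr w i)) ∧
      z = ι x + algebraMap F (Ad F) d • w := by
  cases nonempty_fintype n
  choose f y hy h using fun i => exists_eq_add (bW.repr z i) hd
  refine ⟨∑ i, f i • bV i, ∑ i, y i • bW i, fun i => ?_, ?_⟩
  · rw [bW.repr_sum_self]
    exact hy i
  · conv_lhs => rw [← bW.sum_repr z]
    rw [map_sum, Finset.smul_sum, ← Finset.sum_add_distrib]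
    refine Finset.sum_congr rfl fun i _ => ?_
    rw [h, add_smul, hι, hb, mul_smul]

include hι hb in
/-- An open `Ô`-submodule is the adelic closure of the lattice it cuts out. -/
theorem adelicSpan_preimage (X : Submodule (integralAdeles F) W) {d : 𝓞 F} (hd : d ≠ 0)
    (hX : ∀ i, algebraMap F (Ad F) d • bW i ∈ X) : adelicSpan ι (ι ⁻¹' (X : Set W)) = X := by
  cases nonempty_fintype n
  refine le_antisymm (Submodule.span_le.2 (Set.image_preimage_subset _ _)) fun z hz => ?_
  obtain ⟨x, w, hw, h⟩ := exists_approx hι bV bW hb z d hd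
  have h1 : algebraMap F (Ad F) d • w = ∑ i, bW.repr w i • algebraMap F (Ad F) d • bW i := by
    conv_lhs => rw [← bW.sum_repr w]
    rw [Finset.smul_sum]
    exact Finset.sum_congr rfl fun i _ => smul_comm _ _ _
  have h2 : algebraMap F (Ad F) d • w ∈ X := by
    rw [h1]
    exact X.sum_mem fun i _ => integral_smul_mem X (hw i) (hX i)
  have h3 : ι x ∈ X := by
    have : ι x = z - algebraMap F (Ad F) d • w := by rw [h, add_sub_cancel_right]
    rw [this]
    exact X.sub_mem hz h2
  rw [h]
  refine Submodule.add_mem _ (Submodule.subset_span ⟨x, h3, rfl⟩) ?_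
  rw [h1]
  refine Submodule.sum_mem _ fun i _ => integral_smul_mem _ (hw i) (Submodule.subset_span
    ⟨(d : F) • bV i, ?_, ?_⟩)
  · change ι _ ∈ X
    rw [hι, hb]
    exact hX i
  · rw [hι, hb]

end Lattices

/-! ### Adelic matrices and local principality -/

section LocalPrincipality

variable {F : Type*} [Field F] [NumberField F]

/-- A matrix of finite adeles all of whose entries are integral. -/
def IsIntegralMatrix (m : Matrix (Fin 2) (Fin 2) (Ad F)) : Prop := ∀ i j, IsIntegralAdele (m i j)

theorem isIntegralMatrix_one : IsIntegralMatrix (1 : Matrix (Fin 2) (Fin 2) (Ad F)) := fun i j => by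
  rw [Matrix.one_apply]
  split_ifs
  · exact isIntegralAdele_one
  · exact isIntegralAdele_zero

theorem IsIntegralMatrix.mul {m m' : Matrix (Fin 2) (Fin 2) (Ad F)} (hm : IsIntegralMatrix m)
    (hm' : IsIntegralMatrix m') : IsIntegralMatrix (m * m') := fun i j => by
  rw [Matrix.mul_apply, Fin.sum_univ_two]
  exact ((hm _ _).mul (hm' _ _)).add ((hm _ _).mul (hm' _ _))

theorem IsIntegralMatrix.add {m m' : Matrix (Fin 2) (Fin 2) (Ad F)} (hm : IsIntegralMatrix m)
    (hm' : IsIntegralMatrix m') : IsIntegralMatrix (m + m') := fun i j => (hm i j).add (hm' i j)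

theorem IsIntegralMatrix.smul {m : Matrix (Fin 2) (Fin 2) (Ad F)} (hm : IsIntegralMatrix m)
    {c : Ad F} (hc : IsIntegralAdele c) : IsIntegralMatrix (c • m) := fun i j => hc.mul (hm i j)

theorem IsIntegralMatrix.det {m : Matrix (Fin 2) (Fin 2) (Ad F)} (hm : IsIntegralMatrix m) :
    IsIntegralAdele m.det := by
  rw [Matrix.det_fin_two, sub_eq_add_neg]
  exact ((hm _ _).mul (hm _ _)).add ((hm _ _).mul (hm _ _)).neg

theorem isIntegralMatrix_algebraMap_smul (c : 𝓞 F) {m : Matrix (Fin 2) (Fin 2) (Ad F)}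
    (hm : IsIntegralMatrix m) : IsIntegralMatrix (algebraMap F (Ad F) c • m) :=
  hm.smul (isIntegralAdele_algebraMap c)

theorem isIntegralMatrix_of {a b c d : Ad F} (ha : IsIntegralAdele a) (hb : IsIntegralAdele b)
    (hc : IsIntegralAdele c) (hd : IsIntegralAdele d) : IsIntegralMatrix !![a, b; c, d] := by
  intro i j
  fin_cases i <;> fin_cases j
  exacts [ha, hb, hc, hd]

theorem exists_smul_isIntegralMatrix (m : Matrix (Fin 2) (Fin 2) (Ad F)) :
    ∃ n : 𝓞 F, n ≠ 0 ∧ IsIntegralMatrix (algebraMap F (Ad F) n • m) := by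
  obtain ⟨n, hn, h⟩ := exists_mul_integral_finite fun x : Fin 2 × Fin 2 => m x.1 x.2
  exact ⟨n, hn, fun i j => h (i, j)⟩

/-- The component of an adelic matrix at a place. -/
def evalMatrix (v : HeightOneSpectrum (𝓞 F)) :
    Matrix (Fin 2) (Fin 2) (Ad F) →+* Matrix (Fin 2) (Fin 2) (v.adicCompletion F) :=
  (evalAdele v).mapMatrix

theorem evalMatrix_det (v : HeightOneSpectrum (𝓞 F)) (m : Matrix (Fin 2) (Fin 2) (Ad F)) :
    (evalMatrix v m).det = m.det v :=
  ((evalAdele v).map_det m).symm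

theorem mul_apply_eq_mulVec (v : HeightOneSpectrum (𝓞 F)) (m m' : Matrix (Fin 2) (Fin 2) (Ad F))
    (i k : Fin 2) : (m * m') i k v = ((evalMatrix v m).mulVec fun i => m' i k v) i :=
  congrFun (congrFun (map_mul (evalMatrix v) m m') i) k

theorem evalMatrix_ext {m m' : Matrix (Fin 2) (Fin 2) (Ad F)}
    (h : ∀ v, evalMatrix v m = evalMatrix v m') : m = m' := by
  refine Matrix.ext fun i j => FiniteAdeleRing.ext _ fun v => ?_
  exact congrFun (congrFun (h v) i) j

/-- The invertible adelic matrix with prescribed components. -/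
def mkGL (g : ∀ v : HeightOneSpectrum (𝓞 F), (Matrix (Fin 2) (Fin 2) (v.adicCompletion F))ˣ)
    (h : ∀ i j, {v | ¬ Valued.v ((g v).1 i j) ≤ 1}.Finite)
    (h' : ∀ i j, {v | ¬ Valued.v ((g v)⁻¹.1 i j) ≤ 1}.Finite) :
    (Matrix (Fin 2) (Fin 2) (Ad F))ˣ where
  val := Matrix.of fun i j => mkAdele (fun v => (g v).1 i j) (h i j)
  inv := Matrix.of fun i j => mkAdele (fun v => (g v)⁻¹.1 i j) (h' i j)
  val_inv := evalMatrix_ext fun v => by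
    rw [map_mul, map_one]
    exact (g v).mul_inv
  inv_val := evalMatrix_ext fun v => by
    rw [map_mul, map_one]
    exact (g v).inv_mul

theorem evalMatrix_mkGL (g) (h) (h') (v : HeightOneSpectrum (𝓞 F)) :
    evalMatrix v (mkGL g h h').1 = (g v).1 := rfl

section Local

variable {v : HeightOneSpectrum (𝓞 F)}

/-- A bounded nonzero submodule of a local field is a ball. -/
theorem exists_mem_iff_valued_le (J : Submodule (v.adicCompletionIntegers F) (v.adicCompletion F))
    {n : v.adicCompletion F} (hn : n ≠ 0) (hJ : ∀ x ∈ J, Valued.v (n * x) ≤ 1)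
    (hJ0 : ∃ x ∈ J, x ≠ 0) :
    ∃ t : v.adicCompletion F, t ≠ 0 ∧ ∀ x, x ∈ J ↔ Valued.v x ≤ Valued.v t := by
  let f : v.adicCompletionIntegers F →ₗ[v.adicCompletionIntegers F] v.adicCompletion F :=
    LinearMap.toSpanSingleton _ _ n⁻¹
  have hf : ∀ y, f y = y * n⁻¹ := fun y => rfl
  obtain ⟨g, hg⟩ := (IsPrincipalIdealRing.principal (J.comap f)).principal
  have hmem : ∀ x, x ∈ J ↔ ∃ o : v.adicCompletionIntegers F, x = o * (g * n⁻¹) := by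
    intro x
    constructor
    · intro hx
      have h1 : (⟨n * x, hJ x hx⟩ : v.adicCompletionIntegers F) ∈ J.comap f := by
        rw [Submodule.mem_comap, hf]
        change n * x * n⁻¹ ∈ J
        rwa [mul_comm n, mul_inv_cancel_right₀ hn]
      rw [hg, Submodule.mem_span_singleton] at h1
      obtain ⟨o, ho⟩ := h1
      refine ⟨o, ?_⟩
      have := congrArg (fun z : v.adicCompletionIntegers F => (z : v.adicCompletion F)) ho
      change (o : v.adicCompletion F) * g = n * x at this
      rw [← mul_assoc, this, mul_comm n, mul_inv_cancel_right₀ hn]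
    · rintro ⟨o, rfl⟩
      have h1 : g ∈ J.comap f := hg ▸ Submodule.mem_span_singleton_self g
      exact J.smul_mem o h1
  obtain ⟨x, hx, hx0⟩ := hJ0
  have hg0 : (g * n⁻¹ : v.adicCompletion F) ≠ 0 := by
    intro h
    obtain ⟨o, ho⟩ := (hmem x).1 hx
    exact hx0 (by rw [ho, h, mul_zero])
  refine ⟨g * n⁻¹, hg0, fun x => (hmem x).trans ⟨?_, fun h => ?_⟩⟩
  · rintro ⟨o, rfl⟩
    rw [map_mul]
    exact mul_le_of_le_one_left' ((HeightOneSpectrum.mem_adicCompletionIntegers (𝓞 F) F v).1 o.2)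
  · refine ⟨⟨x / (g * n⁻¹), ?_⟩, (div_mul_cancel₀ x hg0).symm⟩
    rw [HeightOneSpectrum.mem_adicCompletionIntegers, map_div₀]
    exact div_le_one_of_le₀ h zero_le

/-- A lattice in the plane over a local field is free, with a triangular basis. -/
theorem exists_basis_matrix
    (Λ : Submodule (v.adicCompletionIntegers F) (Fin 2 → v.adicCompletion F))
    {n : v.adicCompletion F} (hn : n ≠ 0) (hΛ : ∀ w ∈ Λ, ∀ i, Valued.v (n * w i) ≤ 1)
    (hΛ' : ∀ w : Fin 2 → v.adicCompletion F, (∀ i, Valued.v (w i) ≤ 1) → n • w ∈ Λ) :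
    ∃ g : (Matrix (Fin 2) (Fin 2) (v.adicCompletion F))ˣ,
      ∀ w, w ∈ Λ ↔ ∀ i, Valued.v ((g⁻¹.1.mulVec w) i) ≤ 1 := by
  obtain ⟨a, ha0, ha⟩ := exists_mem_iff_valued_le
    (Λ.comap (LinearMap.single (v.adicCompletionIntegers F)
      (fun _ : Fin 2 => v.adicCompletion F) 0))
    hn (fun x hx => by simpa using hΛ _ hx 0)
    ⟨n, by
      have := hΛ' (Pi.single 0 1) (fun i => by fin_cases i <;> simp)
      rw [← Pi.single_smul] at this
      simpa using this, hn⟩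
  obtain ⟨d, hd0, hd⟩ := exists_mem_iff_valued_le
    (Λ.map (LinearMap.proj (R := v.adicCompletionIntegers F)
      (φ := fun _ : Fin 2 => v.adicCompletion F) 1))
    hn (fun x hx => by
      obtain ⟨w, hw, rfl⟩ := hx
      exact hΛ w hw 1)
    ⟨n, ⟨n • Pi.single 1 1, hΛ' (Pi.single 1 1) (fun i => by fin_cases i <;> simp), by simp⟩, hn⟩
  obtain ⟨w₀, hw₀, hw₀d⟩ := (hd d).2 le_rfl
  change w₀ 1 = d at hw₀d
  set b := w₀ 0
  refine ⟨⟨!![a, b; 0, d], !![a⁻¹, -b * a⁻¹ * d⁻¹; 0, d⁻¹], ?_, ?_⟩, fun w => ?_⟩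
  · refine Matrix.ext fun i j => ?_
    fin_cases i <;> fin_cases j <;> simp [Matrix.mul_apply, Fin.sum_univ_two, ha0, hd0]
    field_simp
    ring
  · refine Matrix.ext fun i j => ?_
    fin_cases i <;> fin_cases j <;> simp [Matrix.mul_apply, Fin.sum_univ_two, ha0, hd0]
    field_simp
    ring
  · change _ ↔ ∀ i, Valued.v ((!![a⁻¹, -b * a⁻¹ * d⁻¹; 0, d⁻¹].mulVec w) i) ≤ 1
    rw [Fin.forall_fin_two]
    have e0 : (!![a⁻¹, -b * a⁻¹ * d⁻¹; 0, d⁻¹].mulVec w) 0 = (w 0 - w 1 * d⁻¹ * b) / a := by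
      simp [Matrix.mulVec, dotProduct, Fin.sum_univ_two]
      field_simp
      ring
    have e1 : (!![a⁻¹, -b * a⁻¹ * d⁻¹; 0, d⁻¹].mulVec w) 1 = w 1 / d := by
      simp [Matrix.mulVec, dotProduct, Fin.sum_univ_two]
      field_simp
    have hpos : ∀ {t : v.adicCompletion F}, t ≠ 0 → 0 < Valued.v t := fun ht =>
      zero_lt_iff.2 ((Valuation.ne_zero_iff Valued.v).2 ht)
    rw [e0, e1, map_div₀, map_div₀, div_le_one₀ (hpos ha0), div_le_one₀ (hpos hd0), ← ha, ← hd]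
    have hsub : ∀ h : Valued.v (w 1) ≤ Valued.v d,
        (w ∈ Λ ↔ w 0 - w 1 * d⁻¹ * b ∈ Λ.comap (LinearMap.single (v.adicCompletionIntegers F)
          (fun _ : Fin 2 => v.adicCompletion F) 0)) := by
      intro h
      have ho : Valued.v (w 1 * d⁻¹) ≤ 1 := by
        rw [← div_eq_mul_inv, map_div₀, div_le_one₀ (hpos hd0)]
        exact h
      have h2 := Λ.smul_mem (⟨w 1 * d⁻¹, ho⟩ : v.adicCompletionIntegers F) hw₀
      have h3 : (Pi.single 0 (w 0 - w 1 * d⁻¹ * b) : Fin 2 → v.adicCompletion F) =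
          w - (⟨w 1 * d⁻¹, ho⟩ : v.adicCompletionIntegers F) • w₀ := by
        funext i
        fin_cases i
        · exact (Pi.single_eq_same _ _).trans rfl
        · refine (Pi.single_eq_of_ne (by decide) _).trans ?_
          change 0 = w 1 - w 1 * d⁻¹ * w₀ 1
          rw [hw₀d, inv_mul_cancel_right₀ hd0, sub_self]
      rw [Submodule.mem_comap, LinearMap.single_apply, h3]
      exact (Submodule.sub_mem_iff_left Λ h2).symm
    constructor
    · intro hw
      have h1 : w 1 ∈ Λ.map (LinearMap.proj (R := v.adicCompletionIntegers F)
        (φ := fun _ : Fin 2 => v.adicCompletion F) 1) := ⟨w, hw, rfl⟩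
      exact ⟨(hsub ((hd _).1 h1)).1 hw, h1⟩
    · rintro ⟨h0, h1⟩
      exact (hsub ((hd _).1 h1)).2 h0

end Local

/-- The finite adele supported at one place. -/
def singleAdele (v : HeightOneSpectrum (𝓞 F)) : v.adicCompletion F →+ Ad F where
  toFun x := by
    classical
    exact mkAdele (Pi.single v x) (by
      refine (Set.finite_singleton v).subset fun w hw => ?_
      by_contra h
      refine hw ?_
      rw [Pi.single_eq_of_ne h, map_zero]
      exact zero_le)
  map_zero' := FiniteAdeleRing.ext _ fun w => by
    classical
    rw [adele_zero_apply, mkAdele_apply, Pi.single_zero, Pi.zero_apply]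
  map_add' x y := FiniteAdeleRing.ext _ fun w => by
    classical
    rw [adele_add_apply, mkAdele_apply, mkAdele_apply, mkAdele_apply, Pi.single_add, Pi.add_apply]

theorem singleAdele_same (v : HeightOneSpectrum (𝓞 F)) (x : v.adicCompletion F) :
    singleAdele v x v = x := by
  classical
  exact Pi.single_eq_same v x

theorem singleAdele_of_ne {v w : HeightOneSpectrum (𝓞 F)} (h : w ≠ v) (x : v.adicCompletion F) :
    singleAdele v x w = 0 := by
  classical
  exact Pi.single_eq_of_ne h x

theorem isIntegralAdele_singleAdele {v : HeightOneSpectrum (𝓞 F)} {x : v.adicCompletion F}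
    (hx : Valued.v x ≤ 1) : IsIntegralAdele (singleAdele v x) := fun w => by
  by_cases h : w = v
  · subst h
    rw [singleAdele_same]
    exact hx
  · rw [singleAdele_of_ne h]
    exact zero_mem _

theorem mul_singleAdele (v : HeightOneSpectrum (𝓞 F)) (x : Ad F) (y : v.adicCompletion F) :
    x * singleAdele v y = singleAdele v (x v * y) := FiniteAdeleRing.ext _ fun w => by
  rw [adele_mul_apply]
  by_cases h : w = v
  · subst h
    rw [singleAdele_same, singleAdele_same]
  · rw [singleAdele_of_ne h, singleAdele_of_ne h, mul_zero]

/-- The adelic matrix with first column a given vector at `v` and zeros elsewhere. -/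
def columnMatrix (v : HeightOneSpectrum (𝓞 F)) (w : Fin 2 → v.adicCompletion F) :
    Matrix (Fin 2) (Fin 2) (Ad F) :=
  Matrix.of fun i j => if j = 0 then singleAdele v (w i) else 0

theorem columnMatrix_eq_mul (v : HeightOneSpectrum (𝓞 F)) (z : Matrix (Fin 2) (Fin 2) (Ad F))
    (k : Fin 2) : columnMatrix v (fun i => z i k v) =
      z * Matrix.of fun i j => if i = k ∧ j = 0 then singleAdele v 1 else 0 := by
  refine Matrix.ext fun i j => ?_
  rw [Matrix.mul_apply, Fin.sum_univ_two]
  fin_cases k <;> fin_cases j <;> simp [columnMatrix, mul_singleAdele]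

theorem singleAdele_smul_eq (v : HeightOneSpectrum (𝓞 F)) (z : Matrix (Fin 2) (Fin 2) (Ad F)) :
    singleAdele v 1 • z = columnMatrix v (fun i => z i 0 v) +
      columnMatrix v (fun i => z i 1 v) * !![0, 1; 0, 0] := by
  refine Matrix.ext fun i j => ?_
  rw [Matrix.add_apply, Matrix.mul_apply, Fin.sum_univ_two]
  fin_cases j <;> simp [columnMatrix, mul_comm (singleAdele v 1), mul_singleAdele]

variable (X : Submodule (integralAdeles F) (Matrix (Fin 2) (Fin 2) (Ad F)))

/-- The columns at `v` of the matrices in `X`. -/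
def columnLattice (v : HeightOneSpectrum (𝓞 F)) :
    Submodule (v.adicCompletionIntegers F) (Fin 2 → v.adicCompletion F) where
  carrier := {w | columnMatrix v w ∈ X}
  add_mem' {w w'} h h' := by
    have : columnMatrix v (w + w') = columnMatrix v w + columnMatrix v w' :=
      Matrix.ext fun i j => by
        rw [Matrix.add_apply]
        simp only [columnMatrix, Matrix.of_apply, Pi.add_apply, map_add]
        split_ifs
        · rfl
        · exact (add_zero _).symm
    change columnMatrix v (w + w') ∈ X
    rw [this]
    exact X.add_mem h h'
  zero_mem' := by
    have : columnMatrix v 0 = 0 := Matrix.ext fun i j => by simp [columnMatrix]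
    change columnMatrix v 0 ∈ X
    rw [this]
    exact X.zero_mem
  smul_mem' c w h := by
    have : columnMatrix v (c • w) = singleAdele v (c : v.adicCompletion F) • columnMatrix v w :=
      Matrix.ext fun i j => by
        rw [Matrix.smul_apply]
        simp only [columnMatrix, Matrix.of_apply]
        split_ifs
        · rw [smul_eq_mul, mul_singleAdele, singleAdele_same]
          rfl
        · exact (smul_zero _).symm
    change columnMatrix v (c • w) ∈ X
    rw [this]
    exact integral_smul_mem X (isIntegralAdele_singleAdele c.2) h

variable {X}

theorem mem_columnLattice {v : HeightOneSpectrum (𝓞 F)} {w : Fin 2 → v.adicCompletion F} :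
    w ∈ columnLattice X v ↔ columnMatrix v w ∈ X := Iff.rfl

/-- A full right `M₂(Ô)`-module in `M₂(F̂)` is principal. -/
theorem exists_generator (hX : ∀ z ∈ X, ∀ m, IsIntegralMatrix m → z * m ∈ X) {n : 𝓞 F}
    (hn : n ≠ 0) (hnX : ∀ m, IsIntegralMatrix m → algebraMap F (Ad F) n • m ∈ X)
    (hXn : ∀ z ∈ X, IsIntegralMatrix (algebraMap F (Ad F) n • z)) :
    ∃ g : (Matrix (Fin 2) (Fin 2) (Ad F))ˣ, ∀ z, z ∈ X ↔ IsIntegralMatrix (g⁻¹.1 * z) := by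
  classical
  have hn' : (n : F) ≠ 0 := by simpa using hn
  have hS := finite_dvd (F := F) (I := Ideal.span {n}) (by simpa using hn)
  set S := hS.toFinset
  have hnv : ∀ v : HeightOneSpectrum (𝓞 F), (algebraMap F (Ad F) n) v ≠ 0 := fun v => by
    rw [← Valuation.ne_zero_iff Valued.v, valued_algebraMap]
    exact (Valuation.ne_zero_iff _).2 hn'
  have hval : ∀ v, v ∉ S → Valued.v ((algebraMap F (Ad F) n) v) = 1 := fun v hv => by
    rw [valued_algebraMap, RingOfIntegers.coe_eq_algebraMap,
      HeightOneSpectrum.valuation_eq_one_iff_notMem]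
    intro h
    exact hv (hS.mem_toFinset.2 (Ideal.dvd_iff_le.2 ((Ideal.span_singleton_le_iff_mem _).2 h)))
  have hcolint : ∀ v (w : Fin 2 → v.adicCompletion F), (∀ i, Valued.v (w i) ≤ 1) →
      IsIntegralMatrix (columnMatrix v w) := fun v w hw i j => by
    rw [columnMatrix, Matrix.of_apply]
    split_ifs
    · exact isIntegralAdele_singleAdele (hw i)
    · exact isIntegralAdele_zero
  have hΛ : ∀ v, ∀ w ∈ columnLattice X v, ∀ i,
      Valued.v ((algebraMap F (Ad F) n) v * w i) ≤ 1 := fun v w hw i => by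
    have := hXn _ (mem_columnLattice.1 hw) i 0 v
    rw [Matrix.smul_apply, smul_eq_mul, adele_mul_apply, columnMatrix, Matrix.of_apply, if_pos rfl,
      singleAdele_same] at this
    exact this
  have hΛ' : ∀ v (w : Fin 2 → v.adicCompletion F), (∀ i, Valued.v (w i) ≤ 1) →
      (algebraMap F (Ad F) n) v • w ∈ columnLattice X v := fun v w hw => by
    have := hnX _ (hcolint v w hw)
    rw [mem_columnLattice]
    convert this using 1
    refine Matrix.ext fun i j => ?_
    rw [Matrix.smul_apply]
    simp only [columnMatrix, Matrix.of_apply]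
    split_ifs
    · rw [smul_eq_mul, mul_singleAdele]
      rfl
    · exact (smul_zero _).symm
  choose g hg using fun v => exists_basis_matrix (columnLattice X v) (hnv v) (hΛ v) (hΛ' v)
  have hg' : ∀ v w, w ∈ columnLattice X v ↔
      ∀ i, Valued.v (((if v ∈ S then g v else 1)⁻¹.1.mulVec w) i) ≤ 1 := by
    intro v w
    split_ifs with h
    · exact hg v w
    · rw [inv_one, Units.val_one, Matrix.one_mulVec]
      refine ⟨fun hw i => ?_, fun hw => ?_⟩
      · have := hΛ v w hw i
        rwa [map_mul, hval v h, one_mul] at this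
      · have := hΛ' v ((algebraMap F (Ad F) n v)⁻¹ • w) (fun i => by
          rw [Pi.smul_apply, smul_eq_mul, map_mul, map_inv₀, hval v h, inv_one, one_mul]
          exact hw i)
        rwa [smul_smul, mul_inv_cancel₀ (hnv v), one_smul] at this
  have hfin : ∀ (f : ∀ v : HeightOneSpectrum (𝓞 F), v.adicCompletion F),
      (∀ v, v ∉ S → Valued.v (f v) ≤ 1) → {v | ¬ Valued.v (f v) ≤ 1}.Finite := fun f hf =>
    S.finite_toSet.subset fun v hv => by
      by_contra h
      exact hv (hf v h)
  have hone : ∀ v : HeightOneSpectrum (𝓞 F), ∀ i j,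
      Valued.v ((1 : Matrix (Fin 2) (Fin 2) (v.adicCompletion F)) i j) ≤ 1 := fun v i j => by
    rw [Matrix.one_apply]
    split_ifs <;> simp
  set G := mkGL (fun v => if v ∈ S then g v else 1)
    (fun i j => hfin _ fun v hv => by rw [if_neg hv]; exact hone v i j)
    (fun i j => hfin _ fun v hv => by rw [if_neg hv, inv_one]; exact hone v i j) with hG
  have hGv : ∀ v, evalMatrix v G⁻¹.1 = (if v ∈ S then g v else 1)⁻¹.1 := fun v => rfl
  clear_value G
  refine ⟨G, fun z => ?_⟩
  have hcols : (∀ v k, (fun i => z i k v) ∈ columnLattice X v) ↔ IsIntegralMatrix (G⁻¹.1 * z) := by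
    refine ⟨fun h i k v => ?_, fun h v k => (hg' v _).2 fun i => ?_⟩
    · have := (hg' v _).1 (h v k) i
      rwa [← hGv, ← mul_apply_eq_mulVec] at this
    · have := h i k v
      rwa [mul_apply_eq_mulVec, hGv] at this
  rw [← hcols]
  refine ⟨fun hz v k => ?_, fun h => ?_⟩
  · rw [mem_columnLattice, columnMatrix_eq_mul]
    refine hX z hz _ fun i j => ?_
    rw [Matrix.of_apply]
    split_ifs
    · exact isIntegralAdele_singleAdele (map_one _).le
    · exact isIntegralAdele_zero
  · have h1 : ∀ v, singleAdele v 1 • z ∈ X := fun v => by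
      rw [singleAdele_smul_eq]
      exact X.add_mem (h v 0) (hX _ (h v 1) _ (isIntegralMatrix_of isIntegralAdele_zero
        isIntegralAdele_one isIntegralAdele_zero isIntegralAdele_zero))
    -- the idempotent that cuts out the finitely many places where `X` may differ from `M₂(𝓞_v)`
    set e : Ad F := ∑ v ∈ S, singleAdele v 1 with he
    have h2 : e • z ∈ X := by
      rw [he, Finset.sum_smul]
      exact X.sum_mem fun v _ => h1 v
    have hev : ∀ v ∈ S, e v = 1 := fun v hv => by
      change evalAdele v e = 1
      rw [he, map_sum, Finset.sum_eq_single_of_mem v hv]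
      · exact singleAdele_same v 1
      · exact fun w _ hw => singleAdele_of_ne hw.symm _
    have hev' : ∀ v, v ∉ S → e v = 0 := fun v hv => by
      change evalAdele v e = 0
      rw [he, map_sum]
      exact Finset.sum_eq_zero fun w hw =>
        singleAdele_of_ne (fun h : v = w => hv (h.symm ▸ hw)) _
    have h3 : (1 - e) • z ∈ X := by
      have hy := hnX (algebraMap F (Ad F) (n : F)⁻¹ • (1 - e) • z) fun i j v => by
        change (algebraMap F (Ad F) (n : F)⁻¹) v * ((1 - e v) * z i j v) ∈ _
        rw [HeightOneSpectrum.mem_adicCompletionIntegers]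
        by_cases hv : v ∈ S
        · rw [hev v hv, sub_self, zero_mul, mul_zero, map_zero]
          exact zero_le
        · rw [hev' v hv, sub_zero, one_mul, map_mul, valued_algebraMap, map_inv₀,
            ← valued_algebraMap, hval v hv, inv_one, one_mul]
          have := hΛ v _ (h v j) i
          rwa [map_mul, hval v hv, one_mul] at this
      rwa [smul_smul, ← map_mul, mul_inv_cancel₀ hn', map_one, one_smul] at hy
    have h4 : z = e • z + (1 - e) • z := by rw [← add_smul, add_sub_cancel, one_smul]
    rw [h4]
    exact X.add_mem h2 h3

end LocalPrincipality

/-! ### The splitting and the reduced norm -/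

section ReducedNorm

variable {F : Type*} [Field F] [NumberField F] {B : Type*} [Ring B] [Algebra F B]
  (θ : AdB F B ≃ₐ[Ad F] Matrix (Fin 2) (Fin 2) (Ad F))

/-- The ring homomorphism `B → M₂(F̂)` given by the splitting `θ`. -/
def adelicMatrix : B →+* Matrix (Fin 2) (Fin 2) (Ad F) :=
  ((θ : AdB F B →+* Matrix (Fin 2) (Fin 2) (Ad F))).comp
    ((Algebra.TensorProduct.includeRight (R := F) (A := Ad F) (B := B) : B →ₐ[F] AdB F B) :
      B →+* AdB F B)

theorem adelicMatrix_apply (x : B) : adelicMatrix θ x = θ ((1 : Ad F) ⊗ₜ[F] x) := rfl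

theorem adelicMatrix_smul (c : F) (x : B) :
    adelicMatrix θ (c • x) = algebraMap F (Ad F) c • adelicMatrix θ x := by
  rw [adelicMatrix_apply, adelicMatrix_apply, ← map_smul, TensorProduct.tmul_smul,
    TensorProduct.smul_tmul', TensorProduct.smul_tmul', Algebra.smul_def, smul_eq_mul]

theorem theta_tmul (c : Ad F) (x : B) : θ (c ⊗ₜ[F] x) = c • adelicMatrix θ x := by
  rw [adelicMatrix_apply, ← map_smul, TensorProduct.smul_tmul', smul_eq_mul, mul_one]

/-- The basis of `M₂(F̂)` over `F̂` given by a basis of `B` over `F`. -/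
@[irreducible] def adelicBasis {n : Type*} (b : Module.Basis n F B) :
    Module.Basis n (Ad F) (Matrix (Fin 2) (Fin 2) (Ad F)) :=
  (b.baseChange (Ad F)).map θ.toLinearEquiv

theorem adelicMatrix_basis {n : Type*} (b : Module.Basis n F B) (i : n) :
    (adelicMatrix θ).toAddMonoidHom (b i) = adelicBasis θ b i := by
  rw [adelicBasis, Module.Basis.map_apply, Module.Basis.baseChange_apply]
  rfl

/-- The trace of left multiplication on `2 × 2` matrices, which links the reduced trace, defined
through the regular representation, to the trace of matrices. -/
theorem trace_mulLeft_matrix {A : Type*} [CommRing A] (m : Matrix (Fin 2) (Fin 2) A) :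
    LinearMap.trace A _ (LinearMap.mulLeft A m) = 2 * m.trace := by
  rw [LinearMap.trace_eq_matrix_trace A (Matrix.stdBasis A (Fin 2) (Fin 2)), Matrix.trace,
    Fintype.sum_prod_type]
  simp only [Matrix.diag_apply, LinearMap.toMatrix_apply, LinearMap.mulLeft_apply,
    Matrix.stdBasis_eq_single, Fin.sum_univ_two, Matrix.trace]
  simp [Matrix.stdBasis, Matrix.mul_apply, Matrix.single]
  ring

variable [Module.Finite F B]

theorem algebraMap_trace_mulLeft (x : B) :
    algebraMap F (Ad F) (LinearMap.trace F B (LinearMap.mulLeft F x)) =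
      2 * (adelicMatrix θ x).trace := by
  obtain ⟨n, b⟩ : Σ n : ℕ, Module.Basis (Fin n) F B := ⟨_, Module.finBasis F B⟩
  have key : ∀ i, algebraMap F (Ad F) (b.repr (x * b i) i) =
      (adelicBasis θ b).repr (adelicMatrix θ x * adelicBasis θ b i) i := fun i => by
    rw [← adelicMatrix_basis]
    refine (repr_map_eq (adelicMatrix_smul θ) b (adelicBasis θ b)
      (adelicMatrix_basis θ b) (x * b i) i).symm.trans ?_
    exact congrArg (fun z => (adelicBasis θ b).repr z i) (map_mul (adelicMatrix θ) x (b i))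
  rw [← trace_mulLeft_matrix, LinearMap.trace_eq_matrix_trace F b,
    LinearMap.trace_eq_matrix_trace (Ad F) (adelicBasis θ b), Matrix.trace, Matrix.trace, map_sum]
  refine Finset.sum_congr rfl fun i _ => ?_
  rw [Matrix.diag_apply, Matrix.diag_apply, LinearMap.toMatrix_apply, LinearMap.toMatrix_apply,
    LinearMap.mulLeft_apply, LinearMap.mulLeft_apply]
  exact key i

theorem algebraMap_half : algebraMap F (Ad F) (2⁻¹ : F) * 2 = 1 := by
  rw [← map_ofNat (algebraMap F (Ad F)) 2, ← map_mul, inv_mul_cancel₀ two_ne_zero, map_one]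

theorem algebraMap_reducedTrace (x : B) :
    algebraMap F (Ad F) (reducedTrace F x) = (adelicMatrix θ x).trace := by
  rw [reducedTrace, div_eq_inv_mul, map_mul, algebraMap_trace_mulLeft θ, ← mul_assoc,
    algebraMap_half, one_mul]

/-- The reduced norm is the determinant under any splitting. -/
theorem algebraMap_reducedNorm (x : B) :
    algebraMap F (Ad F) (reducedNorm F x) = (adelicMatrix θ x).det := by
  rw [reducedNorm, div_eq_inv_mul, map_mul, map_sub, map_pow, algebraMap_reducedTrace θ,
    algebraMap_reducedTrace θ, map_pow, Matrix.det_fin_two, Matrix.trace_fin_two,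
    Matrix.trace_fin_two, sq (adelicMatrix θ x)]
  simp only [Matrix.mul_apply, Fin.sum_univ_two]
  linear_combination ((adelicMatrix θ x) 0 0 * (adelicMatrix θ x) 1 1 -
    (adelicMatrix θ x) 0 1 * (adelicMatrix θ x) 1 0) * algebraMap_half (F := F)

end ReducedNorm

/-! ### Products of adelic closures -/

section Span

variable {F : Type*} [Field F] [NumberField F]

theorem mul_mem_adelicSpan {V W : Type*} [Ring V] [Ring W] [Algebra (Ad F) W] (ι : V →+* W)
    {S T P : Set V} (h : ∀ x ∈ S, ∀ y ∈ T, x * y ∈ P) {z w : W}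
    (hz : z ∈ adelicSpan (F := F) ι.toAddMonoidHom S)
    (hw : w ∈ adelicSpan (F := F) ι.toAddMonoidHom T) :
    z * w ∈ adelicSpan (F := F) ι.toAddMonoidHom P := by
  induction hz using Submodule.span_induction with
  | zero => rw [zero_mul]; exact Submodule.zero_mem _
  | add z z' _ _ hz hz' => rw [add_mul]; exact Submodule.add_mem _ hz hz'
  | smul c z _ hz =>
    change ((c : Ad F) • z) * w ∈ _
    rw [smul_mul_assoc]
    exact integral_smul_mem _ c.2 hz
  | mem z hz =>
    obtain ⟨x, hx, rfl⟩ := hz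
    induction hw using Submodule.span_induction with
    | zero => rw [mul_zero]; exact Submodule.zero_mem _
    | add z z' _ _ hz hz' => rw [mul_add]; exact Submodule.add_mem _ hz hz'
    | smul c z _ hz =>
      change _ * ((c : Ad F) • z) ∈ _
      rw [mul_smul_comm]
      exact integral_smul_mem _ c.2 hz
    | mem w hw =>
      obtain ⟨y, hy, rfl⟩ := hw
      exact Submodule.subset_span ⟨x * y, h x hx y hy, map_mul ι x y⟩

theorem adelicSpan_mono {V W : Type*} [AddCommGroup V] [AddCommGroup W] [Module (Ad F) W]
    (ι : V →+ W) {S T : Set V} (h : S ⊆ T) : adelicSpan (F := F) ι S ≤ adelicSpan (F := F) ι T :=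
  Submodule.span_mono (Set.image_mono h)

end Span

/-! ### Right ideals as lattices of adelic matrices -/

section Lattice

variable {F : Type*} [Field F] [NumberField F] {B : Type*} [Ring B] [Algebra F B]
  (θ : AdB F B ≃ₐ[Ad F] Matrix (Fin 2) (Fin 2) (Ad F))

/-- The lattice `α M₂(Ô)` in `M₂(F̂)`. -/
def adelicLattice (α : (Matrix (Fin 2) (Fin 2) (Ad F))ˣ) :
    Submodule (integralAdeles F) (Matrix (Fin 2) (Fin 2) (Ad F)) where
  carrier := {z | IsIntegralMatrix (α⁻¹.1 * z)}
  add_mem' {z w} hz hw := by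
    change IsIntegralMatrix _
    rw [mul_add]
    exact IsIntegralMatrix.add hz hw
  zero_mem' := by
    change IsIntegralMatrix _
    rw [mul_zero]
    exact fun _ _ => isIntegralAdele_zero
  smul_mem' c z hz := by
    change IsIntegralMatrix (α⁻¹.1 * ((c : Ad F) • z))
    rw [mul_smul_comm]
    exact IsIntegralMatrix.smul hz c.2

theorem mem_adelicLattice {α : (Matrix (Fin 2) (Fin 2) (Ad F))ˣ}
    {z : Matrix (Fin 2) (Fin 2) (Ad F)} :
    z ∈ adelicLattice α ↔ IsIntegralMatrix (α⁻¹.1 * z) := Iff.rfl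

/-- The lattice `B ∩ α M₂(Ô)`. -/
def latticeOf (α : (Matrix (Fin 2) (Fin 2) (Ad F))ˣ) : Submodule (𝓞 F) B where
  carrier := {x | IsIntegralMatrix (α⁻¹.1 * adelicMatrix θ x)}
  add_mem' {z w} hz hw := by
    change IsIntegralMatrix _
    rw [map_add, mul_add]
    exact IsIntegralMatrix.add hz hw
  zero_mem' := by
    change IsIntegralMatrix _
    rw [map_zero, mul_zero]
    exact fun _ _ => isIntegralAdele_zero
  smul_mem' c z hz := by
    change IsIntegralMatrix _
    rw [← algebraMap_smul F c z, adelicMatrix_smul, mul_smul_comm]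
    exact isIntegralMatrix_algebraMap_smul c hz

variable {θ}

theorem mem_latticeOf {α : (Matrix (Fin 2) (Fin 2) (Ad F))ˣ} {x : B} :
    x ∈ latticeOf θ α ↔ IsIntegralMatrix (α⁻¹.1 * adelicMatrix θ x) := Iff.rfl

variable (θ) in
/-- The adelic closure of `B ∩ α M₂(Ô)` is `α M₂(Ô)`. -/
theorem adelicSpan_latticeOf [Module.Finite F B] (α : (Matrix (Fin 2) (Fin 2) (Ad F))ˣ) :
    adelicSpan (F := F) (adelicMatrix θ).toAddMonoidHom (latticeOf θ α : Set B) =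
      adelicLattice α := by
  let b := Module.finBasis F B
  obtain ⟨d, hd, h⟩ := exists_mul_integral_finite
    fun x : Fin (Module.finrank F B) × Fin 2 × Fin 2 =>
      (α⁻¹.1 * adelicBasis θ b x.1) x.2.1 x.2.2
  exact adelicSpan_preimage (adelicMatrix_smul θ) b (adelicBasis θ b) (adelicMatrix_basis θ b)
    (adelicLattice α) hd fun i => by
      rw [mem_adelicLattice, mul_smul_comm]
      exact fun j k => h (i, j, k)

/-- Inclusion of the global lattices is inclusion of the adelic ones, as a lattice is determined by
its adelic closure. -/
theorem latticeOf_le_iff [Module.Finite F B] {α β : (Matrix (Fin 2) (Fin 2) (Ad F))ˣ} :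
    latticeOf θ α ≤ latticeOf θ β ↔ IsIntegralMatrix (β⁻¹.1 * α.1) := by
  constructor
  · intro h
    have h1 := adelicSpan_mono (F := F) (adelicMatrix θ).toAddMonoidHom h
    rw [adelicSpan_latticeOf, adelicSpan_latticeOf] at h1
    exact h1 (show IsIntegralMatrix _ by rw [Units.inv_mul]; exact isIntegralMatrix_one)
  · intro h x hx
    have := h.mul (mem_latticeOf.1 hx)
    rwa [mul_assoc, Units.mul_inv_cancel_left] at this

theorem span_latticeOf [Module.Finite F B] (α : (Matrix (Fin 2) (Fin 2) (Ad F))ˣ) :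
    Submodule.span F (latticeOf θ α : Set B) = ⊤ := by
  rw [eq_top_iff]
  intro x _
  obtain ⟨n, hn, h⟩ := exists_smul_isIntegralMatrix (α⁻¹.1 * adelicMatrix θ x)
  have hn' : (n : F) ≠ 0 := by simpa using hn
  have h1 : (n : F) • x ∈ Submodule.span F (latticeOf θ α : Set B) :=
    Submodule.subset_span (show IsIntegralMatrix _ by rwa [adelicMatrix_smul, mul_smul_comm])
  exact (Submodule.smul_mem_iff _ hn').1 h1

variable {R : Subalgebra (𝓞 F) B}

/-- The order `M₂(Ô)` is the adelic closure of `R`. -/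
theorem isIntegralMatrix_iff_mem_adelicSpan (hθ : SplitsOrder R θ)
    {m : Matrix (Fin 2) (Fin 2) (Ad F)} :
    IsIntegralMatrix m ↔ m ∈ adelicSpan (F := F) (adelicMatrix θ).toAddMonoidHom (R : Set B) := by
  constructor
  · intro hm
    have h1 : θ.symm m ∈ adelicOrder R := (hθ _).2 (by rwa [AlgEquiv.apply_symm_apply])
    have h2 : ∀ z ∈ adelicOrder R,
        θ z ∈ adelicSpan (F := F) (adelicMatrix θ).toAddMonoidHom (R : Set B) := by
      intro z hz
      induction hz using AddSubgroup.closure_induction with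
      | mem z hz =>
        obtain ⟨c, hc, r, hr, rfl⟩ := hz
        rw [theta_tmul]
        exact integral_smul_mem _ hc (Submodule.subset_span ⟨r, hr, rfl⟩)
      | zero => rw [map_zero]; exact Submodule.zero_mem _
      | add x y _ _ hx hy => rw [map_add]; exact Submodule.add_mem _ hx hy
      | neg x _ hx => rw [map_neg]; exact Submodule.neg_mem _ hx
    have := h2 _ h1
    rwa [AlgEquiv.apply_symm_apply] at this
  · intro hm
    have h1 : adelicSpan (F := F) (adelicMatrix θ).toAddMonoidHom (R : Set B) ≤
        adelicLattice 1 := by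
      refine Submodule.span_le.2 ?_
      rintro _ ⟨r, hr, rfl⟩
      have := (hθ ((1 : Ad F) ⊗ₜ[F] r)).1 (AddSubgroup.subset_closure
        ⟨1, isIntegralAdele_one, r, hr, rfl⟩)
      change IsIntegralMatrix _
      rw [inv_one, Units.val_one, one_mul]
      exact this
    have := mem_adelicLattice.1 (h1 hm)
    rwa [inv_one, Units.val_one, one_mul] at this

theorem isIntegralMatrix_adelicMatrix (hθ : SplitsOrder R θ) {x : B} (hx : x ∈ R) :
    IsIntegralMatrix (adelicMatrix θ x) :=
  (isIntegralMatrix_iff_mem_adelicSpan hθ).2 (Submodule.subset_span ⟨x, hx, rfl⟩)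

variable [Module.Finite F B]

theorem mem_of_isIntegralMatrix (hR : IsOrder R) (hθ : SplitsOrder R θ) {x : B}
    (hx : IsIntegralMatrix (adelicMatrix θ x)) : x ∈ R :=
  mem_of_mem_adelicSpan (Λ := Subalgebra.toSubmodule R) (adelicMatrix_smul θ)
    (Module.finBasis F B) (adelicBasis θ _) (adelicMatrix_basis θ _) hR.span_eq_top
    ((isIntegralMatrix_iff_mem_adelicSpan hθ).1 hx)

/-- Right ideals are locally principal. -/
theorem exists_eq_latticeOf (hθ : SplitsOrder R θ) {I : Submodule (𝓞 F) B}
    (hI : IsRightFractionalIdeal R I) : ∃ α, I = latticeOf θ α := by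
  obtain ⟨n₀, hn₀, h₀⟩ := exists_smul_mem_of_span_eq_top hI.span_eq_top 1
  obtain ⟨s, hs⟩ := hI.fg
  obtain ⟨n₁, hn₁, h₁⟩ := exists_mul_integral_finite
    fun x : s × Fin 2 × Fin 2 => adelicMatrix θ x.1.1 x.2.1 x.2.2
  set X := adelicSpan (F := F) (adelicMatrix θ).toAddMonoidHom (I : Set B) with hXdef
  have hint : ∀ z ∈ X, IsIntegralMatrix (algebraMap F (Ad F) n₁ • z) := by
    intro z hz
    induction hz using Submodule.span_induction with
    | mem z hz =>
      obtain ⟨x, hx, rfl⟩ := hz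
      change IsIntegralMatrix (_ • adelicMatrix θ x)
      rw [SetLike.mem_coe, ← hs] at hx
      induction hx using Submodule.span_induction with
      | mem x hx => exact fun i j => h₁ (⟨x, hx⟩, i, j)
      | zero => rw [map_zero, smul_zero]; exact fun _ _ => isIntegralAdele_zero
      | add x y _ _ hx hy => rw [map_add, smul_add]; exact hx.add hy
      | smul c x _ hx =>
        rw [← algebraMap_smul F c x, adelicMatrix_smul, smul_comm]
        exact isIntegralMatrix_algebraMap_smul c hx
    | zero => rw [smul_zero]; exact fun _ _ => isIntegralAdele_zero
    | add z w _ _ hz hw => rw [smul_add]; exact hz.add hw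
    | smul c z _ hz =>
      change IsIntegralMatrix (_ • (c : Ad F) • z)
      rw [smul_comm]
      exact hz.smul c.2
  have hmul : ∀ z ∈ X, ∀ m, IsIntegralMatrix m → z * m ∈ X := fun z hz m hm =>
    mul_mem_adelicSpan _ hI.mul_mem hz ((isIntegralMatrix_iff_mem_adelicSpan hθ).1 hm)
  have hmem : ∀ m, IsIntegralMatrix m → algebraMap F (Ad F) n₀ • m ∈ X := by
    intro m hm
    have h2 : algebraMap F (Ad F) n₀ • (1 : Matrix (Fin 2) (Fin 2) (Ad F)) ∈ X := by
      refine Submodule.subset_span ⟨n₀ • 1, h₀, ?_⟩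
      change adelicMatrix θ (n₀ • 1) = _
      rw [← algebraMap_smul F n₀, adelicMatrix_smul, map_one]
    have := hmul _ h2 m hm
    rwa [smul_mul_assoc, one_mul] at this
  obtain ⟨g, hg⟩ := exists_generator hmul (mul_ne_zero hn₀ hn₁)
    (fun m hm => by
      rw [show ((n₀ * n₁ : 𝓞 F) : F) = (n₀ : F) * (n₁ : F) from rfl, map_mul, mul_smul]
      exact hmem _ (isIntegralMatrix_algebraMap_smul n₁ hm))
    (fun z hz => by
      rw [show ((n₀ * n₁ : 𝓞 F) : F) = (n₀ : F) * (n₁ : F) from rfl, map_mul, mul_smul]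
      exact isIntegralMatrix_algebraMap_smul n₀ (hint z hz))
  refine ⟨g, le_antisymm (fun x hx => (hg _).1 (Submodule.subset_span ⟨x, hx, rfl⟩)) fun x hx => ?_⟩
  exact mem_of_mem_adelicSpan (adelicMatrix_smul θ) (Module.finBasis F B) (adelicBasis θ _)
    (adelicMatrix_basis θ _) hI.span_eq_top ((hg _).2 hx)

theorem isRightFractionalIdeal_latticeOf (hR : IsOrder R) (hθ : SplitsOrder R θ)
    (α : (Matrix (Fin 2) (Fin 2) (Ad F))ˣ) : IsRightFractionalIdeal R (latticeOf θ α) where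
  fg := by
    obtain ⟨n, hn, h⟩ := exists_smul_isIntegralMatrix α.1
    have hn' : (n : F) ≠ 0 := by simpa using hn
    have hmem : ∀ x ∈ latticeOf θ α, (n : F) • x ∈ R := fun x hx => by
      refine mem_of_isIntegralMatrix hR hθ ?_
      have := h.mul (mem_latticeOf.1 hx)
      rwa [smul_mul_assoc, Units.mul_inv_cancel_left, ← adelicMatrix_smul] at this
    have : IsNoetherian (𝓞 F) (Subalgebra.toSubmodule R) :=
      isNoetherian_of_fg_of_noetherian _ hR.fg
    let f : latticeOf θ α →ₗ[𝓞 F] Subalgebra.toSubmodule R :=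
      ((LinearMap.lsmul (𝓞 F) B n).domRestrict (latticeOf θ α)).codRestrict _ fun x => by
        have := hmem x x.2
        rwa [RingOfIntegers.coe_eq_algebraMap, algebraMap_smul] at this
    have hf : Function.Injective f := fun x y hxy => by
      have h1 : n • (x : B) = n • (y : B) := congrArg Subtype.val hxy
      rw [← algebraMap_smul F n, ← algebraMap_smul F n] at h1
      exact Subtype.ext (smul_right_injective B hn' h1)
    have := isNoetherian_of_injective f hf
    exact (Submodule.fg_top _).1 (this.noetherian ⊤)
  span_eq_top := span_latticeOf α
  mul_mem x hx r hr := by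
    rw [mem_latticeOf, map_mul, ← mul_assoc]
    exact (mem_latticeOf.1 hx).mul (isIntegralMatrix_adelicMatrix hθ hr)

end Lattice

/-! ### The group `GL₂(Ô)` -/

section IntegralGL

variable {F : Type*} [Field F] [NumberField F]

variable (F) in
/-- The group `GL₂(Ô)`. -/
def integralGL : Subgroup (Matrix (Fin 2) (Fin 2) (Ad F))ˣ where
  carrier := {g | IsIntegralMatrix g.1 ∧ IsIntegralMatrix g⁻¹.1}
  mul_mem' {g h} hg hh := ⟨hg.1.mul hh.1, by
    rw [mul_inv_rev]
    exact hh.2.mul hg.2⟩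
  one_mem' := ⟨isIntegralMatrix_one, by rw [inv_one]; exact isIntegralMatrix_one⟩
  inv_mem' {g} hg := ⟨hg.2, by rw [inv_inv]; exact hg.1⟩

theorem mem_integralGL {g : (Matrix (Fin 2) (Fin 2) (Ad F))ˣ} :
    g ∈ integralGL F ↔ IsIntegralMatrix g.1 ∧ IsIntegralMatrix g⁻¹.1 := Iff.rfl

theorem units_inv_eq_smul_adjugate {A : Type*} [CommRing A] (g : (Matrix (Fin 2) (Fin 2) A)ˣ) :
    g⁻¹.1 = g⁻¹.1.det • g.1.adjugate := by
  have h : g.1.adjugate = g.1.det • g⁻¹.1 := by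
    have := congrArg (· * g⁻¹.1) (Matrix.adjugate_mul g.1)
    rwa [Units.mul_inv_cancel_right, smul_mul_assoc, one_mul] at this
  rw [h, smul_smul, ← Matrix.det_mul, Units.inv_mul, Matrix.det_one, one_smul]

theorem valued_inv_apply_le_one {v : HeightOneSpectrum (𝓞 F)}
    {g : (Matrix (Fin 2) (Fin 2) (v.adicCompletion F))ˣ} (hg : ∀ i j, Valued.v (g.1 i j) ≤ 1)
    (hdet : Valued.v g.1.det = 1) (i j : Fin 2) : Valued.v (g⁻¹.1 i j) ≤ 1 := by
  have h1 : Valued.v g⁻¹.1.det = 1 := by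
    have := congrArg (fun m : Matrix (Fin 2) (Fin 2) (v.adicCompletion F) => Valued.v m.det)
      g.inv_mul
    simpa only [Matrix.det_mul, map_mul, hdet, mul_one, Matrix.det_one, map_one] using this
  rw [units_inv_eq_smul_adjugate, Matrix.smul_apply, smul_eq_mul, map_mul, h1, one_mul,
    Matrix.adjugate_fin_two]
  fin_cases i <;> fin_cases j
  · exact hg 1 1
  · exact (Valuation.map_neg _ _).trans_le (hg 0 1)
  · exact (Valuation.map_neg _ _).trans_le (hg 1 0)
  · exact hg 0 0

theorem mem_integralGL_of_det {g : (Matrix (Fin 2) (Fin 2) (Ad F))ˣ} (hg : IsIntegralMatrix g.1)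
    (hdet : ∀ v, Valued.v (g.1.det v) = 1) : g ∈ integralGL F :=
  ⟨hg, fun i j v => valued_inv_apply_le_one (g := Units.map (evalMatrix v).toMonoidHom g)
    (fun i j => hg i j v) ((congrArg Valued.v (evalMatrix_det v g.1)).trans (hdet v)) i j⟩

theorem valued_det_of_mem_integralGL {g : (Matrix (Fin 2) (Fin 2) (Ad F))ˣ}
    (hg : g ∈ integralGL F) (v : HeightOneSpectrum (𝓞 F)) : Valued.v (g.1.det v) = 1 := by
  have h1 : Valued.v (g.1.det v) * Valued.v (g⁻¹.1.det v) = 1 := by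
    rw [← map_mul, ← adele_mul_apply, ← Matrix.det_mul, Units.mul_inv, Matrix.det_one,
      adele_one_apply, map_one]
  exact le_antisymm (hg.1.det v) (by
    rw [← h1]
    exact mul_le_of_le_one_right' (hg.2.det v))

theorem det_apply_ne_zero (g : (Matrix (Fin 2) (Fin 2) (Ad F))ˣ) (v : HeightOneSpectrum (𝓞 F)) :
    g.1.det v ≠ 0 := by
  intro h
  have h1 : g.1.det v * g⁻¹.1.det v = 1 := by
    rw [← adele_mul_apply, ← Matrix.det_mul, Units.mul_inv, Matrix.det_one, adele_one_apply]
  rw [h, zero_mul] at h1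
  exact zero_ne_one h1

/-- An element of `GL₂(Ô)` with prescribed components at the primes dividing `N` and trivial
components elsewhere. -/
theorem exists_mem_integralGL {N : Ideal (𝓞 F)}
    (g : ∀ v : HeightOneSpectrum (𝓞 F), (Matrix (Fin 2) (Fin 2) (v.adicCompletion F))ˣ)
    (hg : ∀ v, v.asIdeal ∣ N → ∀ i j, Valued.v ((g v).1 i j) ≤ 1)
    (hdet : ∀ v, v.asIdeal ∣ N → Valued.v (g v).1.det = 1) :
    ∃ κ ∈ integralGL F, (∀ v, v.asIdeal ∣ N → evalMatrix v κ.1 = (g v).1) ∧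
      ∀ v, ¬ v.asIdeal ∣ N → evalMatrix v κ.1 = 1 := by
  classical
  have hone : ∀ v : HeightOneSpectrum (𝓞 F), ∀ i j,
      Valued.v ((1 : Matrix (Fin 2) (Fin 2) (v.adicCompletion F)) i j) ≤ 1 := fun v i j => by
    rw [Matrix.one_apply]
    split_ifs <;> simp
  let f : ∀ v : HeightOneSpectrum (𝓞 F), (Matrix (Fin 2) (Fin 2) (v.adicCompletion F))ˣ :=
    fun v => if v.asIdeal ∣ N then g v else 1
  have hf : ∀ v i j, Valued.v ((f v).1 i j) ≤ 1 := fun v i j => by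
    dsimp only [f]
    split_ifs with h
    · exact hg v h i j
    · exact hone v i j
  have hfinv : ∀ v i j, Valued.v ((f v)⁻¹.1 i j) ≤ 1 := fun v i j => by
    dsimp only [f]
    split_ifs with h
    · exact valued_inv_apply_le_one (hg v h) (hdet v h) i j
    · rw [inv_one]
      exact hone v i j
  refine ⟨mkGL f (fun i j => ?_) (fun i j => ?_), ⟨fun i j v => hf v i j,
    fun i j v => hfinv v i j⟩, fun v hv => ?_, fun v hv => ?_⟩
  · simp only [hf, not_true_eq_false]
    exact Set.finite_empty
  · simp only [hfinv, not_true_eq_false]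
    exact Set.finite_empty
  · rw [evalMatrix_mkGL]
    exact congrArg Units.val (if_pos hv)
  · rw [evalMatrix_mkGL]
    exact congrArg Units.val (if_neg hv)

end IntegralGL

/-! ### Fractional ideals of `F` and ideles -/

section FractionalIdeals

variable {F : Type*} [Field F] [NumberField F]

/-- The idele `t` generates the `𝓞_F`-module `J` locally everywhere: `J Ô = t Ô`. -/
structure IsLocalGenerator (J : Submodule (𝓞 F) F) (t : (Ad F)ˣ) : Prop where
  exists_ne_zero : ∃ x ∈ J, x ≠ 0
  mem : (t : Ad F) ∈ adelicSpan (F := F) (algebraMap F (Ad F)).toAddMonoidHom (J : Set F)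
  valued_le : ∀ x ∈ J, ∀ v : HeightOneSpectrum (𝓞 F),
    v.valuation F x ≤ Valued.v ((t : Ad F) v)

theorem units_apply_ne_zero (t : (Ad F)ˣ) (v : HeightOneSpectrum (𝓞 F)) : (t : Ad F) v ≠ 0 := by
  intro h
  have h1 : (t : Ad F) v * (t⁻¹ : (Ad F)ˣ).1 v = 1 := by
    rw [← adele_mul_apply, Units.mul_inv, adele_one_apply]
  rw [h, zero_mul] at h1
  exact zero_ne_one h1

theorem valued_units_inv (t : (Ad F)ˣ) (v : HeightOneSpectrum (𝓞 F)) :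
    Valued.v ((t⁻¹ : (Ad F)ˣ).1 v) = (Valued.v ((t : Ad F) v))⁻¹ := by
  have h1 : Valued.v ((t⁻¹ : (Ad F)ˣ).1 v) * Valued.v ((t : Ad F) v) = 1 := by
    rw [← map_mul, ← adele_mul_apply, Units.inv_mul, adele_one_apply, map_one]
  exact eq_inv_of_mul_eq_one_left h1

namespace IsLocalGenerator

variable {J J' : Submodule (𝓞 F) F} {t t' : (Ad F)ˣ}

theorem valued_le_of_mem (h : IsLocalGenerator J t) {z : Ad F}
    (hz : z ∈ adelicSpan (F := F) (algebraMap F (Ad F)).toAddMonoidHom (J : Set F))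
    (v : HeightOneSpectrum (𝓞 F)) : Valued.v (z v) ≤ Valued.v ((t : Ad F) v) := by
  induction hz using Submodule.span_induction with
  | mem z hz =>
    obtain ⟨x, hx, rfl⟩ := hz
    exact (valued_algebraMap x v).trans_le (h.valued_le x hx v)
  | zero =>
    rw [adele_zero_apply, map_zero]
    exact zero_le
  | add z w _ _ hz hw => exact (Valuation.map_add _ _ _).trans (max_le hz hw)
  | smul c z _ hz =>
    change Valued.v ((c : Ad F) v * z v) ≤ _
    rw [map_mul]
    exact mul_le_of_le_one_of_le (c.2 v) hz

theorem span_eq_top (h : IsLocalGenerator J t) : Submodule.span F (J : Set F) = ⊤ := by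
  obtain ⟨x, hx, hx0⟩ := h.exists_ne_zero
  rw [eq_top_iff]
  intro y _
  have : y = (y / x) • x := by rw [smul_eq_mul, div_mul_cancel₀ y hx0]
  rw [this]
  exact Submodule.smul_mem _ _ (Submodule.subset_span hx)

theorem mul (h : IsLocalGenerator J t) (h' : IsLocalGenerator J' t') :
    IsLocalGenerator (J * J') (t * t') where
  exists_ne_zero := by
    obtain ⟨x, hx, hx0⟩ := h.exists_ne_zero
    obtain ⟨y, hy, hy0⟩ := h'.exists_ne_zero
    exact ⟨x * y, Submodule.mul_mem_mul hx hy, mul_ne_zero hx0 hy0⟩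
  mem := mul_mem_adelicSpan _ (fun x hx y hy => Submodule.mul_mem_mul hx hy) h.mem h'.mem
  valued_le x hx v := by
    induction hx using Submodule.mul_induction_on' with
    | mem_mul_mem x hx y hy =>
      rw [map_mul, Units.val_mul, adele_mul_apply, map_mul]
      exact mul_le_mul' (h.valued_le x hx v) (h'.valued_le y hy v)
    | add x _ y _ hx hy => exact (Valuation.map_add _ _ _).trans (max_le hx hy)

theorem le_of_valued_le (h : IsLocalGenerator J t) (h' : IsLocalGenerator J' t')
    (hle : ∀ v, Valued.v ((t : Ad F) v) ≤ Valued.v ((t' : Ad F) v)) : J ≤ J' := by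
  intro x hx
  refine mem_of_mem_adelicSpan (ι := (algebraMap F (Ad F)).toAddMonoidHom)
    (fun c x => map_mul (algebraMap F (Ad F)) c x)
    (Module.Basis.singleton Unit F) (Module.Basis.singleton Unit (Ad F)) (fun _ => ?_)
    h'.span_eq_top ?_
  · rw [Module.Basis.singleton_apply, Module.Basis.singleton_apply]
    exact map_one (algebraMap F (Ad F))
  · have h1 : IsIntegralAdele (algebraMap F (Ad F) x * (t'⁻¹ : (Ad F)ˣ).1) := fun v => by
      rw [HeightOneSpectrum.mem_adicCompletionIntegers, adele_mul_apply, map_mul,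
        valued_units_inv, ← div_eq_mul_inv, valued_algebraMap]
      exact div_le_one_of_le₀ ((h.valued_le x hx v).trans (hle v)) zero_le
    have h2 := integral_smul_mem _ h1 h'.mem
    rwa [smul_eq_mul, Units.inv_mul_cancel_right] at h2

theorem eq_iff (h : IsLocalGenerator J t) (h' : IsLocalGenerator J' t') :
    J = J' ↔ ∀ v, Valued.v ((t : Ad F) v) = Valued.v ((t' : Ad F) v) := by
  constructor
  · rintro rfl v
    exact le_antisymm (h'.valued_le_of_mem h.mem v) (h.valued_le_of_mem h'.mem v)
  · intro hv
    exact le_antisymm (h.le_of_valued_le h' fun v => (hv v).le)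
      (h'.le_of_valued_le h fun v => (hv v).ge)

end IsLocalGenerator

theorem isLocalGenerator_span_singleton (x : Fˣ) :
    IsLocalGenerator (Submodule.span (𝓞 F) {(x : F)}) (Units.map (algebraMap F (Ad F)) x) where
  exists_ne_zero := ⟨x, Submodule.mem_span_singleton_self _, x.ne_zero⟩
  mem := Submodule.subset_span ⟨x, Submodule.mem_span_singleton_self _, rfl⟩
  valued_le y hy v := by
    obtain ⟨c, rfl⟩ := Submodule.mem_span_singleton.1 hy
    refine le_of_le_of_eq ?_ (valued_algebraMap _ v).symm
    rw [Algebra.smul_def, map_mul]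
    exact mul_le_of_le_one_left' (v.valuation_le_one c)

omit [NumberField F] in
theorem mem_toFrac {I : Ideal (𝓞 F)} {x : F} : x ∈ toFrac I ↔ ∃ m ∈ I, (m : F) = x :=
  IsLocalization.mem_coeSubmodule F I

theorem valued_uniformizerIdele_same (p : HeightOneSpectrum (𝓞 F)) :
    Valued.v ((uniformizerIdele p : Ad F) p) = WithZero.exp (-1 : ℤ) := by
  refine Eq.trans ?_ (p.valuation_exists_uniformizer F).choose_spec
  refine Eq.trans ?_ (HeightOneSpectrum.valuedAdicCompletion_eq_valuation' p _)
  exact congrArg (fun z : F => Valued.v (z : p.adicCompletion F)) (if_pos rfl)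

theorem uniformizerIdele_of_ne {p v : HeightOneSpectrum (𝓞 F)} (h : v ≠ p) :
    (uniformizerIdele p : Ad F) v = 1 := by
  refine Eq.trans ?_ (HeightOneSpectrum.adicCompletion.coe_one F v)
  exact congrArg (fun z : F => (z : v.adicCompletion F)) (if_neg h)

theorem isIntegralAdele_uniformizerIdele (p : HeightOneSpectrum (𝓞 F)) :
    IsIntegralAdele (uniformizerIdele p : Ad F) := fun v => by
  rw [HeightOneSpectrum.mem_adicCompletionIntegers]
  by_cases h : v = p
  · subst h
    rw [valued_uniformizerIdele_same, ← WithZero.exp_zero, WithZero.exp_le_exp]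
    norm_num
  · rw [uniformizerIdele_of_ne h, map_one]

theorem isLocalGenerator_toFrac (p : HeightOneSpectrum (𝓞 F)) :
    IsLocalGenerator (toFrac p.asIdeal) (uniformizerIdele p) := by
  obtain ⟨n, hn, hn0⟩ := Submodule.exists_mem_ne_zero_of_ne_bot p.ne_bot
  have hexp : ∀ m : 𝓞 F, m ∈ p.asIdeal ↔ p.valuation F m ≤ WithZero.exp (-1 : ℤ) := fun m => by
    have := HeightOneSpectrum.intValuation_le_pow_iff_mem p m 1
    rw [pow_one, Nat.cast_one] at this
    rw [← this, RingOfIntegers.coe_eq_algebraMap, HeightOneSpectrum.valuation_of_algebraMap]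
  refine ⟨⟨n, mem_toFrac.2 ⟨n, hn, rfl⟩, by simpa using hn0⟩, ?_, ?_⟩
  · obtain ⟨m, y, hy, h⟩ := (isIntegralAdele_uniformizerIdele p).exists_eq_add hn0
    have hm : m ∈ p.asIdeal := by
      rw [hexp, ← valued_algebraMap]
      have h1 : (algebraMap F (Ad F) m) p =
          (uniformizerIdele p : Ad F) p - (algebraMap F (Ad F) n) p * y p := by
        rw [h, adele_add_apply, adele_mul_apply, add_sub_cancel_right]
      rw [h1]
      refine (Valuation.map_sub _ _ _).trans (max_le (valued_uniformizerIdele_same p).le ?_)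
      rw [map_mul, valued_algebraMap]
      exact mul_le_of_le_of_le_one ((hexp n).1 hn) (hy p)
    rw [h]
    refine Submodule.add_mem _ (Submodule.subset_span ⟨m, mem_toFrac.2 ⟨m, hm, rfl⟩, rfl⟩) ?_
    rw [mul_comm]
    exact integral_smul_mem _ hy (Submodule.subset_span ⟨n, mem_toFrac.2 ⟨n, hn, rfl⟩, rfl⟩)
  · intro x hx v
    obtain ⟨m, hm, rfl⟩ := mem_toFrac.1 hx
    by_cases h : v = p
    · subst h
      rw [valued_uniformizerIdele_same]
      exact (hexp m).1 hm
    · rw [uniformizerIdele_of_ne h, map_one]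
      exact v.valuation_le_one m

end FractionalIdeals

/-! ### Norms of right ideals -/

section Norm

theorem nonempty_heightOneSpectrum (F : Type*) [Field F] [NumberField F] :
    Nonempty (HeightOneSpectrum (𝓞 F)) := by
  obtain ⟨I, hI⟩ := Ideal.exists_maximal (𝓞 F)
  exact ⟨⟨I, hI.isPrime, Ring.ne_bot_of_isMaximal_of_not_isField hI
    (RingOfIntegers.not_isField F)⟩⟩

variable {F : Type*} [Field F] [NumberField F] {B : Type*} [Ring B] [Algebra F B]
  (θ : AdB F B ≃ₐ[Ad F] Matrix (Fin 2) (Fin 2) (Ad F))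

/-- The determinant of an element of `GL₂(F̂)`, as an idele. -/
def detIdele (g : (Matrix (Fin 2) (Fin 2) (Ad F))ˣ) : (Ad F)ˣ := Units.map Matrix.detMonoidHom g

theorem detIdele_val (g : (Matrix (Fin 2) (Fin 2) (Ad F))ˣ) : (detIdele g : Ad F) = g.1.det := rfl

variable [Module.Finite F B]

/-- The valuations of the reduced norm are those of the determinant of the adelic matrix. -/
theorem valuation_reducedNorm (x : B) (v : HeightOneSpectrum (𝓞 F)) :
    v.valuation F (reducedNorm F x) = Valued.v ((adelicMatrix θ x).det v) := by
  rw [← valued_algebraMap, algebraMap_reducedNorm θ]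

omit [Module.Finite F B] in
/-- Strong approximation for `B` in `M₂(F̂)`. -/
theorem exists_adelicMatrix_approx {n : Type*} [Finite n] (b : Module.Basis n F B)
    (z : Matrix (Fin 2) (Fin 2) (Ad F)) {d : 𝓞 F} (hd : d ≠ 0) :
    ∃ (x : B) (w : Matrix (Fin 2) (Fin 2) (Ad F)),
      (∀ i, IsIntegralAdele ((adelicBasis θ b).repr w i)) ∧
      z = adelicMatrix θ x + algebraMap F (Ad F) d • w := by
  -- only linearity matters, and with opaque maps unification stays cheap
  have hb := adelicMatrix_basis θ b
  have hsmul := adelicMatrix_smul θ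
  generalize adelicBasis θ b = bW at *
  generalize adelicMatrix θ = ι at *
  exact exists_approx (ι := ι.toAddMonoidHom) hsmul b bW hb z d hd

theorem det_eq_mul_add {A : Type*} [CommRing A] (a d : A) (y : Matrix (Fin 2) (Fin 2) A) :
    a = a * (1 + (-d) • y).det + (y.trace + -(d * y.det)) * (d * a) := by
  rw [Matrix.det_fin_two (1 + _), Matrix.trace_fin_two, Matrix.det_fin_two y]
  simp only [Matrix.add_apply, Matrix.smul_apply, smul_eq_mul, Matrix.one_apply_eq,
    Matrix.one_apply_ne zero_ne_one, Matrix.one_apply_ne one_ne_zero]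
  ring

/-- The reduced norms of the elements of the lattice of `α` approximate `det α`. -/
theorem exists_det_eq_add (α : (Matrix (Fin 2) (Fin 2) (Ad F))ˣ) {d : 𝓞 F} (hd : d ≠ 0) :
    ∃ x ∈ latticeOf θ α, ∃ o : Ad F, IsIntegralAdele o ∧
      α.1.det = algebraMap F (Ad F) (reducedNorm F x) +
        o * (algebraMap F (Ad F) d * α.1.det) := by
  obtain ⟨n, b⟩ : Σ n : ℕ, Module.Basis (Fin n) F B := ⟨_, Module.finBasis F B⟩
  obtain ⟨e, he, heb⟩ := exists_mul_integral_finite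
    fun x : Fin n × Fin 2 × Fin 2 => (α⁻¹.1 * adelicBasis θ b x.1) x.2.1 x.2.2
  obtain ⟨x, w, hw, hα⟩ := exists_adelicMatrix_approx θ b α.1 (mul_ne_zero hd he)
  rw [show ((d * e : 𝓞 F) : F) = (d : F) * (e : F) from rfl, map_mul, mul_smul] at hα
  obtain ⟨y, hy⟩ : ∃ y, y = α⁻¹.1 * (algebraMap F (Ad F) e • w) := ⟨_, rfl⟩
  have hyint : IsIntegralMatrix y := by
    clear hα
    have h2 : y = ∑ i, (adelicBasis θ b).repr w i •
        (algebraMap F (Ad F) e • (α⁻¹.1 * adelicBasis θ b i)) := by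
      rw [hy]
      conv_lhs => rw [← (adelicBasis θ b).sum_repr w]
      rw [Finset.smul_sum, Finset.mul_sum]
      refine Finset.sum_congr rfl fun i _ => ?_
      rw [smul_comm, mul_smul_comm, mul_smul_comm]
    rw [h2]
    refine Finset.sum_induction _ IsIntegralMatrix (fun _ _ => IsIntegralMatrix.add)
      (fun _ _ => isIntegralAdele_zero) fun i _ => IsIntegralMatrix.smul ?_ (hw i)
    exact fun k l => heb (i, k, l)
  have hx : adelicMatrix θ x = α.1 * (1 + (-algebraMap F (Ad F) d) • y) := by
    rw [mul_add, mul_one, mul_smul_comm, hy, Units.mul_inv_cancel_left, neg_smul,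
      ← sub_eq_add_neg]
    exact eq_sub_of_add_eq hα.symm
  refine ⟨x, ?_, y.trace + -(algebraMap F (Ad F) d * y.det), ?_, ?_⟩
  · rw [mem_latticeOf, hx, Units.inv_mul_cancel_left]
    exact isIntegralMatrix_one.add (hyint.smul (isIntegralAdele_algebraMap d).neg)
  · rw [Matrix.trace_fin_two]
    exact ((hyint 0 0).add (hyint 1 1)).add ((isIntegralAdele_algebraMap d).mul hyint.det).neg
  · rw [algebraMap_reducedNorm θ, hx, Matrix.det_mul]
    exact det_eq_mul_add _ _ _

/-- The reduced norm of the right ideal `B ∩ α M₂(Ô)` is generated by `det α` locally everywhere: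
by `exists_det_eq_add`, `det α` is a reduced norm up to a multiple of itself by any given `d`. -/
theorem isLocalGenerator_idealNorm (α : (Matrix (Fin 2) (Fin 2) (Ad F))ˣ) :
    IsLocalGenerator (idealNorm (latticeOf θ α)) (detIdele α) := by
  have hle : ∀ x ∈ latticeOf θ α, ∀ v : HeightOneSpectrum (𝓞 F),
      v.valuation F (reducedNorm F x) ≤ Valued.v ((detIdele α : Ad F) v) := fun x hx v => by
    rw [valuation_reducedNorm θ, detIdele_val,
      show adelicMatrix θ x = α.1 * (α⁻¹.1 * adelicMatrix θ x) by rw [Units.mul_inv_cancel_left],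
      Matrix.det_mul, adele_mul_apply, map_mul]
    exact mul_le_of_le_one_right' ((mem_latticeOf.1 hx).det v)
  obtain ⟨j, hjJ, hj0⟩ : ∃ x ∈ idealNorm (latticeOf θ α), x ≠ 0 := by
    obtain ⟨n, hn, h⟩ := exists_smul_mem_of_span_eq_top (span_latticeOf (θ := θ) α) 1
    refine ⟨_, Submodule.subset_span ⟨_, h, rfl⟩, ?_⟩
    obtain ⟨v⟩ := nonempty_heightOneSpectrum F
    rw [← Valuation.ne_zero_iff (v.valuation F), valuation_reducedNorm θ, ← algebraMap_smul F n,
      adelicMatrix_smul, map_one, Matrix.det_smul, Matrix.det_one, mul_one, Fintype.card_fin,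
      ← map_pow, valued_algebraMap]
    exact (Valuation.ne_zero_iff _).2 (pow_ne_zero _ (by simpa using hn))
  refine ⟨⟨j, hjJ, hj0⟩, ?_, fun x hx v => ?_⟩
  · obtain ⟨d, hd, h⟩ := exists_mul_integral (α.1.det * algebraMap F (Ad F) j⁻¹)
    obtain ⟨x, hx, o, ho, hdet⟩ := exists_det_eq_add θ α hd
    have hdX : algebraMap F (Ad F) d * α.1.det ∈ adelicSpan (F := F)
        (algebraMap F (Ad F)).toAddMonoidHom (idealNorm (latticeOf θ α) : Set F) := by
      have h1 := integral_smul_mem (adelicSpan (F := F)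
        (algebraMap F (Ad F)).toAddMonoidHom (idealNorm (latticeOf θ α) : Set F)) h
        (Submodule.subset_span ⟨j, hjJ, rfl⟩)
      have h2 : (algebraMap F (Ad F) d * (α.1.det * algebraMap F (Ad F) j⁻¹)) •
          (algebraMap F (Ad F)).toAddMonoidHom j = algebraMap F (Ad F) d * α.1.det := by
        change _ * algebraMap F (Ad F) j = _
        rw [mul_assoc, mul_assoc, ← map_mul, inv_mul_cancel₀ hj0, map_one, mul_one]
      rwa [h2] at h1
    rw [detIdele_val, hdet]
    exact Submodule.add_mem _ (Submodule.subset_span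
      ⟨_, Submodule.subset_span ⟨x, hx, rfl⟩, rfl⟩) (integral_smul_mem _ ho hdX)
  · induction hx using Submodule.span_induction with
    | mem x hx =>
      obtain ⟨x, hx, rfl⟩ := hx
      exact hle x hx v
    | zero =>
      rw [map_zero]
      exact zero_le
    | add x y _ _ hx hy => exact (Valuation.map_add _ _ _).trans (max_le hx hy)
    | smul c x _ hx =>
      rw [Algebra.smul_def, map_mul]
      exact mul_le_of_le_one_of_le (v.valuation_le_one c) hx

end Norm

/-! ### Left orders, inverses and the sets `Θ(𝔭, a, b)` -/

section LatticeOperations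

variable {F : Type*} [Field F] [NumberField F] {B : Type*} [Ring B] [Algebra F B]
  {θ : AdB F B ≃ₐ[Ad F] Matrix (Fin 2) (Fin 2) (Ad F)}

variable (θ) in
/-- The embedding `Bˣ → GL₂(F̂)` given by the splitting `θ`. -/
def rationalGL : Bˣ →* (Matrix (Fin 2) (Fin 2) (Ad F))ˣ :=
  Units.map (adelicMatrix θ).toMonoidHom

theorem rationalGL_val (u : Bˣ) : (rationalGL θ u).1 = adelicMatrix θ u := rfl

/-- Left translation by `Bˣ` corresponds to left multiplication in `GL₂(F̂)`. -/
theorem leftTranslate_latticeOf (u : Bˣ) (α : (Matrix (Fin 2) (Fin 2) (Ad F))ˣ) :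
    leftTranslate u (latticeOf θ α) = latticeOf θ (rationalGL θ u * α) := by
  ext x
  have h : ∀ y : B, ((rationalGL θ u * α)⁻¹).1 * adelicMatrix θ (u * y) =
      α⁻¹.1 * adelicMatrix θ y := fun y => by
    rw [mul_inv_rev, Units.val_mul, map_mul, ← rationalGL_val, mul_assoc,
      Units.inv_mul_cancel_left]
  constructor
  · rintro ⟨y, hy, rfl⟩
    rw [mem_latticeOf, LinearMap.mulLeft_apply, h]
    exact hy
  · intro hx
    refine ⟨(u⁻¹ : Bˣ) * x, ?_, Units.mul_inv_cancel_left u x⟩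
    rw [SetLike.mem_coe, mem_latticeOf, ← h, Units.mul_inv_cancel_left]
    exact hx

variable [Module.Finite F B]

/-- The right ideals correspond to the cosets in `GL₂(F̂) / GL₂(Ô)`. -/
theorem latticeOf_eq_iff {α β : (Matrix (Fin 2) (Fin 2) (Ad F))ˣ} :
    latticeOf θ α = latticeOf θ β ↔ α⁻¹ * β ∈ integralGL F := by
  rw [le_antisymm_iff, latticeOf_le_iff, latticeOf_le_iff, mem_integralGL, mul_inv_rev, inv_inv,
    Units.val_mul, Units.val_mul, and_comm]

/-- The units of the left order of `B ∩ α M₂(Ô)` are `Bˣ ∩ α GL₂(Ô) α⁻¹`. -/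
theorem mem_leftOrderUnits_latticeOf {u : Bˣ} {α : (Matrix (Fin 2) (Fin 2) (Ad F))ˣ} :
    u ∈ leftOrderUnits (latticeOf θ α) ↔ α⁻¹ * rationalGL θ u * α ∈ integralGL F := by
  have h : ∀ w : Bˣ, (w : B) ∈ leftOrder (latticeOf θ α) ↔
      IsIntegralMatrix (α⁻¹ * rationalGL θ w * α).1 := fun w => by
    rw [mul_assoc, Units.val_mul, ← latticeOf_le_iff (θ := θ), ← leftTranslate_latticeOf,
      leftTranslate, Submodule.map_le_iff_le_comap]
    exact Iff.rfl
  change _ ∧ _ ↔ _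
  rw [h, h, mem_integralGL, map_inv]
  simp only [mul_inv_rev, inv_inv, mul_assoc]

/-- The inverse of `B ∩ α M₂(Ô)` is `B ∩ M₂(Ô) α⁻¹`. -/
theorem mem_idealInv_latticeOf {x : B} {α : (Matrix (Fin 2) (Fin 2) (Ad F))ˣ} :
    x ∈ idealInv (latticeOf θ α) ↔ IsIntegralMatrix (adelicMatrix θ x * α.1) := by
  constructor
  · intro hx
    have hα : α.1 ∈ adelicSpan (F := F) (adelicMatrix θ).toAddMonoidHom
        (latticeOf θ α : Set B) := by
      rw [adelicSpan_latticeOf, mem_adelicLattice, Units.inv_mul]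
      exact isIntegralMatrix_one
    have hxα : adelicMatrix θ x * α.1 ∈ adelicSpan (F := F) (adelicMatrix θ).toAddMonoidHom
        ((fun z => x * z) '' (latticeOf θ α : Set B)) :=
      mul_mem_adelicSpan (adelicMatrix θ) (S := {x}) (T := (latticeOf θ α : Set B))
        (P := (fun z => x * z) '' (latticeOf θ α : Set B)) (fun y hy z hz => ⟨z, hz, by rw [hy]⟩)
        (Submodule.subset_span ⟨x, rfl, rfl⟩) hα
    have h := mul_mem_adelicSpan (adelicMatrix θ) (S := (latticeOf θ α : Set B))
      (T := (fun z => x * z) '' (latticeOf θ α : Set B)) (P := (latticeOf θ α : Set B))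
      (fun y hy w hw => by
        obtain ⟨z, hz, rfl⟩ := hw
        change y * (x * z) ∈ _
        rw [← mul_assoc]
        exact hx y hy z hz) hα hxα
    rw [adelicSpan_latticeOf, mem_adelicLattice, Units.inv_mul_cancel_left] at h
    exact h
  · intro hx y hy z hz
    rw [mem_latticeOf]
    have := ((mem_latticeOf.1 hy).mul hx).mul (mem_latticeOf.1 hz)
    rw [map_mul, map_mul]
    convert this using 1
    simp only [mul_assoc, Units.mul_inv_cancel_left]

variable (θ) in
theorem inv_mem_adelicSpan_idealInv (α : (Matrix (Fin 2) (Fin 2) (Ad F))ˣ) :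
    α⁻¹.1 ∈ adelicSpan (F := F) (adelicMatrix θ).toAddMonoidHom
      (idealInv (latticeOf θ α) : Set B) := by
  let X : Submodule (integralAdeles F) (Matrix (Fin 2) (Fin 2) (Ad F)) :=
    { carrier := {z | IsIntegralMatrix (z * α.1)}
      add_mem' := fun {z w} hz hw => by
        change IsIntegralMatrix _
        rw [add_mul]
        exact IsIntegralMatrix.add hz hw
      zero_mem' := by
        change IsIntegralMatrix _
        rw [zero_mul]
        exact fun _ _ => isIntegralAdele_zero
      smul_mem' := fun c z hz => by
        change IsIntegralMatrix (((c : Ad F) • z) * α.1)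
        rw [smul_mul_assoc]
        exact IsIntegralMatrix.smul hz c.2 }
  let b := Module.finBasis F B
  obtain ⟨d, hd, h⟩ := exists_mul_integral_finite
    fun x : Fin (Module.finrank F B) × Fin 2 × Fin 2 =>
      (adelicBasis θ b x.1 * α.1) x.2.1 x.2.2
  have h1 : adelicSpan (F := F) (adelicMatrix θ).toAddMonoidHom
      ((adelicMatrix θ).toAddMonoidHom ⁻¹' (X : Set _)) = X :=
    adelicSpan_preimage (adelicMatrix_smul θ) b (adelicBasis θ b) (adelicMatrix_basis θ b)
      X hd fun i => by
        change IsIntegralMatrix _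
        rw [smul_mul_assoc]
        exact fun j k => h (i, j, k)
  have h2 : α⁻¹.1 ∈ X := by
    change IsIntegralMatrix _
    rw [Units.inv_mul]
    exact isIntegralMatrix_one
  rw [← h1] at h2
  exact adelicSpan_mono (F := F) _ (fun x hx => mem_idealInv_latticeOf.2 hx) h2

/-- The product `a b⁻¹` is `B ∩ α M₂(Ô) β⁻¹`. -/
theorem mem_mul_idealInv_latticeOf {x : B} {α β : (Matrix (Fin 2) (Fin 2) (Ad F))ˣ} :
    x ∈ latticeOf θ α * idealInv (latticeOf θ β) ↔
      IsIntegralMatrix (α⁻¹.1 * adelicMatrix θ x * β.1) := by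
  constructor
  · intro hx
    induction hx using Submodule.mul_induction_on' with
    | mem_mul_mem y hy z hz =>
      have := (mem_latticeOf.1 hy).mul (mem_idealInv_latticeOf.1 hz)
      rw [map_mul]
      simpa only [mul_assoc] using this
    | add y _ z _ hy hz =>
      rw [map_add, mul_add, add_mul]
      exact hy.add hz
  · intro hx
    have hfull : Submodule.span F
        ((latticeOf θ α * idealInv (latticeOf θ β) : Submodule (𝓞 F) B) : Set B) = ⊤ := by
      obtain ⟨n, hn, hnβ⟩ := exists_smul_isIntegralMatrix β.1
      have hn' : (n : F) ≠ 0 := by simpa using hn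
      rw [eq_top_iff, ← span_latticeOf (θ := θ) α, Submodule.span_le]
      intro y hy
      have h1 : (n : F) • (1 : B) ∈ idealInv (latticeOf θ β) := by
        rw [mem_idealInv_latticeOf, adelicMatrix_smul, map_one, smul_mul_assoc, one_mul]
        exact hnβ
      have h2 := Submodule.subset_span (R := F) (Submodule.mul_mem_mul hy h1)
      rw [mul_smul_comm, mul_one] at h2
      exact (Submodule.smul_mem_iff _ hn').1 h2
    refine mem_of_mem_adelicSpan (adelicMatrix_smul θ) (Module.finBasis F B) (adelicBasis θ _)
      (adelicMatrix_basis θ _) hfull ?_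
    have h1 : adelicMatrix θ x * β.1 ∈ adelicSpan (F := F) (adelicMatrix θ).toAddMonoidHom
        (latticeOf θ α : Set B) := by
      rw [adelicSpan_latticeOf, mem_adelicLattice, ← mul_assoc]
      exact hx
    have h2 := mul_mem_adelicSpan (adelicMatrix θ)
      (P := ((latticeOf θ α * idealInv (latticeOf θ β) : Submodule (𝓞 F) B) : Set B))
      (fun y hy z hz => Submodule.mul_mem_mul hy hz) h1 (inv_mem_adelicSpan_idealInv θ β)
    rwa [Units.mul_inv_cancel_right] at h2

/-- The adelic description of the elements of `a b⁻¹` of reduced norm `𝔭 nr(a) nr(b)⁻¹`. -/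
theorem mem_thetaSet_latticeOf {p : HeightOneSpectrum (𝓞 F)} {u : Bˣ}
    {α β : (Matrix (Fin 2) (Fin 2) (Ad F))ˣ} :
    u ∈ thetaSet p (latticeOf θ α) (latticeOf θ β) ↔
      IsIntegralMatrix (α⁻¹ * rationalGL θ u * β).1 ∧
      ∀ v, Valued.v ((α⁻¹ * rationalGL θ u * β).1.det v) =
        Valued.v ((uniformizerIdele p : Ad F) v) := by
  obtain ⟨w⟩ := nonempty_heightOneSpectrum F
  have hu0 : reducedNorm F (u : B) ≠ 0 := fun h => by
    have h1 := valuation_reducedNorm θ (u : B) w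
    rw [h, map_zero, eq_comm, map_eq_zero] at h1
    exact det_apply_ne_zero (rationalGL θ u) w h1
  have h1 := isLocalGenerator_span_singleton (Units.mk0 _ hu0)
  have h2 := h1.mul (isLocalGenerator_idealNorm θ β)
  have h3 := (isLocalGenerator_toFrac p).mul (isLocalGenerator_idealNorm θ α)
  have h4 := h2.eq_iff h3
  change _ ∧ _ = _ ↔ _
  rw [mem_mul_idealInv_latticeOf]
  refine and_congr Iff.rfl (h4.trans (forall_congr' fun v => ?_))
  have e1 : Valued.v ((Units.map (algebraMap F (Ad F)).toMonoidHom (Units.mk0 _ hu0) *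
      detIdele β : (Ad F)ˣ).1 v) =
      Valued.v ((rationalGL θ u).1.det v) * Valued.v (β.1.det v) := by
    rw [Units.val_mul, adele_mul_apply, map_mul, detIdele_val]
    congr 1
    exact (valued_algebraMap _ v).trans (valuation_reducedNorm θ (u : B) v)
  have e2 : Valued.v ((α⁻¹ * rationalGL θ u * β).1.det v) = (Valued.v (α.1.det v))⁻¹ *
      (Valued.v ((rationalGL θ u).1.det v) * Valued.v (β.1.det v)) := by
    rw [Units.val_mul, Units.val_mul, Matrix.det_mul, Matrix.det_mul, adele_mul_apply,
      adele_mul_apply, map_mul, map_mul, mul_assoc]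
    congr 1
    exact valued_units_inv (detIdele α) v
  have hα : Valued.v (α.1.det v) ≠ 0 := (Valuation.ne_zero_iff _).2 (det_apply_ne_zero α v)
  rw [e2, inv_mul_eq_iff_eq_mul₀ hα, mul_comm (Valued.v (α.1.det v)), ← e1]
  rw [Units.val_mul (uniformizerIdele p), adele_mul_apply, map_mul, detIdele_val]
  rfl

/-- An integral right ideal of norm prime to `N` has an adelic generator that is trivial at the
primes dividing `N`. -/
theorem exists_trivial_generator {R : Subalgebra (𝓞 F) B} (hθ : SplitsOrder R θ)
    {a : Submodule (𝓞 F) B} (ha : IsRightFractionalIdeal R a)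
    (hint : a ≤ Subalgebra.toSubmodule R) {N : Ideal (𝓞 F)}
    (hcop : ∀ q : HeightOneSpectrum (𝓞 F), q.asIdeal ∣ N → ¬ idealNorm a ≤ toFrac q.asIdeal) :
    ∃ α : (Matrix (Fin 2) (Fin 2) (Ad F))ˣ, a = latticeOf θ α ∧
      ∀ v : HeightOneSpectrum (𝓞 F), v.asIdeal ∣ N → evalMatrix v α.1 = 1 := by
  obtain ⟨α, rfl⟩ := exists_eq_latticeOf hθ ha
  have h1 : IsIntegralMatrix α.1 := by
    have : latticeOf θ α ≤ latticeOf θ 1 := fun x hx => by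
      rw [mem_latticeOf, inv_one, Units.val_one, one_mul]
      exact isIntegralMatrix_adelicMatrix hθ (hint hx)
    rw [latticeOf_le_iff, inv_one, Units.val_one, one_mul] at this
    exact this
  have h2 : ∀ v : HeightOneSpectrum (𝓞 F), v.asIdeal ∣ N → Valued.v (α.1.det v) = 1 := by
    intro v hv
    refine le_antisymm (h1.det v) (not_lt.1 fun hlt => hcop v hv fun x hx => ?_)
    have h3 : ∀ w, w.valuation F x ≤ Valued.v (α.1.det w) :=
      fun w => (isLocalGenerator_idealNorm θ α).valued_le x hx w
    obtain ⟨m, rfl⟩ := HeightOneSpectrum.mem_integers_of_valuation_le_one F x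
      fun w => (h3 w).trans (h1.det w)
    exact mem_toFrac.2 ⟨m, (HeightOneSpectrum.valuation_lt_one_iff_mem v m).1
      ((h3 v).trans_lt hlt), rfl⟩
  obtain ⟨κ, hκ, hκv, -⟩ := exists_mem_integralGL (N := N)
    (fun v => Units.map (evalMatrix v).toMonoidHom α) (fun v _ i j => h1 i j v)
    (fun v hv => (congrArg Valued.v (evalMatrix_det v α.1)).trans (h2 v hv))
  refine ⟨α * κ⁻¹, ?_, fun v hv => ?_⟩
  · rw [latticeOf_eq_iff, inv_mul_cancel_left]
    exact inv_mem hκ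
  · have h4 : evalMatrix v κ.1 * evalMatrix v κ⁻¹.1 = 1 := by
      rw [← map_mul, Units.mul_inv, map_one]
    rw [Units.val_mul, map_mul]
    rw [hκv v hv] at h4
    exact h4

end LatticeOperations

/-! ### Reduction modulo `N` -/

section Reduction

variable {F : Type*} [Field F] [NumberField F] {N : Ideal (𝓞 F)}

theorem memLocalIdeal_of_mem {m : 𝓞 F} (hm : m ∈ N) (v : HeightOneSpectrum (𝓞 F)) :
    MemLocalIdeal N v ((algebraMap F (Ad F) m) v) :=
  ⟨algebraMap _ _ m, Ideal.mem_map_of_mem _ hm, rfl⟩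

theorem MemLocalIdeal.neg {v : HeightOneSpectrum (𝓞 F)} {x : v.adicCompletion F}
    (hx : MemLocalIdeal N v x) : MemLocalIdeal N v (-x) := by
  rw [← neg_one_mul]
  exact MemLocalIdeal.mul (neg_mem (one_mem _)) hx

theorem MemLocalIdeal.sub {v : HeightOneSpectrum (𝓞 F)} {x y : v.adicCompletion F}
    (hx : MemLocalIdeal N v x) (hy : MemLocalIdeal N v y) : MemLocalIdeal N v (x - y) := by
  rw [sub_eq_add_neg]
  exact hx.add hy.neg

/-- Elements of `N 𝓞_v` are approximated by elements of `N`. -/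
theorem MemLocalIdeal.exists_valued_sub_lt {v : HeightOneSpectrum (𝓞 F)} {x : v.adicCompletion F}
    (hx : MemLocalIdeal N v x) {z : v.adicCompletion F} (hz : z ≠ 0) :
    ∃ n ∈ N, Valued.v (x - (algebraMap F (Ad F) n) v) < Valued.v z := by
  obtain ⟨y, hy, rfl⟩ := hx
  have hz' : 0 < Valued.v z := zero_lt_iff.2 ((Valuation.ne_zero_iff _).2 hz)
  induction hy using Submodule.span_induction with
  | mem y hy =>
    obtain ⟨n, hn, rfl⟩ := hy
    refine ⟨n, hn, ?_⟩
    have : ((algebraMap (𝓞 F) (v.adicCompletionIntegers F) n : v.adicCompletionIntegers F) :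
        v.adicCompletion F) - (algebraMap F (Ad F) n) v = 0 := sub_self _
    rwa [this, map_zero]
  | zero =>
    refine ⟨0, N.zero_mem, ?_⟩
    have : ((0 : v.adicCompletionIntegers F) : v.adicCompletion F) -
        (algebraMap F (Ad F) ((0 : 𝓞 F) : F)) v = 0 := by
      rw [show ((0 : 𝓞 F) : F) = 0 from rfl, map_zero]
      exact sub_self 0
    rwa [this, map_zero]
  | add y y' _ _ hy hy' =>
    obtain ⟨n, hn, h⟩ := hy
    obtain ⟨n', hn', h'⟩ := hy'
    refine ⟨n + n', N.add_mem hn hn', ?_⟩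
    have : ((y + y' : v.adicCompletionIntegers F) : v.adicCompletion F) -
        (algebraMap F (Ad F) ((n + n' : 𝓞 F) : F)) v = ((y : v.adicCompletion F) -
        (algebraMap F (Ad F) n) v) + ((y' : v.adicCompletion F) - (algebraMap F (Ad F) n') v) := by
      rw [show ((n + n' : 𝓞 F) : F) = (n : F) + (n' : F) from rfl, map_add, adele_add_apply]
      exact add_sub_add_comm _ _ _ _
    rw [this]
    exact Valuation.map_add_lt _ h h'
  | smul c y _ hy =>
    obtain ⟨n, hn, h⟩ := hy
    obtain ⟨a, ha⟩ := BrandtHecke.exists_valued_sub_lt v c z c.2 hz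
    refine ⟨a * n, N.mul_mem_left _ hn, ?_⟩
    have : ((c • y : v.adicCompletionIntegers F) : v.adicCompletion F) -
        (algebraMap F (Ad F) ((a * n : 𝓞 F) : F)) v = (c : v.adicCompletion F) *
        ((y : v.adicCompletion F) - (algebraMap F (Ad F) n) v) +
        ((c : v.adicCompletion F) - (algebraMap F (Ad F) a) v) * (algebraMap F (Ad F) n) v := by
      rw [show ((a * n : 𝓞 F) : F) = (a : F) * (n : F) from rfl, map_mul, adele_mul_apply]
      change (c : v.adicCompletion F) * y - _ = _
      ring
    rw [this]
    refine Valuation.map_add_lt _ ?_ ?_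
    · rw [map_mul]
      exact mul_lt_of_le_one_of_lt c.2 h
    · rw [map_mul]
      exact mul_lt_of_lt_of_le_one ha (isIntegralAdele_algebraMap n v)

/-- An integer in `N 𝓞_v` for all `v` dividing `N` lies in `N`. -/
theorem mem_of_memLocalIdeal (hN : N ≠ ⊥) {m : 𝓞 F}
    (h : ∀ v : HeightOneSpectrum (𝓞 F), v.asIdeal ∣ N →
      MemLocalIdeal N v ((algebraMap F (Ad F) m) v)) : m ∈ N := by
  obtain ⟨n₀, hn₀, hn₀0⟩ := Submodule.exists_mem_ne_zero_of_ne_bot hN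
  -- the ideal of the `r` with `r m ∈ N` is contained in no prime, hence is the unit ideal
  let C : Ideal (𝓞 F) := N.colon {m}
  have hC : ∀ r, r ∈ C ↔ r * m ∈ N := fun r => Submodule.mem_colon_singleton
  by_contra hm
  have hCtop : C ≠ ⊤ := fun h' => hm (by
    have := (hC 1).1 (h' ▸ Submodule.mem_top)
    rwa [one_mul] at this)
  obtain ⟨q, hq, hCq⟩ := Ideal.exists_le_maximal C hCtop
  have hNq : N ≤ q := fun r hr => hCq ((hC r).2 (N.mul_mem_right _ hr))
  let v : HeightOneSpectrum (𝓞 F) := ⟨q, hq.isPrime, fun h0 => hN (le_bot_iff.1 (h0 ▸ hNq))⟩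
  have hn₀' : (n₀ : F) ≠ 0 := by simpa using hn₀0
  have hz : (algebraMap F (Ad F) n₀) v ≠ 0 := by
    rw [← Valuation.ne_zero_iff Valued.v, valued_algebraMap]
    exact (Valuation.ne_zero_iff _).2 hn₀'
  obtain ⟨n, hn, hlt⟩ := (h v (Ideal.dvd_iff_le.2 hNq)).exists_valued_sub_lt hz
  have h1 : v.valuation F (((m - n : 𝓞 F) : F) / n₀) ≤ 1 := by
    rw [map_div₀]
    refine div_le_one_of_le₀ ?_ zero_le
    rw [← valued_algebraMap, ← valued_algebraMap, show ((m - n : 𝓞 F) : F) = (m : F) - n from rfl,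
      map_sub]
    exact hlt.le
  obtain ⟨a, ⟨s, hs⟩, has⟩ := HeightOneSpectrum.exists_primeCompl_mul_eq_of_integer v _ h1
  refine hs (hCq ((hC s).2 ?_))
  have h2 : s * (m - n) = a * n₀ := by
    apply RingOfIntegers.coe_injective
    change (s : F) * ((m - n : 𝓞 F) : F) = a * n₀
    have h3 : ((m - n : 𝓞 F) : F) / n₀ * s = a := has
    rw [← h3]
    field_simp
  have h4 : s * m = a * n₀ + s * n := by rw [← h2]; ring
  rw [h4]
  exact N.add_mem (N.mul_mem_left _ hn₀) (N.mul_mem_left _ hn)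

theorem memLocalIdeal_of_not_dvd {v : HeightOneSpectrum (𝓞 F)} (hv : ¬ v.asIdeal ∣ N)
    {x : v.adicCompletion F} (hx : Valued.v x ≤ 1) : MemLocalIdeal N v x := by
  obtain ⟨n, hn, hnv⟩ := SetLike.not_le_iff_exists.1 fun h => hv (Ideal.dvd_iff_le.2 h)
  have h1 : Valued.v ((algebraMap F (Ad F) n) v) = 1 := by
    rw [valued_algebraMap, RingOfIntegers.coe_eq_algebraMap,
      HeightOneSpectrum.valuation_eq_one_iff_notMem]
    exact hnv
  have h0 : (algebraMap F (Ad F) n) v ≠ 0 := by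
    rw [← Valuation.ne_zero_iff Valued.v, h1]
    exact one_ne_zero
  have h2 : x = x * ((algebraMap F (Ad F) n) v)⁻¹ * (algebraMap F (Ad F) n) v := by
    rw [inv_mul_cancel_right₀ h0]
  rw [h2]
  refine MemLocalIdeal.mul ?_ (memLocalIdeal_of_mem hn v)
  rw [HeightOneSpectrum.mem_adicCompletionIntegers, map_mul, map_inv₀, h1, inv_one, mul_one]
  exact hx

theorem MemLocalIdeal.valued_lt_one {v : HeightOneSpectrum (𝓞 F)} (hv : v.asIdeal ∣ N)
    {x : v.adicCompletion F} (hx : MemLocalIdeal N v x) : Valued.v x < 1 := by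
  obtain ⟨n, hn, hlt⟩ := hx.exists_valued_sub_lt (one_ne_zero)
  rw [map_one] at hlt
  rw [← sub_add_cancel x ((algebraMap F (Ad F) n) v)]
  refine Valuation.map_add_lt _ hlt ?_
  rw [valued_algebraMap]
  exact (HeightOneSpectrum.valuation_lt_one_iff_mem v n).2 (Ideal.dvd_iff_le.1 hv hn)

theorem IsIntegralAdele.exists_memLocalIdeal (hN : N ≠ ⊥) {x : Ad F} (hx : IsIntegralAdele x) :
    ∃ m : 𝓞 F, ∀ v, MemLocalIdeal N v (x v - (algebraMap F (Ad F) m) v) := by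
  obtain ⟨n, hn, hn0⟩ := Submodule.exists_mem_ne_zero_of_ne_bot hN
  obtain ⟨m, y, hy, rfl⟩ := hx.exists_eq_add hn0
  refine ⟨m, fun v => ?_⟩
  rw [adele_add_apply, add_sub_cancel_left, adele_mul_apply, mul_comm]
  exact MemLocalIdeal.mul (hy v) (memLocalIdeal_of_mem hn v)

/-- Any approximating integer, not only the chosen one, computes the reduction. -/
theorem reduceAdele_eq (hN : N ≠ ⊥) {x : Ad F} {m : 𝓞 F}
    (h : ∀ v : HeightOneSpectrum (𝓞 F), v.asIdeal ∣ N →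
      MemLocalIdeal N v (x v - (algebraMap F (Ad F) m) v)) :
    reduceAdele N x = Ideal.Quotient.mk N m := by
  have hex : ∃ m : 𝓞 F, ∀ v : HeightOneSpectrum (𝓞 F), v.asIdeal ∣ N →
      MemLocalIdeal N v (x v - ((m : F) : v.adicCompletion F)) := ⟨m, h⟩
  rw [reduceAdele, dif_pos hex, Ideal.Quotient.eq]
  refine mem_of_memLocalIdeal hN fun v hv => ?_
  have h1 := (h v hv).sub (hex.choose_spec v hv)
  have h2 : (algebraMap F (Ad F) ((hex.choose - m : 𝓞 F) : F)) v =
      (x v - (algebraMap F (Ad F) m) v) - (x v - (algebraMap F (Ad F) hex.choose) v) := by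
    rw [show ((hex.choose - m : 𝓞 F) : F) = (hex.choose : F) - m from rfl, map_sub]
    exact (sub_sub_sub_cancel_left _ _ _).symm
  rw [h2]
  exact h1

theorem reduceAdele_congr {x y : Ad F}
    (h : ∀ v : HeightOneSpectrum (𝓞 F), v.asIdeal ∣ N → x v = y v) :
    reduceAdele N x = reduceAdele N y := by
  have key : ∀ P Q : 𝓞 F → Prop, P = Q → ∀ [Decidable (∃ m, P m)] [Decidable (∃ m, Q m)],
      (if h : ∃ m, P m then Ideal.Quotient.mk N h.choose else 0) =
        if h : ∃ m, Q m then Ideal.Quotient.mk N h.choose else 0 := by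
    rintro P Q rfl _ _
    congr
  unfold reduceAdele
  classical
  exact key _ _ (funext fun m => propext (forall₂_congr fun v hv => by rw [h v hv]))

theorem reduceAdele_algebraMap (hN : N ≠ ⊥) (m : 𝓞 F) :
    reduceAdele N (algebraMap F (Ad F) m) = Ideal.Quotient.mk N m :=
  reduceAdele_eq hN fun v _ => by
    rw [sub_self]
    exact memLocalIdeal_zero N v

theorem reduceAdele_zero (hN : N ≠ ⊥) : reduceAdele N (0 : Ad F) = 0 := by
  have := reduceAdele_algebraMap hN 0
  rwa [show ((0 : 𝓞 F) : F) = 0 from rfl, map_zero, map_zero] at this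

theorem reduceAdele_one (hN : N ≠ ⊥) : reduceAdele N (1 : Ad F) = 1 := by
  have := reduceAdele_algebraMap hN 1
  rwa [show ((1 : 𝓞 F) : F) = 1 from rfl, map_one, map_one] at this

theorem reduceAdele_add (hN : N ≠ ⊥) {x y : Ad F} (hx : IsIntegralAdele x)
    (hy : IsIntegralAdele y) : reduceAdele N (x + y) = reduceAdele N x + reduceAdele N y := by
  obtain ⟨m, hm⟩ := hx.exists_memLocalIdeal hN
  obtain ⟨n, hn⟩ := hy.exists_memLocalIdeal hN
  rw [reduceAdele_eq hN fun v _ => hm v, reduceAdele_eq hN fun v _ => hn v, ← map_add]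
  refine reduceAdele_eq hN fun v _ => ?_
  have := (hm v).add (hn v)
  rw [show ((m + n : 𝓞 F) : F) = (m : F) + n from rfl, map_add, adele_add_apply, adele_add_apply,
    add_sub_add_comm]
  exact this

theorem reduceAdele_mul (hN : N ≠ ⊥) {x y : Ad F} (hx : IsIntegralAdele x)
    (hy : IsIntegralAdele y) : reduceAdele N (x * y) = reduceAdele N x * reduceAdele N y := by
  obtain ⟨m, hm⟩ := hx.exists_memLocalIdeal hN
  obtain ⟨n, hn⟩ := hy.exists_memLocalIdeal hN
  rw [reduceAdele_eq hN fun v _ => hm v, reduceAdele_eq hN fun v _ => hn v, ← map_mul]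
  refine reduceAdele_eq hN fun v _ => ?_
  have := (MemLocalIdeal.mul (hy v) (hm v)).add
    (MemLocalIdeal.mul (isIntegralAdele_algebraMap m v) (hn v))
  rw [show ((m * n : 𝓞 F) : F) = (m : F) * n from rfl, map_mul, adele_mul_apply, adele_mul_apply]
  convert this using 1
  ring

theorem reduceAdele_eq_zero_iff (hN : N ≠ ⊥) {x : Ad F} (hx : IsIntegralAdele x) :
    reduceAdele N x = 0 ↔ ∀ v, MemLocalIdeal N v (x v) := by
  obtain ⟨m, hm⟩ := hx.exists_memLocalIdeal hN
  rw [reduceAdele_eq hN fun v _ => hm v, Ideal.Quotient.eq_zero_iff_mem]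
  refine ⟨fun h v => ?_, fun h => mem_of_memLocalIdeal hN fun v _ => ?_⟩
  · have := (hm v).add (memLocalIdeal_of_mem h v)
    rwa [sub_add_cancel] at this
  · have := (h v).sub (hm v)
    rwa [sub_sub_cancel] at this

variable (N) in
/-- The reduction modulo `N` of an adelic matrix that is integral at the primes dividing `N`. -/
def reduceMatrix (m : Matrix (Fin 2) (Fin 2) (Ad F)) : Matrix (Fin 2) (Fin 2) (𝓞 F ⧸ N) :=
  Matrix.of fun i j => reduceAdele N (m i j)

theorem reduceMatrix_mul (hN : N ≠ ⊥) {m m' : Matrix (Fin 2) (Fin 2) (Ad F)}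
    (hm : IsIntegralMatrix m) (hm' : IsIntegralMatrix m') :
    reduceMatrix N (m * m') = reduceMatrix N m * reduceMatrix N m' := by
  refine Matrix.ext fun i j => ?_
  rw [Matrix.mul_apply, Fin.sum_univ_two]
  simp only [reduceMatrix, Matrix.of_apply]
  rw [Matrix.mul_apply, Fin.sum_univ_two, reduceAdele_add hN ((hm _ _).mul (hm' _ _))
    ((hm _ _).mul (hm' _ _)), reduceAdele_mul hN (hm _ _) (hm' _ _),
    reduceAdele_mul hN (hm _ _) (hm' _ _)]

theorem reduceMatrix_one (hN : N ≠ ⊥) :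
    reduceMatrix N (1 : Matrix (Fin 2) (Fin 2) (Ad F)) = 1 := by
  refine Matrix.ext fun i j => ?_
  simp only [reduceMatrix, Matrix.of_apply]
  rw [Matrix.one_apply, Matrix.one_apply]
  split_ifs
  · exact reduceAdele_one hN
  · exact reduceAdele_zero hN

theorem reduceMatrix_congr {m m' : Matrix (Fin 2) (Fin 2) (Ad F)}
    (h : ∀ v : HeightOneSpectrum (𝓞 F), v.asIdeal ∣ N → evalMatrix v m = evalMatrix v m') :
    reduceMatrix N m = reduceMatrix N m' := by
  refine Matrix.ext fun i j => reduceAdele_congr fun v hv => ?_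
  exact congrFun (congrFun (h v hv) i) j

theorem reduceMatrix_inv_mul (hN : N ≠ ⊥) {g : (Matrix (Fin 2) (Fin 2) (Ad F))ˣ}
    (hg : g ∈ integralGL F) : reduceMatrix N g⁻¹.1 * reduceMatrix N g.1 = 1 := by
  rw [← reduceMatrix_mul hN hg.2 hg.1, Units.inv_mul, reduceMatrix_one hN]

end Reduction

/-! ### The projective line modulo `N` -/

section ProjectiveLine

theorem isCoprime_col {A : Type*} [CommRing A] {M M' : Matrix (Fin 2) (Fin 2) A}
    (h : M' * M = 1) : IsCoprime (M 0 0) (M 1 0) := by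
  refine ⟨M' 0 0, M' 0 1, ?_⟩
  have h00 := congrFun (congrFun h 0) 0
  rwa [Matrix.mul_apply, Fin.sum_univ_two, Matrix.one_apply_eq] at h00

variable {F : Type*} [Field F] [NumberField F] {N : Ideal (𝓞 F)}

/-- The point `g (1 : 0)` of the projective line over `𝓞_F / N`, for `g ∈ GL₂(Ô)`. -/
def pointOf (hN : N ≠ ⊥) (g : integralGL F) : P1 (𝓞 F ⧸ N) :=
  Quotient.mk (p1Setoid _) ⟨(reduceMatrix N g.1.1).col 0,
    isCoprime_col (reduceMatrix_inv_mul hN g.2)⟩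

theorem pointOf_eq_iff (hN : N ≠ ⊥) {g h : integralGL F} : pointOf hN g = pointOf hN h ↔
    ∃ c : (𝓞 F ⧸ N)ˣ, (reduceMatrix N h.1.1).col 0 = (c : 𝓞 F ⧸ N) • (reduceMatrix N g.1.1).col 0 :=
  Quotient.eq (r := p1Setoid _)

theorem mem_gammaZero_iff (hN : N ≠ ⊥) {g : (Matrix (Fin 2) (Fin 2) (Ad F))ˣ} :
    g ∈ gammaZero N ↔ g ∈ integralGL F ∧ reduceMatrix N g.1 1 0 = 0 := by
  constructor
  · rintro ⟨h1, h2, h3⟩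
    exact ⟨⟨h1, h2⟩, (reduceAdele_eq_zero_iff hN (h1 1 0)).2 h3⟩
  · rintro ⟨⟨h1, h2⟩, h3⟩
    exact ⟨h1, h2, (reduceAdele_eq_zero_iff hN (h1 1 0)).1 h3⟩

/-- The stabilizer of `(1 : 0)` in `GL₂(Ô)` is `U₀(N)`. -/
theorem pointOf_eq_iff_mem (hN : N ≠ ⊥) {g h : integralGL F} :
    pointOf hN g = pointOf hN h ↔ g.1⁻¹ * h.1 ∈ gammaZero N := by
  have hk : g.1⁻¹ * h.1 ∈ integralGL F := mul_mem (inv_mem g.2) h.2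
  have hred : reduceMatrix N (g.1⁻¹ * h.1).1 = reduceMatrix N g.1⁻¹.1 * reduceMatrix N h.1.1 :=
    reduceMatrix_mul hN g.2.2 h.2.1
  have hred' : reduceMatrix N h.1.1 = reduceMatrix N g.1.1 * reduceMatrix N (g.1⁻¹ * h.1).1 := by
    rw [← reduceMatrix_mul hN g.2.1 hk.1, ← Units.val_mul, mul_inv_cancel_left]
  have hinv := reduceMatrix_inv_mul hN g.2
  have hkinv := reduceMatrix_inv_mul hN hk
  rw [pointOf_eq_iff, mem_gammaZero_iff hN, and_iff_right hk]
  generalize reduceMatrix N (g.1⁻¹ * h.1).1 = k at *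
  generalize reduceMatrix N (g.1⁻¹ * h.1)⁻¹.1 = k' at *
  generalize reduceMatrix N g.1.1 = a at *
  generalize reduceMatrix N g.1⁻¹.1 = a' at *
  constructor
  · rintro ⟨c, hc⟩
    have h0 : reduceMatrix N h.1.1 0 0 = c * a 0 0 := congrFun hc 0
    have h1 : reduceMatrix N h.1.1 1 0 = c * a 1 0 := congrFun hc 1
    have h10 := congrFun (congrFun hinv 1) 0
    rw [Matrix.mul_apply, Fin.sum_univ_two, Matrix.one_apply_ne (by decide)] at h10
    rw [hred, Matrix.mul_apply, Fin.sum_univ_two, h0, h1]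
    linear_combination (c : 𝓞 F ⧸ N) * h10
  · intro hk0
    have h00 := congrFun (congrFun hkinv 0) 0
    rw [Matrix.mul_apply, Fin.sum_univ_two, Matrix.one_apply_eq, hk0, mul_zero, add_zero] at h00
    refine ⟨Units.mkOfMulEqOne (k 0 0) (k' 0 0) (by rw [mul_comm]; exact h00), ?_⟩
    funext i
    change reduceMatrix N h.1.1 i 0 = k 0 0 * a i 0
    rw [hred', Matrix.mul_apply, Fin.sum_univ_two, hk0, mul_zero, add_zero, mul_comm]

/-- `GL₂(Ô)` acts transitively on the projective line over `𝓞_F / N`. -/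
theorem pointOf_surjective (hN : N ≠ ⊥) : Function.Surjective (pointOf (F := F) hN) := by
  classical
  intro x
  induction x using Quotient.inductionOn with
  | _ w =>
  obtain ⟨w, hw⟩ := w
  obtain ⟨w0, hw0⟩ := Ideal.Quotient.mk_surjective (w 0)
  obtain ⟨w1, hw1⟩ := Ideal.Quotient.mk_surjective (w 1)
  have hcop : ∀ v : HeightOneSpectrum (𝓞 F), v.asIdeal ∣ N → w0 ∈ v.asIdeal → w1 ∉ v.asIdeal := by
    intro v hv h0 h1
    obtain ⟨a, b, hab⟩ := hw
    obtain ⟨a, rfl⟩ := Ideal.Quotient.mk_surjective a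
    obtain ⟨b, rfl⟩ := Ideal.Quotient.mk_surjective b
    rw [← hw0, ← hw1, ← map_mul, ← map_mul, ← map_add, ← map_one (Ideal.Quotient.mk N),
      Ideal.Quotient.eq] at hab
    refine v.isPrime.ne_top ((Ideal.eq_top_iff_one _).2 ?_)
    have h2 := v.asIdeal.sub_mem (v.asIdeal.add_mem (v.asIdeal.mul_mem_left a h0)
      (v.asIdeal.mul_mem_left b h1)) (Ideal.dvd_iff_le.1 hv hab)
    rwa [sub_sub_cancel] at h2
  have hval : ∀ (v : HeightOneSpectrum (𝓞 F)) (m : 𝓞 F), m ∉ v.asIdeal →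
      Valued.v ((algebraMap F (Ad F) m) v) = 1 := fun v m hm => by
    rw [valued_algebraMap, RingOfIntegers.coe_eq_algebraMap,
      HeightOneSpectrum.valuation_eq_one_iff_notMem]
    exact hm
  -- complete the column locally to an invertible matrix, by a unit vector
  let c : ∀ v : HeightOneSpectrum (𝓞 F), Matrix (Fin 2) (Fin 2) (v.adicCompletion F) := fun v =>
    !![(algebraMap F (Ad F) w0) v, if w0 ∈ v.asIdeal then 1 else 0;
      (algebraMap F (Ad F) w1) v, if w0 ∈ v.asIdeal then 0 else 1]
  have hcdet : ∀ v : HeightOneSpectrum (𝓞 F), v.asIdeal ∣ N → Valued.v (c v).det = 1 := by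
    intro v hv
    by_cases h : w0 ∈ v.asIdeal
    · have : (c v).det = -(algebraMap F (Ad F) w1) v := by
        simp [c, Matrix.det_fin_two, h]
      rw [this, Valuation.map_neg]
      exact hval v w1 (hcop v hv h)
    · have : (c v).det = (algebraMap F (Ad F) w0) v := by
        simp [c, Matrix.det_fin_two, h]
      rw [this]
      exact hval v w0 h
  have hcunit : ∀ v : HeightOneSpectrum (𝓞 F), v.asIdeal ∣ N → IsUnit (c v) := fun v hv =>
    (Matrix.isUnit_iff_isUnit_det _).2 (isUnit_iff_ne_zero.2 fun h => by
      have := hcdet v hv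
      rw [h, map_zero] at this
      exact zero_ne_one this)
  obtain ⟨g, hg, hgv, -⟩ := exists_mem_integralGL (N := N)
    (fun v => if h : v.asIdeal ∣ N then (hcunit v h).unit else 1)
    (fun v hv i j => by
      rw [dif_pos hv, IsUnit.unit_spec]
      have h0 := isIntegralAdele_algebraMap w0 v
      have h1 := isIntegralAdele_algebraMap w1 v
      rw [HeightOneSpectrum.mem_adicCompletionIntegers] at h0 h1
      fin_cases i <;> fin_cases j
      · exact h0
      · change Valued.v (if w0 ∈ v.asIdeal then (1 : v.adicCompletion F) else 0) ≤ 1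
        split_ifs <;> simp
      · exact h1
      · change Valued.v (if w0 ∈ v.asIdeal then (0 : v.adicCompletion F) else 1) ≤ 1
        split_ifs <;> simp)
    (fun v hv => by
      rw [dif_pos hv, IsUnit.unit_spec]
      exact hcdet v hv)
  refine ⟨⟨g, hg⟩, ?_⟩
  have hgv' : ∀ v : HeightOneSpectrum (𝓞 F), v.asIdeal ∣ N →
      evalMatrix v g.1 = c v := fun v hv => by
    rw [hgv v hv, dif_pos hv, IsUnit.unit_spec]
  have e0 : reduceAdele N (g.1 0 0) = w 0 := by
    rw [← hw0, ← reduceAdele_algebraMap hN]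
    exact reduceAdele_congr fun v hv => congrFun (congrFun (hgv' v hv) 0) 0
  have e1 : reduceAdele N (g.1 1 0) = w 1 := by
    rw [← hw1, ← reduceAdele_algebraMap hN]
    exact reduceAdele_congr fun v hv => congrFun (congrFun (hgv' v hv) 1) 0
  refine congrArg (Quotient.mk (p1Setoid _)) (Subtype.ext ?_)
  funext i
  fin_cases i
  · exact e0
  · exact e1

end ProjectiveLine

/-! ### The double coset of `diag(1, ϖ)` -/

section HeckeMatrices

variable {F : Type*} [Field F] [NumberField F] {N : Ideal (𝓞 F)} {p : HeightOneSpectrum (𝓞 F)}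

theorem valued_eq_one_of_isUnit_reduceAdele (hN : N ≠ ⊥) {x : Ad F} (hx : IsIntegralAdele x)
    (h : IsUnit (reduceAdele N x)) {v : HeightOneSpectrum (𝓞 F)} (hv : v.asIdeal ∣ N) :
    Valued.v (x v) = 1 := by
  obtain ⟨m, hm⟩ := hx.exists_memLocalIdeal hN
  rw [reduceAdele_eq hN fun v _ => hm v] at h
  obtain ⟨b, hb⟩ := h.exists_right_inv
  obtain ⟨n, rfl⟩ := Ideal.Quotient.mk_surjective b
  rw [← map_mul, ← map_one (Ideal.Quotient.mk N), Ideal.Quotient.eq] at hb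
  refine le_antisymm (hx v) (not_lt.1 fun hlt => ?_)
  have h1 : Valued.v ((algebraMap F (Ad F) m) v) < 1 := by
    rw [← sub_sub_cancel (x v) ((algebraMap F (Ad F) m) v)]
    exact Valuation.map_sub_lt _ hlt ((hm v).valued_lt_one hv)
  rw [valued_algebraMap] at h1
  have h2 := (HeightOneSpectrum.valuation_lt_one_iff_mem v m).1 h1
  refine v.isPrime.ne_top ((Ideal.eq_top_iff_one _).2 ?_)
  have h3 := v.asIdeal.sub_mem (v.asIdeal.mul_mem_right n h2) (Ideal.dvd_iff_le.1 hv hb)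
  rwa [sub_sub_cancel] at h3

theorem valued_le_exp_neg_one {v : HeightOneSpectrum (𝓞 F)} {x : v.adicCompletion F}
    (hx : Valued.v x < 1) : Valued.v x ≤ WithZero.exp (-1 : ℤ) := by
  by_cases h : Valued.v x = 0
  · rw [h]
    exact zero_le
  · rw [← WithZero.exp_log h] at hx ⊢
    rw [← WithZero.exp_zero, WithZero.exp_lt_exp] at hx
    rw [WithZero.exp_le_exp]
    omega

/-- An integral local matrix whose determinant is a uniformizer is brought by a row operation to
one whose second row is divisible by the uniformizer. If the upper left entry is a unit, the
operation makes the lower left one zero, which keeps track of the level when the prime divides `N`. -/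
theorem exists_row_operation {v : HeightOneSpectrum (𝓞 F)}
    {M : Matrix (Fin 2) (Fin 2) (v.adicCompletion F)} (hM : ∀ i j, Valued.v (M i j) ≤ 1)
    (hdet : Valued.v M.det = WithZero.exp (-1 : ℤ)) :
    ∃ E : Matrix (Fin 2) (Fin 2) (v.adicCompletion F), (∀ i j, Valued.v (E i j) ≤ 1) ∧ E.det = 1 ∧
      (∀ j, Valued.v ((E * M) 1 j) ≤ WithZero.exp (-1 : ℤ)) ∧
      (Valued.v (M 0 0) = 1 → E 1 0 = -(M 0 0)⁻¹ * M 1 0 ∧ (E * M) 1 0 = 0) := by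
  have key : ∀ (z w : v.adicCompletion F), Valued.v z ≤ 1 → Valued.v w ≤ 1 → z = 1 ∨ w = 1 →
      ∃ E : Matrix (Fin 2) (Fin 2) (v.adicCompletion F), (∀ i j, Valued.v (E i j) ≤ 1) ∧
        E.det = 1 ∧ E 1 0 = z ∧ ∀ j, (E * M) 1 j = z * M 0 j + w * M 1 j := by
    rintro z w hz hw (rfl | rfl)
    · refine ⟨!![0, -1; 1, w], fun i j => ?_, by simp [Matrix.det_fin_two], rfl, fun j => ?_⟩
      · fin_cases i <;> fin_cases j <;> simp [hw]
      · rw [Matrix.mul_apply, Fin.sum_univ_two]; rfl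
    · refine ⟨!![1, 0; z, 1], fun i j => ?_, by simp [Matrix.det_fin_two], rfl, fun j => ?_⟩
      · fin_cases i <;> fin_cases j <;> simp [hz]
      · rw [Matrix.mul_apply, Fin.sum_univ_two]; rfl
  have hne : ∀ {x : v.adicCompletion F}, Valued.v x = 1 → x ≠ 0 := fun {x} hx h => by
    rw [h, map_zero] at hx
    exact zero_ne_one hx
  have hq : ∀ {x y : v.adicCompletion F}, Valued.v x = 1 → Valued.v y ≤ 1 →
      Valued.v (-x⁻¹ * y) ≤ 1 := fun {x y} hx hy => by
    rw [map_mul, Valuation.map_neg, map_inv₀, hx, inv_one, one_mul]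
    exact hy
  have hd : ∀ {x : v.adicCompletion F}, Valued.v x = 1 →
      Valued.v (x⁻¹ * M.det) ≤ WithZero.exp (-1 : ℤ) := fun {x} hx => by
    rw [map_mul, map_inv₀, hx, inv_one, one_mul, hdet]
  have h0 : Valued.v (0 : v.adicCompletion F) ≤ WithZero.exp (-1 : ℤ) := by
    rw [map_zero]
    exact zero_le
  have hdet' := Matrix.det_fin_two M
  by_cases ha : Valued.v (M 0 0) = 1
  · obtain ⟨E, h1, h2, h3, h4⟩ := key (-(M 0 0)⁻¹ * M 1 0) 1 (hq ha (hM _ _)) (map_one _).le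
      (Or.inr rfl)
    have ha' := hne ha
    have e0 : (E * M) 1 0 = 0 := by
      rw [h4]
      field_simp
      ring
    have e1 : (E * M) 1 1 = (M 0 0)⁻¹ * M.det := by
      rw [h4, hdet']
      field_simp
      ring
    refine ⟨E, h1, h2, fun j => ?_, fun _ => ⟨h3, e0⟩⟩
    fin_cases j
    · exact (congrArg Valued.v e0).trans_le h0
    · exact (congrArg Valued.v e1).trans_le (hd ha)
  · by_cases hc : Valued.v (M 1 0) = 1
    · obtain ⟨E, h1, h2, -, h4⟩ := key 1 (-(M 1 0)⁻¹ * M 0 0) (map_one _).le (hq hc (hM _ _))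
        (Or.inl rfl)
      have hc' := hne hc
      have e0 : (E * M) 1 0 = 0 := by
        rw [h4]
        field_simp
        ring
      have e1 : (E * M) 1 1 = -((M 1 0)⁻¹ * M.det) := by
        rw [h4, hdet']
        field_simp
        ring
      refine ⟨E, h1, h2, fun j => ?_, fun h => absurd h ha⟩
      fin_cases j
      · exact (congrArg Valued.v e0).trans_le h0
      · exact (congrArg Valued.v e1).trans_le ((Valuation.map_neg _ _).trans_le (hd hc))
    · by_cases hb : Valued.v (M 0 1) = 1
      · obtain ⟨E, h1, h2, -, h4⟩ := key (-(M 0 1)⁻¹ * M 1 1) 1 (hq hb (hM _ _)) (map_one _).le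
          (Or.inr rfl)
        have hb' := hne hb
        have e0 : (E * M) 1 0 = -((M 0 1)⁻¹ * M.det) := by
          rw [h4, hdet']
          field_simp
          ring
        have e1 : (E * M) 1 1 = 0 := by
          rw [h4]
          field_simp
          ring
        refine ⟨E, h1, h2, fun j => ?_, fun h => absurd h ha⟩
        fin_cases j
        · exact (congrArg Valued.v e0).trans_le ((Valuation.map_neg _ _).trans_le (hd hb))
        · exact (congrArg Valued.v e1).trans_le h0
      · -- as `det M` is divisible only once by the uniformizer, some entry is a unit
        have hd1 : Valued.v (M 1 1) = 1 := by
          by_contra hd1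
          have hlt : ∀ {x : v.adicCompletion F}, Valued.v x ≤ 1 → ¬ Valued.v x = 1 →
              Valued.v x ≤ WithZero.exp (-1 : ℤ) :=
            fun h1 h2 => valued_le_exp_neg_one (lt_of_le_of_ne h1 h2)
          have h2 : Valued.v M.det ≤ WithZero.exp (-2 : ℤ) := by
            rw [hdet']
            rw [show (-2 : ℤ) = -1 + -1 from rfl, WithZero.exp_add]
            refine (Valuation.map_sub _ _ _).trans (max_le ?_ ?_) <;> rw [map_mul]
            · exact mul_le_mul' (hlt (hM _ _) ha) (hlt (hM _ _) hd1)
            · exact mul_le_mul' (hlt (hM _ _) hb) (hlt (hM _ _) hc)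
          rw [hdet, WithZero.exp_le_exp] at h2
          omega
        obtain ⟨E, h1, h2, -, h4⟩ := key 1 (-(M 1 1)⁻¹ * M 0 1) (map_one _).le (hq hd1 (hM _ _))
          (Or.inl rfl)
        have hd' := hne hd1
        have e0 : (E * M) 1 0 = (M 1 1)⁻¹ * M.det := by
          rw [h4, hdet']
          field_simp
          ring
        have e1 : (E * M) 1 1 = 0 := by
          rw [h4]
          field_simp
          ring
        refine ⟨E, h1, h2, fun j => ?_, fun h => absurd h ha⟩
        fin_cases j
        · exact (congrArg Valued.v e0).trans_le (hd hd1)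
        · exact (congrArg Valued.v e1).trans_le h0

variable (N p) in
/-- The adelic description of the double coset `U₀(N) diag(1, ϖ) U₀(N)`: integral matrices with
determinant a uniformizer at `p` and a unit elsewhere, whose first column is a unit multiple
of `(1, 0)` modulo `N`. -/
structure IsHeckeMatrix (m : (Matrix (Fin 2) (Fin 2) (Ad F))ˣ) : Prop where
  integral : IsIntegralMatrix m.1
  valued_det : ∀ v, Valued.v (m.1.det v) = Valued.v ((uniformizerIdele p : Ad F) v)
  lower_left : reduceMatrix N m.1 1 0 = 0
  isUnit : IsUnit (reduceMatrix N m.1 0 0)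

theorem diagUniformizer_val (p : HeightOneSpectrum (𝓞 F)) :
    (diagUniformizer p).1 = !![1, 0; 0, (uniformizerIdele p : Ad F)] := by
  refine Matrix.ext fun i j => ?_
  fin_cases i <;> fin_cases j <;> rfl

theorem diagUniformizer_inv_val (p : HeightOneSpectrum (𝓞 F)) :
    (diagUniformizer p)⁻¹.1 = !![1, 0; 0, ((uniformizerIdele p)⁻¹ : (Ad F)ˣ).1] := by
  refine Matrix.ext fun i j => ?_
  fin_cases i <;> fin_cases j <;> rfl

theorem isHeckeMatrix_diagUniformizer (hN : N ≠ ⊥) : IsHeckeMatrix N p (diagUniformizer p) where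
  integral := by
    rw [diagUniformizer_val]
    exact isIntegralMatrix_of isIntegralAdele_one isIntegralAdele_zero isIntegralAdele_zero
      (isIntegralAdele_uniformizerIdele p)
  valued_det v := by
    rw [diagUniformizer_val, Matrix.det_fin_two_of, one_mul, mul_zero, sub_zero]
  lower_left := by
    rw [diagUniformizer_val]
    exact reduceAdele_zero hN
  isUnit := by
    rw [diagUniformizer_val]
    exact (congrArg IsUnit (reduceAdele_one hN)).mpr isUnit_one

theorem isUnit_reduceMatrix_of_mem_gammaZero (hN : N ≠ ⊥)
    {u : (Matrix (Fin 2) (Fin 2) (Ad F))ˣ} (hu : u ∈ gammaZero N) :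
    IsUnit (reduceMatrix N u.1 0 0) := by
  have h := (mem_gammaZero_iff hN).1 hu
  have h1 := congrFun (congrFun (reduceMatrix_inv_mul hN h.1) 0) 0
  rw [Matrix.mul_apply, Fin.sum_univ_two, h.2, mul_zero, add_zero, Matrix.one_apply_eq] at h1
  exact IsUnit.of_mul_eq_one _ (by rw [mul_comm]; exact h1)

theorem IsHeckeMatrix.mul_left (hN : N ≠ ⊥) {m u : (Matrix (Fin 2) (Fin 2) (Ad F))ˣ}
    (hm : IsHeckeMatrix N p m) (hu : u ∈ gammaZero N) : IsHeckeMatrix N p (u * m) := by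
  have h := (mem_gammaZero_iff hN).1 hu
  refine ⟨h.1.1.mul hm.integral, fun v => ?_, ?_, ?_⟩
  · rw [Units.val_mul, Matrix.det_mul, adele_mul_apply, map_mul, valued_det_of_mem_integralGL h.1,
      one_mul, hm.valued_det]
  · rw [Units.val_mul, reduceMatrix_mul hN h.1.1 hm.integral, Matrix.mul_apply, Fin.sum_univ_two,
      h.2, hm.lower_left, zero_mul, mul_zero, add_zero]
  · rw [Units.val_mul, reduceMatrix_mul hN h.1.1 hm.integral, Matrix.mul_apply, Fin.sum_univ_two,
      hm.lower_left, mul_zero, add_zero]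
    exact (isUnit_reduceMatrix_of_mem_gammaZero hN hu).mul hm.isUnit

theorem IsHeckeMatrix.mul_right (hN : N ≠ ⊥) {m u : (Matrix (Fin 2) (Fin 2) (Ad F))ˣ}
    (hm : IsHeckeMatrix N p m) (hu : u ∈ gammaZero N) : IsHeckeMatrix N p (m * u) := by
  have h := (mem_gammaZero_iff hN).1 hu
  refine ⟨hm.integral.mul h.1.1, fun v => ?_, ?_, ?_⟩
  · rw [Units.val_mul, Matrix.det_mul, adele_mul_apply, map_mul, valued_det_of_mem_integralGL h.1,
      mul_one, hm.valued_det]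
  · rw [Units.val_mul, reduceMatrix_mul hN hm.integral h.1.1, Matrix.mul_apply, Fin.sum_univ_two,
      h.2, hm.lower_left, zero_mul, mul_zero, add_zero]
  · rw [Units.val_mul, reduceMatrix_mul hN hm.integral h.1.1, Matrix.mul_apply, Fin.sum_univ_two,
      h.2, mul_zero, add_zero]
    exact hm.isUnit.mul (isUnit_reduceMatrix_of_mem_gammaZero hN hu)

theorem dvd_asIdeal_iff {v p : HeightOneSpectrum (𝓞 F)} : v.asIdeal ∣ p.asIdeal ↔ v = p := by
  refine ⟨fun h => ?_, fun h => h ▸ dvd_rfl⟩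
  exact HeightOneSpectrum.ext (p.isMaximal.eq_of_le v.isPrime.ne_top (Ideal.dvd_iff_le.1 h)).symm

theorem IsHeckeMatrix.exists_eq_mul (hN : N ≠ ⊥) {m : (Matrix (Fin 2) (Fin 2) (Ad F))ˣ}
    (hm : IsHeckeMatrix N p m) :
    ∃ u ∈ gammaZero N, ∃ w ∈ gammaZero N, m = u * diagUniformizer p * w := by
  have hunit : ∀ v, v.asIdeal ∣ N → Valued.v (m.1 0 0 v) = 1 := fun v hv =>
    valued_eq_one_of_isUnit_reduceAdele hN (hm.integral 0 0) hm.isUnit hv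
  have hlow : ∀ v, MemLocalIdeal N v (m.1 1 0 v) :=
    (reduceAdele_eq_zero_iff hN (hm.integral 1 0)).1 hm.lower_left
  obtain ⟨E, hE, hEdet, hrow, hE0⟩ := exists_row_operation (M := evalMatrix p m.1)
    (fun i j => hm.integral i j p) (by
      rw [evalMatrix_det, hm.valued_det, valued_uniformizerIdele_same])
  have hEunit : IsUnit E := (Matrix.isUnit_iff_isUnit_det _).2 (hEdet ▸ isUnit_one)
  classical
  obtain ⟨A, hA, hAp, hAv⟩ := exists_mem_integralGL (N := p.asIdeal)
    (fun v => if h : v = p then h ▸ hEunit.unit else 1)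
    (fun v hv i j => by
      obtain rfl := dvd_asIdeal_iff.1 hv
      rw [dif_pos rfl]
      exact hE i j)
    (fun v hv => by
      obtain rfl := dvd_asIdeal_iff.1 hv
      rw [dif_pos rfl]
      exact (congrArg Valued.v hEdet).trans (map_one _))
  have hAp : evalMatrix p A.1 = E := by
    rw [hAp p dvd_rfl, dif_pos rfl]
    rfl
  have hAv : ∀ v, v ≠ p → evalMatrix v A.1 = 1 := fun v hv =>
    hAv v fun h => hv (dvd_asIdeal_iff.1 h)
  have hAm : IsIntegralMatrix (A.1 * m.1) := hA.1.mul hm.integral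
  have hAmp : evalMatrix p (A.1 * m.1) = E * evalMatrix p m.1 := by rw [map_mul, hAp]
  have hAmv : ∀ v, v ≠ p → evalMatrix v (A.1 * m.1) = evalMatrix v m.1 := fun v hv => by
    rw [map_mul, hAv v hv, one_mul]
  -- at `𝔭 ∣ N` the row operation has lower left entry in `N`, as that of `m` is
  have hA0 : A ∈ gammaZero N := by
    refine ⟨hA.1, hA.2, fun v => ?_⟩
    by_cases hv : v = p
    · subst hv
      by_cases hvN : v.asIdeal ∣ N
      · have : A.1 1 0 v = -(m.1 0 0 v)⁻¹ * m.1 1 0 v :=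
          (congrFun (congrFun hAp 1) 0).trans (hE0 (hunit v hvN)).1
        rw [this]
        refine MemLocalIdeal.mul ?_ (hlow v)
        rw [HeightOneSpectrum.mem_adicCompletionIntegers, Valuation.map_neg, map_inv₀,
          hunit v hvN, inv_one]
      · exact memLocalIdeal_of_not_dvd hvN (hA.1 1 0 v)
    · have : A.1 1 0 v = 0 := congrFun (congrFun (hAv v hv) 1) 0
      rw [this]
      exact memLocalIdeal_zero N v
  have hw : ((diagUniformizer p)⁻¹ * (A * m)).1 = !![(A.1 * m.1) 0 0, (A.1 * m.1) 0 1;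
      ((uniformizerIdele p)⁻¹ : (Ad F)ˣ).1 * (A.1 * m.1) 1 0,
      ((uniformizerIdele p)⁻¹ : (Ad F)ˣ).1 * (A.1 * m.1) 1 1] := by
    rw [Units.val_mul, Units.val_mul, diagUniformizer_inv_val]
    generalize A.1 * m.1 = z
    refine Matrix.ext fun i j => ?_
    rw [Matrix.mul_apply, Fin.sum_univ_two]
    fin_cases i <;> fin_cases j <;> simp
  have hscale : ∀ j, IsIntegralAdele (((uniformizerIdele p)⁻¹ : (Ad F)ˣ).1 * (A.1 * m.1) 1 j) := by
    intro j v
    rw [HeightOneSpectrum.mem_adicCompletionIntegers, adele_mul_apply, map_mul, valued_units_inv]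
    by_cases hv : v = p
    · subst hv
      rw [valued_uniformizerIdele_same, show (A.1 * m.1) 1 j v = (E * evalMatrix v m.1) 1 j from
        congrFun (congrFun hAmp 1) j]
      refine (mul_le_mul_right (hrow j) _).trans_eq ?_
      exact inv_mul_cancel₀ (WithZero.exp_ne_zero (a := (-1 : ℤ)))
    · rw [uniformizerIdele_of_ne hv, map_one, inv_one, one_mul]
      exact hAm 1 j v
  have hwmem : (diagUniformizer p)⁻¹ * (A * m) ∈ gammaZero N := by
    have h1 : (diagUniformizer p)⁻¹ * (A * m) ∈ integralGL F := by
      refine mem_integralGL_of_det ?_ fun v => ?_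
      · rw [hw]
        exact isIntegralMatrix_of (hAm 0 0) (hAm 0 1) (hscale 0) (hscale 1)
      · have h1 : ((diagUniformizer p)⁻¹ * (A * m)).1.det =
            ((uniformizerIdele p)⁻¹ : (Ad F)ˣ).1 * (A.1.det * m.1.det) := by
          rw [Units.val_mul, Units.val_mul, Matrix.det_mul, Matrix.det_mul,
            diagUniformizer_inv_val, Matrix.det_fin_two_of, one_mul, mul_zero, sub_zero]
        rw [h1, adele_mul_apply, adele_mul_apply, map_mul, map_mul, valued_units_inv,
          valued_det_of_mem_integralGL hA, hm.valued_det, one_mul]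
        exact inv_mul_cancel₀ ((Valuation.ne_zero_iff _).2 (units_apply_ne_zero _ _))
    refine ⟨h1.1, h1.2, fun v => ?_⟩
    by_cases hvN : v.asIdeal ∣ N
    · have h2 : ((diagUniformizer p)⁻¹ * (A * m)).1 1 0 v =
          ((uniformizerIdele p)⁻¹ : (Ad F)ˣ).1 v * (A.1 * m.1) 1 0 v := by
        rw [hw]
        rfl
      rw [h2]
      by_cases hv : v = p
      · subst hv
        have h3 : (A.1 * m.1) 1 0 v = 0 :=
          (congrFun (congrFun hAmp 1) 0).trans (hE0 (hunit v hvN)).2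
        rw [h3, mul_zero]
        exact memLocalIdeal_zero N v
      · refine MemLocalIdeal.mul ?_ ?_
        · rw [HeightOneSpectrum.mem_adicCompletionIntegers, valued_units_inv,
            uniformizerIdele_of_ne hv, map_one, inv_one]
        · rw [show (A.1 * m.1) 1 0 v = m.1 1 0 v from congrFun (congrFun (hAmv v hv) 1) 0]
          exact hlow v
    · exact memLocalIdeal_of_not_dvd hvN (h1.1 1 0 v)
  refine ⟨A⁻¹, inv_mem hA0, _, hwmem, ?_⟩
  rw [mul_assoc, mul_inv_cancel_left, inv_mul_cancel_left]

/-- The double coset of `diag(1, ϖ)`. -/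
theorem isHeckeMatrix_iff (hN : N ≠ ⊥) {m : (Matrix (Fin 2) (Fin 2) (Ad F))ˣ} :
    IsHeckeMatrix N p m ↔
      ∃ u ∈ gammaZero N, ∃ w ∈ gammaZero N, m = u * diagUniformizer p * w := by
  refine ⟨fun h => h.exists_eq_mul hN, ?_⟩
  rintro ⟨u, hu, w, hw, rfl⟩
  exact ((isHeckeMatrix_diagUniformizer hN).mul_left hN hu).mul_right hN hw

end HeckeMatrices

/-! ### Finiteness of the Hecke cosets and of `Θ(𝔭, a, b)` -/

section HeckeCosets

variable {F : Type*} [Field F] [NumberField F] {N : Ideal (𝓞 F)} {p : HeightOneSpectrum (𝓞 F)}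
  {B : Type*} [Ring B] [Algebra F B]
  {θ : AdB F B ≃ₐ[Ad F] Matrix (Fin 2) (Fin 2) (Ad F)}

variable (θ) in
/-- The isomorphism `B̂ˣ ≃ GL₂(F̂)` given by the splitting `θ`. -/
def unitsEquiv : (AdB F B)ˣ ≃* (Matrix (Fin 2) (Fin 2) (Ad F))ˣ :=
  Units.mapEquiv (θ : AdB F B ≃* Matrix (Fin 2) (Fin 2) (Ad F))

theorem mem_U0 {x : (AdB F B)ˣ} : x ∈ U0 θ N ↔ unitsEquiv θ x ∈ gammaZero N := Iff.rfl

theorem unitsEquiv_heckeElement : unitsEquiv θ (heckeElement θ p) = diagUniformizer p := by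
  refine Units.ext ?_
  exact θ.apply_symm_apply _

theorem unitsEquiv_diagB (u : Bˣ) :
    unitsEquiv θ (diagB (F := F) u) = rationalGL θ u := by
  refine Units.ext ?_
  exact (adelicMatrix_apply θ (u : B)).symm

theorem mk_eq_mk_iff {x y : (AdB F B)ˣ} :
    (x : (AdB F B)ˣ ⧸ U0 θ N) = y ↔ (unitsEquiv θ x)⁻¹ * unitsEquiv θ y ∈ gammaZero N := by
  rw [QuotientGroup.eq, mem_U0, map_mul, map_inv]

/-- The cosets `x U₀(N)` in the Hecke operator are those with `x⁻¹` in the double coset of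
`diag(1, ϖ)`. -/
theorem mem_heckeCosets_iff (hN : N ≠ ⊥) {x : (AdB F B)ˣ} :
    (x : (AdB F B)ˣ ⧸ U0 θ N) ∈ heckeCosets θ N p ↔ IsHeckeMatrix N p (unitsEquiv θ x)⁻¹ := by
  rw [isHeckeMatrix_iff hN]
  constructor
  · rintro ⟨u, hu, h⟩
    rw [mk_eq_mk_iff, map_mul, map_inv, unitsEquiv_heckeElement] at h
    refine ⟨_, h, (unitsEquiv θ u)⁻¹, inv_mem (mem_U0.1 hu), ?_⟩
    rw [mul_assoc, mul_assoc, mul_assoc, inv_mul_cancel_left, mul_inv_cancel, mul_one]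
  · rintro ⟨u, hu, w, hw, h⟩
    refine ⟨(unitsEquiv θ).symm w⁻¹, ?_, ?_⟩
    · rw [mem_U0, MulEquiv.apply_symm_apply]
      exact inv_mem hw
    · rw [mk_eq_mk_iff, h, map_mul, map_inv _ (heckeElement θ p), unitsEquiv_heckeElement,
        MulEquiv.apply_symm_apply, mul_assoc, mul_inv_cancel_left, mul_assoc,
        mul_inv_cancel, mul_one]
      exact hu

theorem finite_range_of_factors {X Y Z : Type*} [Finite Z] [Nonempty Y] {f : X → Y} {κ : X → Z}
    (h : ∀ x y, κ x = κ y → f x = f y) : (Set.range f).Finite := by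
  obtain ⟨y₀⟩ := ‹Nonempty Y›
  refine (Set.finite_range (Function.extend κ f fun _ => y₀)).subset ?_
  rintro _ ⟨x, rfl⟩
  exact ⟨κ x, Function.FactorsThrough.extend_apply (fun a b hab => h a b hab) _ x⟩

/-- The Hecke cosets are finite in number: the coset of `u diag(1, ϖ)⁻¹` depends only on the second
column of `u` modulo `𝔭`. -/
theorem heckeCosets_finite (hN : N ≠ ⊥) : (heckeCosets θ N p).Finite := by
  have hp : p.asIdeal ≠ ⊥ := p.ne_bot
  have : Finite (𝓞 F ⧸ p.asIdeal) := Ideal.finiteQuotientOfFreeOfNeBot _ hp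
  let f : U0 θ N → (AdB F B)ˣ ⧸ U0 θ N := fun u => ((u.1 * (heckeElement θ p)⁻¹ : (AdB F B)ˣ) : _)
  let κ : U0 θ N → (𝓞 F ⧸ p.asIdeal) × (𝓞 F ⧸ p.asIdeal) := fun u =>
    (reduceMatrix p.asIdeal (unitsEquiv θ u).1 0 1, reduceMatrix p.asIdeal (unitsEquiv θ u).1 1 1)
  have : heckeCosets θ N p = Set.range f := by
    ext c
    constructor
    · rintro ⟨u, hu, rfl⟩
      exact ⟨⟨u, hu⟩, rfl⟩
    · rintro ⟨⟨u, hu⟩, rfl⟩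
      exact ⟨u, hu, rfl⟩
  rw [this]
  refine finite_range_of_factors (κ := κ) ?_
  rintro ⟨x, hx⟩ ⟨y, hy⟩ hxy
  change ((x * (heckeElement θ p)⁻¹ : (AdB F B)ˣ) : (AdB F B)ˣ ⧸ U0 θ N) =
    ((y * (heckeElement θ p)⁻¹ : (AdB F B)ˣ) : (AdB F B)ˣ ⧸ U0 θ N)
  rw [mk_eq_mk_iff, map_mul, map_mul, map_inv, unitsEquiv_heckeElement]
  rw [mem_U0] at hx hy
  have e0 : reduceMatrix p.asIdeal (unitsEquiv θ x).1 0 1 =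
    reduceMatrix p.asIdeal (unitsEquiv θ y).1 0 1 := congrArg Prod.fst hxy
  have e1 : reduceMatrix p.asIdeal (unitsEquiv θ x).1 1 1 =
    reduceMatrix p.asIdeal (unitsEquiv θ y).1 1 1 := congrArg Prod.snd hxy
  generalize unitsEquiv θ x = g at *
  generalize unitsEquiv θ y = h at *
  have hk : g⁻¹ * h ∈ gammaZero N := mul_mem (inv_mem hx) hy
  have hg := ((mem_gammaZero_iff hN).1 hx).1
  have hh := ((mem_gammaZero_iff hN).1 hy).1
  have hk' := ((mem_gammaZero_iff hN).1 hk).1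
  have h01 : reduceMatrix p.asIdeal (g⁻¹ * h).1 0 1 = 0 := by
    have h1 := congrFun (congrFun (reduceMatrix_inv_mul hp hg) 0) 1
    rw [Matrix.mul_apply, Fin.sum_univ_two, Matrix.one_apply_ne (by decide), e0, e1] at h1
    rw [Units.val_mul, reduceMatrix_mul hp hg.2 hh.1, Matrix.mul_apply, Fin.sum_univ_two, h1]
  have h01' := (reduceAdele_eq_zero_iff hp (hk'.1 0 1)).1 h01 p
  have h01'' := valued_le_exp_neg_one (h01'.valued_lt_one dvd_rfl)
  have e : (g * (diagUniformizer p)⁻¹)⁻¹ * (h * (diagUniformizer p)⁻¹) =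
      diagUniformizer p * (g⁻¹ * h) * (diagUniformizer p)⁻¹ := by group
  rw [e]
  generalize g⁻¹ * h = k at *
  have hval : (diagUniformizer p * k * (diagUniformizer p)⁻¹).1 =
      !![k.1 0 0, ((uniformizerIdele p)⁻¹ : (Ad F)ˣ).1 * k.1 0 1;
        (uniformizerIdele p : Ad F) * k.1 1 0, k.1 1 1] := by
    rw [Units.val_mul, Units.val_mul, diagUniformizer_val, diagUniformizer_inv_val]
    refine Matrix.ext fun i j => ?_
    rw [Matrix.mul_apply, Fin.sum_univ_two, Matrix.mul_apply, Fin.sum_univ_two, Matrix.mul_apply,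
      Fin.sum_univ_two]
    fin_cases i <;> fin_cases j <;> simp [mul_comm]
  have hint : IsIntegralMatrix (diagUniformizer p * k * (diagUniformizer p)⁻¹).1 := by
    rw [hval]
    refine isIntegralMatrix_of (hk'.1 0 0) (fun v => ?_)
      ((isIntegralAdele_uniformizerIdele p).mul (hk'.1 1 0)) (hk'.1 1 1)
    rw [HeightOneSpectrum.mem_adicCompletionIntegers, adele_mul_apply, map_mul, valued_units_inv]
    by_cases hv : v = p
    · subst hv
      rw [valued_uniformizerIdele_same]
      refine (mul_le_mul_right h01'' _).trans_eq ?_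
      exact inv_mul_cancel₀ (WithZero.exp_ne_zero (a := (-1 : ℤ)))
    · rw [uniformizerIdele_of_ne hv, map_one, inv_one, one_mul]
      exact hk'.1 0 1 v
  have hmem : diagUniformizer p * k * (diagUniformizer p)⁻¹ ∈ integralGL F := by
    refine mem_integralGL_of_det hint fun v => ?_
    have h1 : (diagUniformizer p * k * (diagUniformizer p)⁻¹).1.det = k.1.det := by
      rw [Units.val_mul, Units.val_mul, Matrix.det_mul, Matrix.det_mul, mul_right_comm,
        ← Matrix.det_mul, Units.mul_inv, Matrix.det_one, one_mul]
    rw [h1]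
    exact valued_det_of_mem_integralGL hk' v
  refine ⟨hmem.1, hmem.2, fun v => ?_⟩
  rw [hval]
  exact MemLocalIdeal.mul (isIntegralAdele_uniformizerIdele p v) (hk.2.2 v)

/-- For `N = 1` the condition modulo `N` is empty, as `𝓞_F / N` is the zero ring. -/
theorem isHeckeMatrix_top_iff {m : (Matrix (Fin 2) (Fin 2) (Ad F))ˣ} :
    IsHeckeMatrix ⊤ p m ↔ IsIntegralMatrix m.1 ∧
      ∀ v, Valued.v (m.1.det v) = Valued.v ((uniformizerIdele p : Ad F) v) := by
  have : Subsingleton (𝓞 F ⧸ (⊤ : Ideal (𝓞 F))) := Ideal.Quotient.subsingleton_iff.2 rfl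
  exact ⟨fun h => ⟨h.1, h.2⟩, fun h => ⟨h.1, h.2, Subsingleton.elim _ _, isUnit_of_subsingleton _⟩⟩

/-- `Θ(𝔭, a, b)` is finite, as it embeds in the set of cosets of `GL₂(Ô)` in its double coset
of `diag(1, ϖ)⁻¹`. -/
theorem finite_theta [Module.Finite F B] (θ : AdB F B ≃ₐ[Ad F] Matrix (Fin 2) (Fin 2) (Ad F))
    (α β : (Matrix (Fin 2) (Fin 2) (Ad F))ˣ) :
    Finite (Theta p (latticeOf θ α) (latticeOf θ β)) := by
  have htop : (⊤ : Ideal (𝓞 F)) ≠ ⊥ := top_ne_bot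
  have hfin : Finite (heckeCosets θ ⊤ p) := heckeCosets_finite htop
  let f : thetaSet p (latticeOf θ α) (latticeOf θ β) → heckeCosets θ ⊤ p := fun u =>
    ⟨((unitsEquiv θ).symm (α⁻¹ * rationalGL θ u * β)⁻¹ : (AdB F B)ˣ), by
      rw [mem_heckeCosets_iff htop, MulEquiv.apply_symm_apply, inv_inv, isHeckeMatrix_top_iff]
      exact mem_thetaSet_latticeOf.1 u.2⟩
  have hf : ∀ u w, f u = f w → (thetaSetoid p _ _).r u w := by
    intro u w h
    have h1 := congrArg Subtype.val h
    dsimp only [f] at h1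
    rw [mk_eq_mk_iff, MulEquiv.apply_symm_apply, MulEquiv.apply_symm_apply, inv_inv,
      mem_gammaZero_iff htop] at h1
    refine ⟨w * (u.1)⁻¹, ?_, (inv_mul_cancel_right _ _).symm⟩
    rw [mem_leftOrderUnits_latticeOf]
    have h2 := inv_mem h1.1
    convert h2 using 1
    rw [map_mul, map_inv]
    group
  refine Finite.of_injective (fun c : Theta p (latticeOf θ α) (latticeOf θ β) => f c.out) ?_
  intro c d hcd
  rw [← Quotient.out_eq c, ← Quotient.out_eq d]
  exact Quotient.sound (s := thetaSetoid p _ _) (hf _ _ hcd)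

end HeckeCosets

/-! ### Division with remainder in an order -/

section Dirichlet

variable {A : Type*} [Ring A] [Algebra ℚ A] {ι : Type*} [Fintype ι] [DecidableEq ι]

/-- Simultaneous approximation: some multiple `r t` of `t` by a positive integer `r`, bounded
independently of `t`, differs from an integral vector by one with small coordinates. -/
theorem exists_nat_mul_sub_int_lt (ι : Type*) [Fintype ι] {m : ℕ} (hm : 0 < m) :
    ∃ Q : ℕ, ∀ t : ι → ℚ, ∃ r : ℕ, 0 < r ∧ r ≤ Q ∧ ∃ q : ι → ℤ,
      ∀ i, |(r : ℚ) * t i - q i| * m < 1 := by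
  classical
  have hm' : (0 : ℚ) < m := by exact_mod_cast hm
  refine ⟨m ^ Fintype.card ι, fun t => ?_⟩
  have hlt : ∀ x : ℚ, ⌊Int.fract x * m⌋.toNat < m := fun x => by
    have h1 : 0 ≤ ⌊Int.fract x * m⌋ := Int.floor_nonneg.2 (by positivity)
    have h2 : ⌊Int.fract x * m⌋ < m := by
      rw [Int.floor_lt]
      push_cast
      exact mul_lt_of_lt_one_left hm' (Int.fract_lt_one x)
    omega
  let f : Fin (m ^ Fintype.card ι + 1) → ι → Fin m := fun r i =>
    ⟨⌊Int.fract ((r : ℕ) * t i) * m⌋.toNat, hlt _⟩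
  obtain ⟨r, s, hrs, hf⟩ := Fintype.exists_ne_map_eq_of_card_lt f (by simp)
  wlog hlt' : r < s generalizing r s
  · exact this s r hrs.symm hf.symm (lt_of_le_of_ne (not_lt.1 hlt') hrs.symm)
  have hlt'' : (r : ℕ) < s := hlt'
  refine ⟨s - r, by omega, by omega, fun i => ⌊(s : ℕ) * t i⌋ - ⌊(r : ℕ) * t i⌋, fun i => ?_⟩
  have h1 : ⌊Int.fract ((s : ℕ) * t i) * m⌋ = ⌊Int.fract ((r : ℕ) * t i) * m⌋ := by
    have h2 := congrArg Fin.val (congrFun hf i)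
    dsimp only [f] at h2
    have h3 : 0 ≤ ⌊Int.fract ((s : ℕ) * t i) * m⌋ := Int.floor_nonneg.2 (by positivity)
    have h4 : 0 ≤ ⌊Int.fract ((r : ℕ) * t i) * m⌋ := Int.floor_nonneg.2 (by positivity)
    omega
  have h2 := Int.abs_sub_lt_one_of_floor_eq_floor h1
  rw [← sub_mul, abs_mul, abs_of_pos hm'] at h2
  have h3 : ((s - r : ℕ) : ℚ) * t i - ((⌊(s : ℕ) * t i⌋ - ⌊(r : ℕ) * t i⌋ : ℤ) : ℚ) =
      Int.fract ((s : ℕ) * t i) - Int.fract ((r : ℕ) * t i) := by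
    rw [Nat.cast_sub hlt''.le, ← Int.self_sub_floor, ← Int.self_sub_floor]
    push_cast
    ring
  rw [h3]
  exact h2

/-- The norm is a polynomial in the coordinates that vanishes at zero, hence small near zero. -/
theorem exists_norm_lt_one [Nontrivial A] (e : Module.Basis ι ℚ A) :
    ∃ m : ℕ, 0 < m ∧ ∀ x : A, (∀ i, |e.repr x i| * m < 1) → |Algebra.norm ℚ x| < 1 := by
  have : Module.Finite ℚ A := Module.Finite.of_basis e
  let g : (ι → ℚ) → ℚ := fun c => (∑ i, c i • Algebra.leftMulMatrix e (e i)).det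
  have hg : ∀ x, g (e.repr x) = Algebra.norm ℚ x := fun x => by
    rw [Algebra.norm_eq_matrix_det e]
    dsimp only [g]
    conv_rhs => rw [← e.sum_repr x]
    rw [map_sum]
    simp only [map_smul]
  have hcont : Continuous g := by
    refine Continuous.matrix_det ?_
    refine continuous_finsetSum _ fun i _ => ?_
    exact (continuous_apply i).smul continuous_const
  have h0 : g 0 = 0 := by
    have := hg 0
    rw [map_zero, Finsupp.coe_zero, Algebra.norm_zero] at this
    exact this
  obtain ⟨δ, hδ, h⟩ := Metric.continuousAt_iff.1 hcont.continuousAt (1 : ℝ) one_pos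
  obtain ⟨m, hm⟩ := exists_nat_gt δ⁻¹
  have hm0 : 0 < m := by
    have : (0 : ℝ) < m := (inv_pos.2 hδ).trans hm
    exact_mod_cast this
  refine ⟨m, hm0, fun x hx => ?_⟩
  have h1 : dist (g (e.repr x)) (g 0) < 1 := by
    refine h ((dist_pi_lt_iff hδ).2 fun i => ?_)
    rw [Pi.zero_apply, Rat.dist_eq, Rat.cast_zero, sub_zero]
    have h2 : |((e.repr x i : ℚ) : ℝ)| * m < 1 := by exact_mod_cast hx i
    have h3 : |((e.repr x i : ℚ) : ℝ)| < 1 / m := (lt_div_iff₀ (by exact_mod_cast hm0)).2 h2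
    refine h3.trans ?_
    rw [one_div]
    exact inv_lt_of_inv_lt₀ hδ hm
  rw [h0, hg, Rat.dist_eq, Rat.cast_zero, sub_zero] at h1
  exact_mod_cast h1

/-- The norm of an element of the order with integral basis `e` is an integer. -/
theorem exists_norm_eq_intCast (e : Module.Basis ι ℚ A) {R : Subring A}
    (hR : ∀ x, x ∈ R ↔ ∀ i, ∃ z : ℤ, e.repr x i = z) {x : A} (hx : x ∈ R) :
    ∃ z : ℤ, Algebra.norm ℚ x = z := by
  have he : ∀ j, e j ∈ R := fun j => (hR _).2 fun i => by
    rw [e.repr_self, Finsupp.single_apply]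
    split_ifs
    · exact ⟨1, by simp⟩
    · exact ⟨0, by simp⟩
  choose Z hZ using fun j => (hR _).1 (R.mul_mem hx (he j))
  refine ⟨(Matrix.of fun i j => Z j i).det, ?_⟩
  rw [Algebra.norm_eq_matrix_det e, Int.cast_det]
  congr 1
  ext i j
  rw [Algebra.leftMulMatrix_eq_repr_mul]
  exact hZ j i

/-- The key step in the finiteness of the class number: an integral right ideal `a` contains
an element `b` with `D a ⊆ b R`, where `D` depends on `R` only. The element `b` is one of minimal
norm, so that division with remainder by `b` works after multiplication by a bounded integer. -/
theorem exists_nsmul_mem_principal [Nontrivial A] (hA : ∀ x : A, x ≠ 0 → IsUnit x)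
    (e : Module.Basis ι ℚ A) {R : Subring A}
    (hR : ∀ x, x ∈ R ↔ ∀ i, ∃ z : ℤ, e.repr x i = z) :
    ∃ D : ℕ, D ≠ 0 ∧ ∀ a : AddSubgroup A, (∀ x ∈ a, x ∈ R) → (∀ x ∈ a, ∀ r ∈ R, x * r ∈ a) →
      (∃ x ∈ a, x ≠ 0) → ∃ b : Aˣ, (b : A) ∈ a ∧ ∀ x ∈ a, ∃ r ∈ R, D • x = b * r := by
  obtain ⟨m, hm, hnorm⟩ := exists_norm_lt_one e
  obtain ⟨Q, hQ⟩ := exists_nat_mul_sub_int_lt ι hm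
  refine ⟨Q.factorial, Nat.factorial_ne_zero _, fun a haR ha hne => ?_⟩
  have hex : ∃ n : ℕ, ∃ x ∈ a, x ≠ 0 ∧ |Algebra.norm ℚ x| = n := by
    obtain ⟨x, hx, hx0⟩ := hne
    obtain ⟨z, hz⟩ := exists_norm_eq_intCast e hR (haR x hx)
    exact ⟨z.natAbs, x, hx, hx0, by rw [hz, Nat.cast_natAbs, Int.cast_abs]⟩
  classical
  obtain ⟨b, hb, hb0, hbn⟩ := Nat.find_spec hex
  have hmin : ∀ x ∈ a, |Algebra.norm ℚ x| < |Algebra.norm ℚ b| → x = 0 := by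
    intro x hx hlt
    by_contra hx0
    obtain ⟨z, hz⟩ := exists_norm_eq_intCast e hR (haR x hx)
    have h1 : |Algebra.norm ℚ x| = z.natAbs := by rw [hz, Nat.cast_natAbs, Int.cast_abs]
    refine Nat.find_min hex ?_ ⟨x, hx, hx0, h1⟩
    rw [h1, hbn] at hlt
    exact_mod_cast hlt
  have hbu := hA b hb0
  have hbpos : 0 < |Algebra.norm ℚ b| := abs_pos.2 (hbu.map (Algebra.norm ℚ)).ne_zero
  refine ⟨hbu.unit, hb, fun x hx => ?_⟩
  obtain ⟨r, hr, hrQ, q, hq⟩ := hQ (e.repr (hbu.unit⁻¹.1 * x))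
  let y : A := e.equivFun.symm fun i => (q i : ℚ)
  have hy : ∀ i, e.repr y i = q i := fun i => congrFun (e.equivFun.apply_symm_apply _) i
  have hyR : y ∈ R := (hR y).2 fun i => ⟨q i, hy i⟩
  have hs : |Algebra.norm ℚ (r • (hbu.unit⁻¹.1 * x) - y)| < 1 := hnorm _ fun i => by
    rw [map_sub, map_nsmul, Finsupp.sub_apply, Finsupp.smul_apply, hy, nsmul_eq_mul]
    exact hq i
  have hbs : b * (r • (hbu.unit⁻¹.1 * x) - y) = r • x - b * y := by
    rw [mul_sub, mul_smul_comm]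
    congr 2
    exact hbu.unit.mul_inv_cancel_left x
  have h0 : r • x - b * y = 0 := by
    refine hmin _ (a.sub_mem (a.nsmul_mem hx r) (ha b hb y hyR)) ?_
    rw [← hbs, map_mul, abs_mul]
    exact mul_lt_of_lt_one_right hbpos hs
  obtain ⟨c, hc⟩ := Nat.dvd_factorial hr hrQ
  refine ⟨c • y, R.nsmul_mem hyR c, ?_⟩
  rw [hc, mul_comm, mul_smul, sub_eq_zero.1 h0, mul_smul_comm]
  rfl

end Dirichlet

/-! ### Finiteness of the class number -/

section ClassNumber

variable {F : Type*} [Field F] [NumberField F] {B : Type*} [Ring B] [Algebra F B]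

omit [NumberField F] in
/-- Nonzero elements of a totally definite algebra are invertible, since Hamilton's quaternions
are a division ring. -/
theorem isUnit_of_isTotallyDefinite [Module.Finite F B] (hdef : IsTotallyDefinite F B)
    (τ : F →+* ℝ) {x : B} (hx : x ≠ 0) : IsUnit x := by
  let : Algebra F ℝ := τ.toAlgebra
  obtain ⟨e⟩ := hdef τ
  let f : B →+* ℍ[ℝ] := (e : ℝ ⊗[F] B →+* ℍ[ℝ]).comp
    (Algebra.TensorProduct.includeRight (R := F) (A := ℝ) (B := B)).toRingHom
  have hf : Function.Injective f := e.injective.comp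
    (Algebra.TensorProduct.includeRight_injective (algebraMap F ℝ).injective)
  have : IsDomain B := hf.isDomain f
  exact FiniteDimensional.isUnit F hx

/-- An order of `B` is the `ℤ`-span of a basis of `B` over `ℚ`; the algebra structure over `ℚ` is
an argument, as the restriction of scalars from `F` is not an instance. -/
theorem exists_integral_basis [Algebra ℚ B] [IsScalarTower ℚ F B] {R : Subalgebra (𝓞 F) B}
    (hR : IsOrder R) :
    ∃ (n : ℕ) (e : Module.Basis (Fin n) ℚ B),
      ∀ x, x ∈ R.toSubring ↔ ∀ i, ∃ z : ℤ, e.repr x i = z := by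
  have hfin : Module.Finite (𝓞 F) R := Module.Finite.iff_fg.2 hR.fg
  have hfinZ : Module.Finite ℤ R := Module.Finite.trans (𝓞 F) R
  have htf : Module.IsTorsionFree ℤ B := Module.IsTorsionFree.trans_faithfulSMul ℤ ℚ B
  have hfree : Module.Free ℤ R := by
    have : Module.IsTorsionFree ℤ R := Subtype.val_injective.moduleIsTorsionFree _ fun _ _ => rfl
    infer_instance
  let b := Module.finBasis ℤ R
  have hli : LinearIndependent ℚ fun i => (b i : B) := by
    rw [← LinearIndependent.iff_fractionRing ℤ ℚ]
    exact b.linearIndependent.map' (R.toSubring.subtype.toAddMonoidHom.toIntLinearMap)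
      (LinearMap.ker_eq_bot.2 Subtype.val_injective)
  have hmem : ∀ x : R, (x : B) = ∑ i, (b.repr x i : ℚ) • (b i : B) := fun x => by
    conv_lhs => rw [← b.sum_repr x]
    rw [AddSubmonoidClass.coe_finsetSum]
    refine Finset.sum_congr rfl fun i _ => ?_
    rw [Int.cast_smul_eq_zsmul]
    rfl
  have hsp : ⊤ ≤ Submodule.span ℚ (Set.range fun i => (b i : B)) := by
    intro x _
    have hx : x ∈ Submodule.span F (R : Set B) := hR.span_eq_top ▸ Submodule.mem_top
    obtain ⟨d, hd, hdx⟩ := exists_smul_mem_of_span_eq_top (Λ := Subalgebra.toSubmodule R)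
      hR.span_eq_top x
    have hN0 : Ideal.absNorm (Ideal.span {d}) ≠ 0 := by
      rw [Ne, Ideal.absNorm_eq_zero_iff, Ideal.span_singleton_eq_bot]
      exact hd
    obtain ⟨k, hk⟩ := Ideal.mem_span_singleton'.1 (Ideal.absNorm_mem (Ideal.span {d}))
    have hNx : (Ideal.absNorm (Ideal.span {d}) : ℚ) • x ∈ R := by
      rw [Nat.cast_smul_eq_nsmul, ← Nat.cast_smul_eq_nsmul (𝓞 F), ← hk, mul_smul]
      exact R.smul_mem hdx k
    rw [← Submodule.smul_mem_iff _ (Nat.cast_ne_zero.2 hN0 : (_ : ℚ) ≠ 0)]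
    have h2 : (Ideal.absNorm (Ideal.span {d}) : ℚ) • x = _ := hmem ⟨_, hNx⟩
    rw [h2]
    exact Submodule.sum_mem _ fun i _ => Submodule.smul_mem _ _ (Submodule.subset_span ⟨i, rfl⟩)
  refine ⟨_, Module.Basis.mk hli hsp, fun x => ⟨fun hx i => ⟨b.repr ⟨x, hx⟩ i, ?_⟩, fun h => ?_⟩⟩
  · have h1 : x = ∑ i, (b.repr ⟨x, hx⟩ i : ℚ) • Module.Basis.mk hli hsp i := by
      simp only [Module.Basis.mk_apply]
      exact hmem ⟨x, hx⟩
    conv_lhs => rw [h1]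
    exact congrFun (Module.Basis.repr_sum_self (Module.Basis.mk hli hsp) _) i
  · choose z hz using h
    rw [← (Module.Basis.mk hli hsp).sum_repr x]
    refine R.toSubring.sum_mem fun i _ => ?_
    rw [hz, Int.cast_smul_eq_zsmul, Module.Basis.mk_apply]
    exact R.toSubring.zsmul_mem (b i).2 _

/-- The finiteness of the class number: after division by an element `b` of minimal norm, a right
ideal lies between `R` and `D⁻¹ R` for a fixed integer `D`. -/
theorem finite_classReps [Module.Finite F B] [Nontrivial B] (hB : ∀ x : B, x ≠ 0 → IsUnit x)
    {R : Subalgebra (𝓞 F) B} (hR : IsOrder R) {Cl : Set (Submodule (𝓞 F) B)}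
    (hCl : IsRightClassReps R Cl) (hint : ∀ a ∈ Cl, a ≤ Subalgebra.toSubmodule R) :
    Finite Cl := by
  let : Algebra ℚ B := ((algebraMap F B).comp (algebraMap ℚ F)).toAlgebra' fun c x =>
    Algebra.commutes (algebraMap ℚ F c) x
  have : IsScalarTower ℚ F B := IsScalarTower.of_algebraMap_eq fun _ => rfl
  obtain ⟨n, e, he⟩ := exists_integral_basis hR
  obtain ⟨D, hD, h⟩ := exists_nsmul_mem_principal hB e he
  have hD' : (D : ℚ) ≠ 0 := Nat.cast_ne_zero.2 hD
  have hcancel : ∀ {x y : B}, D • x = D • y → x = y := fun {x y} hxy => by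
    rw [← Nat.cast_smul_eq_nsmul ℚ, ← Nat.cast_smul_eq_nsmul ℚ] at hxy
    exact smul_right_injective B hD' hxy
  have hb : ∀ a : Cl, ∃ b : Bˣ, (b : B) ∈ a.1 ∧ ∀ x ∈ a.1, ∃ r ∈ R, D • x = b * r := by
    intro a
    have ha := hCl.isRightFractionalIdeal a.1 a.2
    refine h a.1.toAddSubgroup (fun x hx => hint a.1 a.2 hx)
      (fun x hx r hr => ha.mul_mem x hx r hr) ?_
    by_contra! hne
    have h1 : (⊤ : Submodule F B) ≤ ⊥ := by
      rw [← ha.span_eq_top, Submodule.span_le]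
      exact fun x hx => hne x hx
    exact one_ne_zero (h1 (Submodule.mem_top (x := (1 : B))))
  choose b hba hbR using hb
  have : NeZero D := ⟨hD⟩
  -- `κ a` is the image of `D b⁻¹ a ⊆ R` in `R / D R`, which determines `D b⁻¹ a ⊇ D R`
  let κ : Cl → Set (Fin n → ZMod D) := fun a =>
    {z | ∃ x ∈ a.1, ∃ r ∈ R, D • x = b a * r ∧ ∃ c : Fin n → ℤ, (∀ i, e.repr r i = c i) ∧
      ∀ i, z i = c i}
  have key : ∀ a a' : Cl, κ a = κ a' → ∀ x ∈ a.1, (b a' * (b a)⁻¹ : Bˣ) * x ∈ a'.1 := by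
    intro a a' haa' x hx
    obtain ⟨r, hr, hxr⟩ := hbR a x hx
    choose c hc using (he r).1 hr
    have hz : (fun i => (c i : ZMod D)) ∈ κ a' :=
      haa' ▸ ⟨x, hx, r, hr, hxr, c, hc, fun i => rfl⟩
    obtain ⟨x', hx', r', hr', hxr', c', hc', hcc'⟩ := hz
    choose d hd using fun i => (ZMod.intCast_eq_intCast_iff_dvd_sub _ _ _).1 (hcc' i).symm
    let y : B := e.equivFun.symm fun i => (d i : ℚ)
    have hy : ∀ i, e.repr y i = d i := fun i => congrFun (e.equivFun.apply_symm_apply _) i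
    have hyR : y ∈ R := (he y).2 fun i => ⟨d i, hy i⟩
    have hry : r = r' + D • y := by
      refine e.ext_elem fun i => ?_
      rw [map_add, map_nsmul, Finsupp.add_apply, Finsupp.smul_apply, hy, hc, hc', nsmul_eq_mul]
      have := hd i
      rw [sub_eq_iff_eq_add] at this
      rw [this]
      push_cast
      ring
    have h1 : (b a' * (b a)⁻¹ : Bˣ) * x = x' + b a' * y := by
      refine hcancel ?_
      rw [← mul_smul_comm, hxr, Units.val_mul, mul_assoc, Units.inv_mul_cancel_left, hry, mul_add,
        ← hxr', smul_add, mul_smul_comm]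
    rw [h1]
    exact a'.1.add_mem hx'
      ((hCl.isRightFractionalIdeal a'.1 a'.2).mul_mem _ (hba a') y hyR)
  refine Finite.of_injective κ fun a a' haa' => Subtype.ext ?_
  refine (hCl.existsUnique a.1 (hCl.isRightFractionalIdeal a.1 a.2)).unique
    ⟨a.2, 1, ?_⟩ ⟨a'.2, b a * (b a')⁻¹, ?_⟩
  · ext x
    simp [leftTranslate]
  · ext x
    constructor
    · intro hx
      refine ⟨_, key a a' haa' x hx, ?_⟩
      rw [LinearMap.mulLeft_apply, ← mul_assoc, ← Units.val_mul]
      simp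
    · rintro ⟨y, hy, rfl⟩
      exact key a' a haa'.symm y hy

end ClassNumber

/-! ### The weight representation -/

section Weight

theorem symAct_coe (a b : ℕ) (M : Matrix (Fin 2) (Fin 2) ℂ) (P : SymSpace a) :
    (symAct a b M P : MvPolynomial (Fin 2) ℂ) = M.det ^ b • MvPolynomial.aeval (fun i : Fin 2 =>
      ∑ j : Fin 2, MvPolynomial.C (M i j) * MvPolynomial.X j :
        Fin 2 → MvPolynomial (Fin 2) ℂ) (P : MvPolynomial (Fin 2) ℂ) := rfl

theorem symAct_mul (a b : ℕ) (M M' : Matrix (Fin 2) (Fin 2) ℂ) :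
    symAct a b (M * M') = symAct a b M' ∘ₗ symAct a b M := by
  refine LinearMap.ext fun P => Subtype.ext ?_
  rw [LinearMap.comp_apply, symAct_coe, symAct_coe, symAct_coe, map_smul, smul_smul,
    Matrix.det_mul, mul_pow, mul_comm (M.det ^ b), ← AlgHom.comp_apply, MvPolynomial.comp_aeval]
  congr 3
  funext i
  simp only [map_mul, MvPolynomial.aeval_C, MvPolynomial.aeval_X, Matrix.mul_apply,
    Fin.sum_univ_two, MvPolynomial.algebraMap_eq, map_add]
  ring

theorem symAct_one (a b : ℕ) : symAct a b 1 = LinearMap.id := by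
  refine LinearMap.ext fun P => Subtype.ext ?_
  have : (fun i : Fin 2 => ∑ j : Fin 2, MvPolynomial.C ((1 : Matrix (Fin 2) (Fin 2) ℂ) i j) *
      MvPolynomial.X j : Fin 2 → MvPolynomial (Fin 2) ℂ) = MvPolynomial.X := by
    funext i
    simp only [Matrix.one_apply, Fin.sum_univ_two]
    fin_cases i <;> simp
  rw [symAct_coe, this, MvPolynomial.aeval_X_left, AlgHom.id_apply, Matrix.det_one, one_pow,
    one_smul, LinearMap.id_apply]

variable {F : Type*} [Field F] {B : Type*} [Ring B] (k v : (F →+* ℝ) → ℕ)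
  (j : (F →+* ℝ) → B →+* Matrix (Fin 2) (Fin 2) ℂ)

/-- The weight representation is a right action. -/
theorem weightAct_mul (u w : B) :
    weightAct k v j (u * w) = weightAct k v j w ∘ₗ weightAct k v j u := by
  exact (congrArg PiTensorProduct.map (funext fun τ => by rw [map_mul, symAct_mul])).trans
    (PiTensorProduct.map_comp _ _)

theorem weightAct_one : weightAct k v j (1 : B) = LinearMap.id := by
  unfold weightAct
  simp only [map_one, symAct_one]
  exact PiTensorProduct.map_id

theorem weightAct_mul_apply (u w : B) (x : WeightSpace F k) :
    weightAct k v j (u * w) x = weightAct k v j w (weightAct k v j u x) := by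
  rw [weightAct_mul, LinearMap.comp_apply]

theorem weightAct_inv_apply (u : Bˣ) (x : WeightSpace F k) :
    weightAct k v j (u⁻¹ : Bˣ) (weightAct k v j u x) = x := by
  rw [← weightAct_mul_apply, Units.mul_inv, weightAct_one, LinearMap.id_apply]

end Weight

/-! ### The Hecke operator -/

section HeckeOperator

variable {F : Type*} [Field F] [NumberField F] {N : Ideal (𝓞 F)}
  {B : Type*} [Ring B] [Algebra F B]
  {θ : AdB F B ≃ₐ[Ad F] Matrix (Fin 2) (Fin 2) (Ad F)}
  {k v : (F →+* ℝ) → ℕ} {j : (F →+* ℝ) → B →+* Matrix (Fin 2) (Fin 2) ℂ}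

theorem bijOn_smul_heckeCosets (p : HeightOneSpectrum (𝓞 F)) {u : (AdB F B)ˣ}
    (hu : u ∈ U0 θ N) :
    Set.BijOn (fun c => u • c) (heckeCosets θ N p) (heckeCosets θ N p) := by
  have key : ∀ w ∈ U0 θ N, ∀ c ∈ heckeCosets θ N p, w • c ∈ heckeCosets θ N p := by
    rintro w hw c ⟨x, hx, rfl⟩
    refine ⟨w * x, mul_mem hw hx, ?_⟩
    rw [mul_assoc]
    rfl
  exact ⟨key u hu, (MulAction.injective u).injOn,
    fun c hc => ⟨u⁻¹ • c, key _ (inv_mem hu) c hc, smul_inv_smul u c⟩⟩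

/-- The sum over the Hecke cosets at `x` depends only on the coset of `x`, as `U₀(N)` permutes the
cosets. -/
theorem sum_heckeCosets_congr (p : HeightOneSpectrum (𝓞 F)) {L : Type*}
    [AddCommMonoid L] (f : (AdB F B)ˣ ⧸ U0 θ N → L) {x y : (AdB F B)ˣ}
    (h : (x : (AdB F B)ˣ ⧸ U0 θ N) = y) :
    ∑ᶠ c ∈ heckeCosets θ N p, f (x • c) = ∑ᶠ c ∈ heckeCosets θ N p, f (y • c) := by
  refine (finsum_mem_eq_of_bijOn _ (bijOn_smul_heckeCosets p (QuotientGroup.eq.1 h))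
    fun c _ => ?_).symm
  rw [smul_smul, mul_inv_cancel_left]

/-- The Hecke operator `T(𝔭)`. -/
def heckeOperator (hN : N ≠ ⊥) (p : HeightOneSpectrum (𝓞 F)) :
    AutForm θ N k v j →ₗ[ℂ] AutForm θ N k v j where
  toFun f := ⟨fun x => ∑ᶠ c ∈ heckeCosets θ N p, f.1 (x.out • c), fun γ x => by
    have h : (((diagB (F := F) γ * x.out : (AdB F B)ˣ) : (AdB F B)ˣ ⧸ U0 θ N)) =
        ((diagB (F := F) γ • x).out : (AdB F B)ˣ) := by
      rw [QuotientGroup.out_eq']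
      conv_rhs => rw [← QuotientGroup.out_eq' x]
      rfl
    dsimp only
    rw [← sum_heckeCosets_congr p f.1 h]
    refine ((weightAct k v j (γ : B)).toAddMonoidHom.map_finsum_mem _
      (heckeCosets_finite hN)).trans ?_
    refine finsum_mem_congr rfl fun c _ => ?_
    rw [← smul_smul]
    exact f.2 γ _⟩
  map_add' f g := Subtype.ext (funext fun x => finsum_mem_add_distrib (heckeCosets_finite hN))
  map_smul' r f := Subtype.ext (funext fun x =>
    ((DistribSMul.toAddMonoidHom (WeightSpace F k) r).map_finsum_mem
      (fun c => f.1 (x.out • c)) (heckeCosets_finite hN)).symm)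

theorem isHeckeOperator_heckeOperator (hN : N ≠ ⊥) (p : HeightOneSpectrum (𝓞 F)) :
    IsHeckeOperator θ N k v j p (heckeOperator hN p) :=
  ⟨heckeCosets_finite hN, fun f x => sum_heckeCosets_congr p f.1 (y := x)
    (QuotientGroup.out_eq' (x : (AdB F B)ˣ ⧸ U0 θ N))⟩

end HeckeOperator

/-! ### Slash operators and the maps `T_{a,b}(𝔭)` -/

section Slash

theorem isCoprime_of_mulVec {A : Type*} [CommRing A] {M : Matrix (Fin 2) (Fin 2) A}
    {w : Fin 2 → A} (h : IsCoprime (M.mulVec w 0) (M.mulVec w 1)) : IsCoprime (w 0) (w 1) := by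
  obtain ⟨a, b, hab⟩ := h
  refine ⟨a * M 0 0 + b * M 1 0, a * M 0 1 + b * M 1 1, ?_⟩
  simp only [Matrix.mulVec, dotProduct, Fin.sum_univ_two] at hab
  linear_combination hab

theorem P1.extend_of_isCoprime {A L : Type*} [CommRing A] [Zero L] (f : P1 A → L) {w : Fin 2 → A}
    (h : IsCoprime (w 0) (w 1)) : P1.extend f w = f (Quotient.mk (p1Setoid A) ⟨w, h⟩) :=
  dif_pos h

theorem P1.extend_of_not_isCoprime {A L : Type*} [CommRing A] [Zero L] (f : P1 A → L)
    {w : Fin 2 → A} (h : ¬ IsCoprime (w 0) (w 1)) : P1.extend f w = 0 :=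
  dif_neg h

variable {F : Type*} [Field F] [NumberField F] {N : Ideal (𝓞 F)}
  {B : Type*} [Ring B] [Algebra F B]
  {θ : AdB F B ≃ₐ[Ad F] Matrix (Fin 2) (Fin 2) (Ad F)}
  {k v : (F →+* ℝ) → ℕ} {j : (F →+* ℝ) → B →+* Matrix (Fin 2) (Fin 2) ℂ}

theorem slash_mk (u : B) (f : P1 (𝓞 F ⧸ N) → WeightSpace F k)
    (w : {w : Fin 2 → 𝓞 F ⧸ N // IsCoprime (w 0) (w 1)}) :
    slash θ N k v j u f (Quotient.mk (p1Setoid _) w) =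
      weightAct k v j u (P1.extend f ((reduceB θ N u).mulVec w.1)) := rfl

theorem extend_slash (u : B) (f : P1 (𝓞 F ⧸ N) → WeightSpace F k) (w : Fin 2 → 𝓞 F ⧸ N) :
    P1.extend (slash θ N k v j u f) w =
      weightAct k v j u (P1.extend f ((reduceB θ N u).mulVec w)) := by
  by_cases h : IsCoprime (w 0) (w 1)
  · rw [P1.extend_of_isCoprime _ h, slash_mk]
  · rw [P1.extend_of_not_isCoprime _ h,
      P1.extend_of_not_isCoprime _ fun h' => h (isCoprime_of_mulVec h'), map_zero]

/-- The slash operators form a right action as long as reduction modulo `N` is multiplicative; it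
need not be for elements that are not integral at `N`. -/
theorem slash_mul {u w : B} (h : reduceB θ N (u * w) = reduceB θ N u * reduceB θ N w)
    (f : P1 (𝓞 F ⧸ N) → WeightSpace F k) :
    slash θ N k v j (u * w) f = slash θ N k v j w (slash θ N k v j u f) := by
  funext x
  induction x using Quotient.inductionOn with
  | _ x =>
  rw [slash_mk, slash_mk, extend_slash, h, weightAct_mul_apply, Matrix.mulVec_mulVec]

theorem evalMatrix_inv_eq_one {α : (Matrix (Fin 2) (Fin 2) (Ad F))ˣ}
    {v : HeightOneSpectrum (𝓞 F)} (h : evalMatrix v α.1 = 1) : evalMatrix v α⁻¹.1 = 1 := by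
  have h1 : evalMatrix v α.1 * evalMatrix v α⁻¹.1 = 1 := by
    rw [← map_mul, Units.mul_inv, map_one]
  rwa [h, one_mul] at h1

variable {α β : (Matrix (Fin 2) (Fin 2) (Ad F))ˣ}

/-- If the generators `α` and `β` are trivial at the primes dividing `N`, then elements of `B`
act on the projective line modulo `N` through `α⁻¹ u β`, which is integral for `u` in `a b⁻¹`. -/
theorem reduceB_eq (hα : ∀ v : HeightOneSpectrum (𝓞 F), v.asIdeal ∣ N → evalMatrix v α.1 = 1)
    (hβ : ∀ v : HeightOneSpectrum (𝓞 F), v.asIdeal ∣ N → evalMatrix v β.1 = 1) (u : Bˣ) :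
    reduceB θ N (u : B) = reduceMatrix N (α⁻¹ * rationalGL θ u * β).1 := by
  have : reduceB θ N (u : B) = reduceMatrix N (adelicMatrix θ (u : B)) := rfl
  rw [this]
  refine reduceMatrix_congr fun v hv => ?_
  rw [Units.val_mul, Units.val_mul, map_mul, map_mul, hβ v hv, evalMatrix_inv_eq_one (hα v hv),
    one_mul, mul_one, rationalGL_val]

variable [Module.Finite F B]

/-- The slash operator on `M_k(R_a, N)` depends only on the class of `u` modulo `R_aˣ`. -/
theorem slash_unit_mul (hN : N ≠ ⊥)
    (hα : ∀ v : HeightOneSpectrum (𝓞 F), v.asIdeal ∣ N → evalMatrix v α.1 = 1)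
    (hβ : ∀ v : HeightOneSpectrum (𝓞 F), v.asIdeal ∣ N → evalMatrix v β.1 = 1)
    {γ u : Bˣ} (hγ : γ ∈ leftOrderUnits (latticeOf θ α))
    (hu : IsIntegralMatrix (α⁻¹ * rationalGL θ u * β).1)
    {f : P1 (𝓞 F ⧸ N) → WeightSpace F k} (hf : f ∈ OrderForm θ N k v j (latticeOf θ α)) :
    slash θ N k v j ((γ * u : Bˣ) : B) f = slash θ N k v j (u : B) f := by
  have h1 : reduceB θ N ((γ : B) * u) = reduceB θ N γ * reduceB θ N u := by
    rw [← Units.val_mul, reduceB_eq hα hβ, reduceB_eq hα hα, reduceB_eq hα hβ, ← reduceMatrix_mul hN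
      (mem_leftOrderUnits_latticeOf.1 hγ).1 hu, ← Units.val_mul, map_mul]
    refine congrArg (fun m => reduceMatrix N (Units.val m)) ?_
    group
  rw [Units.val_mul, slash_mul h1, hf γ hγ]

theorem slash_mul_unit (hN : N ≠ ⊥)
    (hα : ∀ v : HeightOneSpectrum (𝓞 F), v.asIdeal ∣ N → evalMatrix v α.1 = 1)
    (hβ : ∀ v : HeightOneSpectrum (𝓞 F), v.asIdeal ∣ N → evalMatrix v β.1 = 1)
    {γ u : Bˣ} (hγ : γ ∈ leftOrderUnits (latticeOf θ β))
    (hu : IsIntegralMatrix (α⁻¹ * rationalGL θ u * β).1)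
    (f : P1 (𝓞 F ⧸ N) → WeightSpace F k) :
    slash θ N k v j ((u * γ : Bˣ) : B) f = slash θ N k v j (γ : B) (slash θ N k v j (u : B) f) := by
  have h1 : reduceB θ N ((u : B) * γ) = reduceB θ N u * reduceB θ N γ := by
    rw [← Units.val_mul, reduceB_eq hα hβ, reduceB_eq hα hβ, reduceB_eq hβ hβ, ← reduceMatrix_mul hN
      hu (mem_leftOrderUnits_latticeOf.1 hγ).1, ← Units.val_mul, map_mul]
    refine congrArg (fun m => reduceMatrix N (Units.val m)) ?_
    group
  rw [Units.val_mul, slash_mul h1]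

theorem mul_mem_thetaSet {p : HeightOneSpectrum (𝓞 F)} {γ u : Bˣ}
    (hu : u ∈ thetaSet p (latticeOf θ α) (latticeOf θ β))
    (hγ : γ ∈ leftOrderUnits (latticeOf θ β)) :
    u * γ ∈ thetaSet p (latticeOf θ α) (latticeOf θ β) := by
  rw [mem_thetaSet_latticeOf] at hu ⊢
  rw [mem_leftOrderUnits_latticeOf] at hγ
  have h : α⁻¹ * rationalGL θ (u * γ) * β =
      (α⁻¹ * rationalGL θ u * β) * (β⁻¹ * rationalGL θ γ * β) := by
    rw [map_mul]
    group
  rw [h]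
  refine ⟨hu.1.mul hγ.1, fun v => ?_⟩
  rw [Units.val_mul, Matrix.det_mul, adele_mul_apply, map_mul, hu.2,
    valued_det_of_mem_integralGL hγ, mul_one]

/-- The existence of `T_{a,b}(𝔭)`. The slash operators of `u` and `γ u` agree on `M_k(R_a, N)`
for units `γ` of `R_a`, and right multiplication by a unit of `R_b` permutes `Θ(𝔭, a, b)`. -/
theorem exists_isBrandtMap (hN : N ≠ ⊥)
    (hα : ∀ v : HeightOneSpectrum (𝓞 F), v.asIdeal ∣ N → evalMatrix v α.1 = 1)
    (hβ : ∀ v : HeightOneSpectrum (𝓞 F), v.asIdeal ∣ N → evalMatrix v β.1 = 1)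
    {a b : Submodule (𝓞 F) B} (ha : a = latticeOf θ α) (hb : b = latticeOf θ β)
    (p : HeightOneSpectrum (𝓞 F)) :
    ∃ T : OrderForm θ N k v j a →ₗ[ℂ] OrderForm θ N k v j b, IsBrandtMap θ N k v j p a b T := by
  subst ha hb
  have hfin : Finite (Theta p (latticeOf θ α) (latticeOf θ β)) := finite_theta θ α β
  have := Fintype.ofFinite (Theta p (latticeOf θ α) (latticeOf θ β))
  have hrep : ∀ (f : OrderForm θ N k v j (latticeOf θ α))
      {u w : thetaSet p (latticeOf θ α) (latticeOf θ β)},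
      (Quotient.mk (thetaSetoid p _ _) u : Theta p _ _) = Quotient.mk (thetaSetoid p _ _) w →
      slash θ N k v j ((u : Bˣ) : B) f.1 = slash θ N k v j ((w : Bˣ) : B) f.1 := by
    intro f u w h
    obtain ⟨γ, hγ, h⟩ := Quotient.exact (s := thetaSetoid p _ _) h
    rw [h, slash_unit_mul hN hα hβ hγ (mem_thetaSet_latticeOf.1 u.2).1 f.2]
  have hmem : ∀ f : OrderForm θ N k v j (latticeOf θ α),
      ∑ c : Theta p (latticeOf θ α) (latticeOf θ β), slash θ N k v j ((c.out : Bˣ) : B) f.1 ∈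
        OrderForm θ N k v j (latticeOf θ β) := by
    intro f γ hγ
    let s : Theta p (latticeOf θ α) (latticeOf θ β) → Theta p (latticeOf θ α) (latticeOf θ β) :=
      fun c => Quotient.mk _ ⟨(c.out : Bˣ) * γ, mul_mem_thetaSet c.out.2 hγ⟩
    have hs : Function.Bijective s := by
      refine Finite.injective_iff_bijective.1 fun c d hcd => ?_
      obtain ⟨δ, hδ, h⟩ := Quotient.exact (s := thetaSetoid p _ _) hcd
      rw [← Quotient.out_eq c, ← Quotient.out_eq d]
      refine Quotient.sound (s := thetaSetoid p _ _) ⟨δ, hδ, ?_⟩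
      dsimp only at h
      rw [← mul_assoc] at h
      exact mul_right_cancel h
    rw [map_sum, ← hs.sum_comp fun c => slash θ N k v j ((c.out : Bˣ) : B) f.1]
    refine Finset.sum_congr rfl fun c _ => ?_
    rw [← slash_mul_unit hN hα hβ hγ (mem_thetaSet_latticeOf.1 c.out.2).1]
    exact hrep f (u := ⟨(c.out : Bˣ) * γ, mul_mem_thetaSet c.out.2 hγ⟩) (Quotient.out_eq _).symm
  refine ⟨{ toFun := fun f => ⟨_, hmem f⟩
            map_add' := fun f g => Subtype.ext ?_
            map_smul' := fun r f => Subtype.ext ?_ }, hfin, fun r hr f => ?_⟩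
  · change ∑ c, slash θ N k v j _ (f.1 + g.1) = ∑ c, _ + ∑ c, _
    simp only [map_add, Finset.sum_add_distrib]
  · change ∑ c, slash θ N k v j _ (r • f.1) = r • ∑ c, _
    simp only [map_smul, Finset.smul_sum]
  · rw [finsum_eq_sum_of_fintype]
    refine Finset.sum_congr rfl fun c _ => hrep f ?_
    rw [hr]
    exact Quotient.out_eq c

end Slash

/-! ### The components of an automorphic form -/

section Component

variable {F : Type*} [Field F] [NumberField F] {N : Ideal (𝓞 F)}
  {B : Type*} [Ring B] [Algebra F B]
  {θ : AdB F B ≃ₐ[Ad F] Matrix (Fin 2) (Fin 2) (Ad F)}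
  {k v : (F →+* ℝ) → ℕ} {j : (F →+* ℝ) → B →+* Matrix (Fin 2) (Fin 2) ℂ}

/-- The value of an automorphic form at an element of `GL₂(F̂)`. -/
def evalForm (f : AutForm θ N k v j) (x : (Matrix (Fin 2) (Fin 2) (Ad F))ˣ) :
    WeightSpace F k :=
  f.1 ((unitsEquiv θ).symm x : (AdB F B)ˣ)

theorem evalForm_unitsEquiv (f : AutForm θ N k v j) (y : (AdB F B)ˣ) :
    evalForm f (unitsEquiv θ y) = f.1 y := by
  rw [evalForm, MulEquiv.symm_apply_apply]

theorem evalForm_congr (f : AutForm θ N k v j) {x y : (Matrix (Fin 2) (Fin 2) (Ad F))ˣ}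
    (h : x⁻¹ * y ∈ gammaZero N) : evalForm f x = evalForm f y := by
  refine congrArg f.1 (mk_eq_mk_iff.2 ?_)
  rwa [MulEquiv.apply_symm_apply, MulEquiv.apply_symm_apply]

theorem weightAct_evalForm (f : AutForm θ N k v j) (γ : Bˣ)
    (x : (Matrix (Fin 2) (Fin 2) (Ad F))ˣ) :
    weightAct k v j γ (evalForm f (rationalGL θ γ * x)) = evalForm f x := by
  have h : (unitsEquiv θ).symm (rationalGL θ γ * x) =
      diagB (F := F) γ * (unitsEquiv θ).symm x := by
    rw [MulEquiv.symm_apply_eq, map_mul, unitsEquiv_diagB, MulEquiv.apply_symm_apply]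
  rw [evalForm, h]
  exact f.2 γ ((unitsEquiv θ).symm x : (AdB F B)ˣ)

theorem mulVec_col_zero (hN : N ≠ ⊥) {m m' : Matrix (Fin 2) (Fin 2) (Ad F)}
    (hm : IsIntegralMatrix m) (hm' : IsIntegralMatrix m') :
    (reduceMatrix N m).mulVec ((reduceMatrix N m').col 0) = (reduceMatrix N (m * m')).col 0 := by
  rw [reduceMatrix_mul hN hm hm']
  rfl

theorem extend_mulVec_col (hN : N ≠ ⊥) {L : Type*} [Zero L] (φ : P1 (𝓞 F ⧸ N) → L)
    (m g : integralGL F) :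
    P1.extend φ ((reduceMatrix N m.1.1).mulVec ((reduceMatrix N g.1.1).col 0)) =
      φ (pointOf hN (m * g)) := by
  rw [mulVec_col_zero hN m.2.1 g.2.1]
  exact P1.extend_of_isCoprime φ (isCoprime_col (reduceMatrix_inv_mul hN (m * g).2))

theorem slash_pointOf (hN : N ≠ ⊥) (u : B) (φ : P1 (𝓞 F ⧸ N) → WeightSpace F k)
    (g : integralGL F) : slash θ N k v j u φ (pointOf hN g) = weightAct k v j u
      (P1.extend φ ((reduceB θ N u).mulVec ((reduceMatrix N g.1.1).col 0))) := rfl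

variable {α : (Matrix (Fin 2) (Fin 2) (Ad F))ˣ}

variable (α) in
/-- The function `g (1 : 0) ↦ f(α g)` on the projective line, for `g ∈ GL₂(Ô)`. -/
def componentFun (hN : N ≠ ⊥) (f : AutForm θ N k v j) (x : P1 (𝓞 F ⧸ N)) : WeightSpace F k :=
  evalForm f (α * (Function.surjInv (pointOf_surjective hN) x).1)

theorem componentFun_pointOf (hN : N ≠ ⊥) (f : AutForm θ N k v j) (g : integralGL F) :
    componentFun α hN f (pointOf hN g) = evalForm f (α * g.1) := by
  refine evalForm_congr f ?_
  rw [mul_inv_rev, mul_assoc, inv_mul_cancel_left, ← pointOf_eq_iff_mem hN]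
  exact Function.surjInv_eq (pointOf_surjective hN) _

variable [Module.Finite F B]

/-- A unit `γ` of `R_a` moves the point `g (1 : 0)` to `α⁻¹ γ α g (1 : 0)`. -/
theorem slash_unit_pointOf (hN : N ≠ ⊥)
    (hα : ∀ v : HeightOneSpectrum (𝓞 F), v.asIdeal ∣ N → evalMatrix v α.1 = 1)
    {γ : Bˣ} (hγ : γ ∈ leftOrderUnits (latticeOf θ α))
    (φ : P1 (𝓞 F ⧸ N) → WeightSpace F k) (g : integralGL F) :
    slash θ N k v j γ φ (pointOf hN g) = weightAct k v j γ
      (φ (pointOf hN (⟨_, mem_leftOrderUnits_latticeOf.1 hγ⟩ * g))) := by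
  rw [slash_pointOf, reduceB_eq hα hα]
  exact congrArg _ (extend_mulVec_col hN φ ⟨_, mem_leftOrderUnits_latticeOf.1 hγ⟩ g)

theorem componentFun_mem (hN : N ≠ ⊥)
    (hα : ∀ v : HeightOneSpectrum (𝓞 F), v.asIdeal ∣ N → evalMatrix v α.1 = 1)
    (f : AutForm θ N k v j) : componentFun α hN f ∈ OrderForm θ N k v j (latticeOf θ α) := by
  intro γ hγ
  funext x
  obtain ⟨g, rfl⟩ := pointOf_surjective hN x
  rw [slash_unit_pointOf hN hα hγ, componentFun_pointOf, componentFun_pointOf,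
    ← weightAct_evalForm f γ (α * g.1)]
  refine congrArg (fun z => weightAct k v j γ (evalForm f z)) ?_
  rw [Subgroup.coe_mul]
  group

/-- The component `M_k^B(N) → M_k(R_a, N)` of the isomorphism. -/
def component (hN : N ≠ ⊥)
    (hα : ∀ v : HeightOneSpectrum (𝓞 F), v.asIdeal ∣ N → evalMatrix v α.1 = 1)
    {a : Submodule (𝓞 F) B} (ha : a = latticeOf θ α) :
    AutForm θ N k v j →ₗ[ℂ] OrderForm θ N k v j a where
  toFun f := ⟨componentFun α hN f, ha ▸ componentFun_mem hN hα f⟩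
  map_add' _ _ := rfl
  map_smul' _ _ := rfl

theorem component_pointOf (hN : N ≠ ⊥)
    (hα : ∀ v : HeightOneSpectrum (𝓞 F), v.asIdeal ∣ N → evalMatrix v α.1 = 1)
    {a : Submodule (𝓞 F) B} (ha : a = latticeOf θ α) (f : AutForm θ N k v j) (g : integralGL F) :
    (component hN hα ha f).1 (pointOf hN g) = evalForm f (α * g.1) := componentFun_pointOf hN f g

end Component

/-! ### The class decomposition of `GL₂(F̂)` -/

section Decomposition

variable {F : Type*} [Field F] [NumberField F] {N : Ideal (𝓞 F)}
  {B : Type*} [Ring B] [Algebra F B] [Module.Finite F B]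
  {θ : AdB F B ≃ₐ[Ad F] Matrix (Fin 2) (Fin 2) (Ad F)}
  {k v : (F →+* ℝ) → ℕ} {j : (F →+* ℝ) → B →+* Matrix (Fin 2) (Fin 2) ℂ}
  {R : Subalgebra (𝓞 F) B} {Cl : Set (Submodule (𝓞 F) B)}
  {α : Cl → (Matrix (Fin 2) (Fin 2) (Ad F))ˣ}

/-- `GL₂(F̂)` is the union of the double cosets `Bˣ α_a GL₂(Ô)`. -/
theorem exists_decomposition (hR : IsOrder R) (hθ : SplitsOrder R θ)
    (hCl : IsRightClassReps R Cl) (hα : ∀ a, a.1 = latticeOf θ (α a))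
    (y : (Matrix (Fin 2) (Fin 2) (Ad F))ˣ) :
    ∃ (γ : Bˣ) (a : Cl) (h : integralGL F), y = rationalGL θ γ * α a * h.1 := by
  obtain ⟨a, ⟨ha, u, hu⟩, -⟩ := hCl.existsUnique _ (isRightFractionalIdeal_latticeOf hR hθ y)
  have h1 := hα ⟨a, ha⟩
  dsimp only at h1
  rw [h1, leftTranslate_latticeOf, eq_comm, latticeOf_eq_iff] at hu
  exact ⟨u, ⟨a, ha⟩, ⟨_, hu⟩, (mul_inv_cancel_left _ _).symm⟩

/-- The double cosets `Bˣ α_a GL₂(Ô)` are disjoint, and the units of the left order of `a` account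
for the ambiguity in the decomposition. -/
theorem decomposition_unique (hR : IsOrder R) (hθ : SplitsOrder R θ)
    (hCl : IsRightClassReps R Cl) (hα : ∀ a, a.1 = latticeOf θ (α a)) {γ γ' : Bˣ} {a a' : Cl}
    {h h' : integralGL F} (heq : rationalGL θ γ * α a * h.1 = rationalGL θ γ' * α a' * h'.1) :
    a = a' ∧ γ'⁻¹ * γ ∈ leftOrderUnits (latticeOf θ (α a)) := by
  have key : ∀ (γ : Bˣ) (a : Cl) (h : integralGL F),
      latticeOf θ (rationalGL θ γ * α a * h.1) = leftTranslate γ a.1 := fun γ a h => by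
    rw [hα, leftTranslate_latticeOf, eq_comm, latticeOf_eq_iff, inv_mul_cancel_left]
    exact h.2
  have h1 : a = a' := Subtype.ext
    ((hCl.existsUnique _ (isRightFractionalIdeal_latticeOf hR hθ _)).unique
    ⟨a.2, γ, key γ a h⟩ ⟨a'.2, γ', heq ▸ key γ' a' h'⟩)
  subst h1
  refine ⟨rfl, mem_leftOrderUnits_latticeOf.2 ?_⟩
  have h2 : (α a)⁻¹ * rationalGL θ (γ'⁻¹ * γ) * α a = h'.1 * h.1⁻¹ := by
    have h3 : rationalGL θ γ * α a = rationalGL θ γ' * α a * h'.1 * h.1⁻¹ := by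
      rw [← heq, mul_inv_cancel_right]
    rw [map_mul, map_inv, mul_assoc, mul_assoc, h3]
    group
  rw [h2]
  exact mul_mem h'.2 (inv_mem h.2)

/-- A form is determined by its components, since it is determined on `Bˣ α_a g` by its value at
`α_a g`. -/
theorem component_injective (hN : N ≠ ⊥) (hR : IsOrder R) (hθ : SplitsOrder R θ)
    (hCl : IsRightClassReps R Cl) (hα : ∀ a, a.1 = latticeOf θ (α a))
    (hαN : ∀ a, ∀ v : HeightOneSpectrum (𝓞 F), v.asIdeal ∣ N → evalMatrix v (α a).1 = 1)
    {f f' : AutForm θ N k v j}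
    (hf : ∀ a, component hN (hαN a) (hα a) f = component hN (hαN a) (hα a) f') : f = f' := by
  refine Subtype.ext (funext fun y => ?_)
  induction y using QuotientGroup.induction_on with
  | H y =>
  rw [← evalForm_unitsEquiv, ← evalForm_unitsEquiv]
  obtain ⟨γ, a, h, hy⟩ := exists_decomposition hR hθ hCl hα (unitsEquiv θ y)
  have h1 := weightAct_evalForm f γ (α a * h.1)
  rw [← component_pointOf hN (hαN a) (hα a), hf, component_pointOf,
    ← weightAct_evalForm f' γ (α a * h.1), ← mul_assoc, ← hy] at h1
  rw [← weightAct_inv_apply k v j γ (evalForm f (unitsEquiv θ y)), h1, weightAct_inv_apply]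

/-- Any family of elements of the `M_k(R_a, N)` comes from a form: the ambiguity in
`y = γ α_a h` is by units of `R_a`, under which the components are invariant. -/
theorem component_surjective (hN : N ≠ ⊥) (hR : IsOrder R) (hθ : SplitsOrder R θ)
    (hCl : IsRightClassReps R Cl) (hα : ∀ a, a.1 = latticeOf θ (α a))
    (hαN : ∀ a, ∀ v : HeightOneSpectrum (𝓞 F), v.asIdeal ∣ N → evalMatrix v (α a).1 = 1)
    (Φ : ∀ a : Cl, OrderForm θ N k v j a.1) :
    ∃ f : AutForm θ N k v j, ∀ a, component hN (hαN a) (hα a) f = Φ a := by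
  -- the form is forced to take the value `Φ_a(h (1 : 0)) γ⁻¹` at `γ α_a h`
  let val : Bˣ → Cl → integralGL F → WeightSpace F k := fun γ a h =>
    weightAct k v j (γ⁻¹ : Bˣ) ((Φ a).1 (pointOf hN h))
  have hval : ∀ {γ γ' : Bˣ} {a a' : Cl} {h h' : integralGL F},
      rationalGL θ γ * α a * h.1 = rationalGL θ γ' * α a' * h'.1 → val γ a h = val γ' a' h' := by
    intro γ γ' a a' h h' heq
    obtain ⟨rfl, hδ⟩ := decomposition_unique hR hθ hCl hα heq
    have h1 := (Φ a).2 _ (by rwa [hα a])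
    have h2 := congrFun h1 (pointOf hN h)
    rw [slash_unit_pointOf hN (hαN a) hδ] at h2
    have h3 : (⟨_, mem_leftOrderUnits_latticeOf.1 hδ⟩ * h : integralGL F) = h' := by
      refine Subtype.ext ?_
      rw [Subgroup.coe_mul]
      dsimp only
      rw [map_mul, map_inv, mul_assoc, mul_assoc, mul_assoc, ← mul_assoc _ (α a) h.1, heq]
      group
    dsimp only [val]
    rw [← h2, h3, ← weightAct_mul_apply, ← Units.val_mul, mul_inv_cancel_right]
  choose γ a h hdec using exists_decomposition hR hθ hCl hα
  let f : (AdB F B)ˣ ⧸ U0 θ N → WeightSpace F k := fun q =>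
    val (γ (unitsEquiv θ q.out)) (a (unitsEquiv θ q.out)) (h (unitsEquiv θ q.out))
  have hf : ∀ (y : (AdB F B)ˣ) (γ' : Bˣ) (a' : Cl) (h' : integralGL F),
      unitsEquiv θ y = rationalGL θ γ' * α a' * h'.1 → f y = val γ' a' h' := by
    intro y γ' a' h' hy
    have h1 : (unitsEquiv θ y)⁻¹ * unitsEquiv θ (y : (AdB F B)ˣ ⧸ U0 θ N).out ∈ gammaZero N :=
      mk_eq_mk_iff.1 (QuotientGroup.out_eq' _).symm
    let κ : integralGL F := ⟨_, ((mem_gammaZero_iff hN).1 h1).1⟩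
    have h2 : val γ' a' h' = val γ' a' (h' * κ) := by
      have : pointOf hN h' = pointOf hN (h' * κ) := by
        rw [pointOf_eq_iff_mem, Subgroup.coe_mul, inv_mul_cancel_left]
        exact h1
      dsimp only [val]
      rw [this]
    rw [h2]
    refine hval ?_
    rw [← hdec, Subgroup.coe_mul, ← mul_assoc, ← hy]
    exact (mul_inv_cancel_left _ _).symm
  refine ⟨⟨f, fun δ q => ?_⟩, fun a' => Subtype.ext (funext fun x => ?_)⟩
  · induction q using QuotientGroup.induction_on with
    | H y =>
    have h1 := hdec (unitsEquiv θ y)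
    rw [hf y _ _ _ h1]
    have h2 : f (diagB (F := F) δ • (y : (AdB F B)ˣ ⧸ U0 θ N)) =
        val (δ * γ (unitsEquiv θ y)) (a (unitsEquiv θ y)) (h (unitsEquiv θ y)) := by
      refine hf (diagB (F := F) δ * y) _ _ _ ?_
      rw [map_mul, unitsEquiv_diagB, map_mul, mul_assoc, mul_assoc,
        ← mul_assoc (rationalGL θ (γ _)), ← h1]
    rw [h2]
    dsimp only [val]
    rw [← weightAct_mul_apply, ← Units.val_mul, mul_inv_rev, inv_mul_cancel_right]
  · obtain ⟨g, rfl⟩ := pointOf_surjective hN x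
    rw [component_pointOf]
    refine (hf _ 1 a' g ?_).trans ?_
    · rw [MulEquiv.apply_symm_apply, map_one, one_mul]
    · dsimp only [val]
      rw [inv_one, Units.val_one, weightAct_one, LinearMap.id_apply]

end Decomposition

/-! ### Comparison of the Hecke operators -/

section HeckeFormula

variable {F : Type*} [Field F] [NumberField F] {N : Ideal (𝓞 F)} {p : HeightOneSpectrum (𝓞 F)}

/-- Two Hecke matrices that differ by an element of `GL₂(Ô)` on the left differ by an element of
`U₀(N)`, since both fix the point `(1 : 0)`. -/
theorem IsHeckeMatrix.mem_gammaZero (hN : N ≠ ⊥) {m m' κ : (Matrix (Fin 2) (Fin 2) (Ad F))ˣ}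
    (hm : IsHeckeMatrix N p m) (hm' : IsHeckeMatrix N p m') (hκ : κ ∈ integralGL F)
    (h : m = κ * m') : κ ∈ gammaZero N := by
  rw [mem_gammaZero_iff hN, and_iff_right hκ]
  have h1 := hm.lower_left
  rw [h, Units.val_mul, reduceMatrix_mul hN hκ.1 hm'.integral, Matrix.mul_apply, Fin.sum_univ_two,
    hm'.lower_left, mul_zero, add_zero] at h1
  exact (hm'.isUnit.mul_left_eq_zero).1 h1

/-- A Hecke matrix `m` fixes `(1 : 0)`, so that `h m (1 : 0) = h (1 : 0)`. -/
theorem IsHeckeMatrix.extend_eq (hN : N ≠ ⊥) {L : Type*} [Zero L] (φ : P1 (𝓞 F ⧸ N) → L)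
    {m : (Matrix (Fin 2) (Fin 2) (Ad F))ˣ} (hm : IsHeckeMatrix N p m) (h : integralGL F) :
    P1.extend φ ((reduceMatrix N (h.1 * m).1).col 0) = φ (pointOf hN h) := by
  have h1 : (reduceMatrix N (h.1 * m).1).col 0 =
      (hm.isUnit.unit : 𝓞 F ⧸ N) • (reduceMatrix N h.1.1).col 0 := by
    rw [Units.val_mul, reduceMatrix_mul hN h.2.1 hm.integral]
    funext i
    change (reduceMatrix N h.1.1 * reduceMatrix N m.1) i 0 =
      reduceMatrix N m.1 0 0 * reduceMatrix N h.1.1 i 0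
    rw [Matrix.mul_apply, Fin.sum_univ_two, hm.lower_left, mul_zero, add_zero, mul_comm]
  rw [h1, P1.extend_unit_smul]
  exact P1.extend_of_isCoprime φ _

/-- An integral matrix `m` whose determinant is a uniformizer becomes a Hecke matrix after left
multiplication by some `h⁻¹ ∈ GL₂(Ô)`, provided that `m (1 : 0)` is a point modulo `N`: take `h`
with `h (1 : 0) = m (1 : 0)`. -/
theorem exists_isHeckeMatrix (hN : N ≠ ⊥) {m : (Matrix (Fin 2) (Fin 2) (Ad F))ˣ}
    (hm : IsIntegralMatrix m.1)
    (hdet : ∀ v, Valued.v (m.1.det v) = Valued.v ((uniformizerIdele p : Ad F) v))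
    (hcop : IsCoprime ((reduceMatrix N m.1).col 0 0) ((reduceMatrix N m.1).col 0 1)) :
    ∃ h : integralGL F, IsHeckeMatrix N p (h.1⁻¹ * m) := by
  obtain ⟨h, hh⟩ := pointOf_surjective hN (Quotient.mk (p1Setoid _) ⟨_, hcop⟩)
  obtain ⟨c, hc⟩ := Quotient.exact (s := p1Setoid _) hh
  dsimp only at hc
  have hinv := reduceMatrix_inv_mul hN h.2
  have key : ∀ i, reduceMatrix N (h.1⁻¹ * m).1 i 0 =
      c * (1 : Matrix (Fin 2) (Fin 2) (𝓞 F ⧸ N)) i 0 := by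
    intro i
    have h0 : reduceMatrix N m.1 0 0 = c * reduceMatrix N h.1.1 0 0 := congrFun hc 0
    have h1 : reduceMatrix N m.1 1 0 = c * reduceMatrix N h.1.1 1 0 := congrFun hc 1
    rw [← hinv, Units.val_mul, reduceMatrix_mul hN h.2.2 hm, Matrix.mul_apply, Fin.sum_univ_two,
      Matrix.mul_apply, Fin.sum_univ_two, h0, h1]
    ring
  refine ⟨h, h.2.2.mul hm, fun v => ?_, ?_, ?_⟩
  · rw [Units.val_mul, Matrix.det_mul, adele_mul_apply, map_mul,
      valued_det_of_mem_integralGL (inv_mem h.2), one_mul, hdet]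
  · rw [key, Matrix.one_apply_ne (by decide), mul_zero]
  · rw [key, Matrix.one_apply_eq, mul_one]
    exact c.isUnit

variable {B : Type*} [Ring B] [Algebra F B] [Module.Finite F B]
  {θ : AdB F B ≃ₐ[Ad F] Matrix (Fin 2) (Fin 2) (Ad F)}
  {k v : (F →+* ℝ) → ℕ} {j : (F →+* ℝ) → B →+* Matrix (Fin 2) (Fin 2) ℂ}
  {R : Subalgebra (𝓞 F) B} {Cl : Set (Submodule (𝓞 F) B)}
  {α : Cl → (Matrix (Fin 2) (Fin 2) (Ad F))ˣ}

/-- The term of `u` in the Brandt operator is a term of the Hecke operator. -/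
theorem slash_component_pointOf (hN : N ≠ ⊥) (hα : ∀ a, a.1 = latticeOf θ (α a))
    (hαN : ∀ a, ∀ v : HeightOneSpectrum (𝓞 F), v.asIdeal ∣ N → evalMatrix v (α a).1 = 1)
    (f : AutForm θ N k v j) {a b : Cl} {u : Bˣ} {g h : integralGL F}
    (hu : IsIntegralMatrix ((α a)⁻¹ * rationalGL θ u * α b).1)
    (hm : IsHeckeMatrix N p (h.1⁻¹ * ((α a)⁻¹ * rationalGL θ u * α b * g.1))) :
    slash θ N k v j u (component hN (hαN a) (hα a) f).1 (pointOf hN g) =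
      evalForm f (rationalGL θ u⁻¹ * α a * h.1) := by
  have h1 := hm.extend_eq hN (component hN (hαN a) (hα a) f).1 h
  rw [mul_inv_cancel_left, Units.val_mul _ g.1, ← mulVec_col_zero hN hu g.2.1,
    component_pointOf] at h1
  rw [slash_pointOf, reduceB_eq (hαN a) (hαN b), h1,
    ← weightAct_evalForm f u⁻¹ (α a * h.1), ← weightAct_mul_apply, Units.inv_mul, weightAct_one,
    LinearMap.id_apply, mul_assoc]

set_option maxHeartbeats 800000 in
/-- The cosets in the Hecke operator at `α_b g` correspond to the `u` in the union of the
`Θ(𝔭, a, b)` for which `u g (1 : 0)` is a point of the projective line: the coset `x U₀(N)`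
corresponds to `u` if `α_b g x` lies in `u⁻¹ α_a GL₂(Ô)`. -/
theorem sum_heckeCosets_eq (hN : N ≠ ⊥) (hR : IsOrder R) (hθ : SplitsOrder R θ)
    (hCl : IsRightClassReps R Cl) [Fintype Cl] (hα : ∀ a, a.1 = latticeOf θ (α a))
    (hαN : ∀ a, ∀ v : HeightOneSpectrum (𝓞 F), v.asIdeal ∣ N → evalMatrix v (α a).1 = 1)
    (f : AutForm θ N k v j) (b : Cl) (g : integralGL F)
    [∀ a : Cl, Fintype (Theta p a.1 b.1)] :
    ∑ᶠ c ∈ heckeCosets θ N p, f.1 ((unitsEquiv θ).symm (α b * g.1) • c) =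
      ∑ a : Cl, ∑ c : Theta p a.1 b.1,
        slash θ N k v j ((c.out : Bˣ) : B) (component hN (hαN a) (hα a) f).1 (pointOf hN g) := by
  have hmem : ∀ (a : Cl) (u : Bˣ), u ∈ thetaSet p a.1 b.1 ↔
      IsIntegralMatrix ((α a)⁻¹ * rationalGL θ u * α b).1 ∧
      ∀ v, Valued.v (((α a)⁻¹ * rationalGL θ u * α b).1.det v) =
        Valued.v ((uniformizerIdele p : Ad F) v) := fun a u => by
    rw [hα a, hα b]
    exact mem_thetaSet_latticeOf
  have hdec : ∀ c : (AdB F B)ˣ ⧸ U0 θ N, ∃ (u : Bˣ) (a : Cl) (h : integralGL F),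
      α b * g.1 * unitsEquiv θ c.out = rationalGL θ u⁻¹ * α a * h.1 := fun c => by
    obtain ⟨γ, a, h, hy⟩ := exists_decomposition hR hθ hCl hα (α b * g.1 * unitsEquiv θ c.out)
    exact ⟨γ⁻¹, a, h, by rw [inv_inv]; exact hy⟩
  choose u a h hdec using hdec
  have hx : ∀ c, (unitsEquiv θ c.out)⁻¹ =
      (h c).1⁻¹ * ((α (a c))⁻¹ * rationalGL θ (u c) * α b * g.1) := fun c => by
    rw [← inv_inj, inv_inv, ← mul_right_inj (α b * g.1), hdec, map_inv]
    group
  have hhecke : ∀ c ∈ heckeCosets θ N p,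
      IsHeckeMatrix N p ((h c).1⁻¹ * ((α (a c))⁻¹ * rationalGL θ (u c) * α b * g.1)) :=
    fun c hc => by
      rw [← hx, ← mem_heckeCosets_iff hN, QuotientGroup.out_eq']
      exact hc
  have hu : ∀ c ∈ heckeCosets θ N p, u c ∈ thetaSet p (a c).1 b.1 := fun c hc => by
    have h1 := hhecke c hc
    have h2 : (α (a c))⁻¹ * rationalGL θ (u c) * α b =
        (h c).1 * ((h c).1⁻¹ * ((α (a c))⁻¹ * rationalGL θ (u c) * α b * g.1)) * g.1⁻¹ := by group
    rw [hmem, h2]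
    refine ⟨((h c).2.1.mul h1.integral).mul g.2.2, fun v => ?_⟩
    rw [Units.val_mul, Units.val_mul _ (_ * _), Matrix.det_mul, Matrix.det_mul, adele_mul_apply,
      adele_mul_apply, map_mul, map_mul, valued_det_of_mem_integralGL (h c).2,
      valued_det_of_mem_integralGL (inv_mem g.2), h1.valued_det, one_mul, mul_one]
  have hrep : ∀ {a : Cl} {w w' : thetaSet p a.1 b.1},
      (Quotient.mk (thetaSetoid p a.1 b.1) w : Theta p a.1 b.1) = Quotient.mk _ w' →
      slash θ N k v j ((w : Bˣ) : B) (component hN (hαN a) (hα a) f).1 =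
        slash θ N k v j ((w' : Bˣ) : B) (component hN (hαN a) (hα a) f).1 := by
    intro a w w' hw
    obtain ⟨γ, hγ, hw⟩ := Quotient.exact (s := thetaSetoid p _ _) hw
    rw [hα a] at hγ
    rw [hw]
    refine (slash_unit_mul hN (hαN a) (hαN b) hγ ((hmem a w).1 w.2).1 ?_).symm
    rw [← hα a]
    exact (component hN (hαN a) (hα a) f).2
  have hsigma : ∀ {a₁ a₂ : Cl} {w₁ : thetaSet p a₁.1 b.1} {w₂ : thetaSet p a₂.1 b.1},
      (⟨a₁, Quotient.mk _ w₁⟩ : Σ a : Cl, Theta p a.1 b.1) = ⟨a₂, Quotient.mk _ w₂⟩ ↔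
        a₁ = a₂ ∧ ∃ γ ∈ leftOrderUnits a₁.1, w₂.1 = γ * w₁.1 := by
    intro a₁ a₂ w₁ w₂
    constructor
    · intro heq
      obtain ⟨rfl, heq⟩ := Sigma.mk.inj_iff.1 heq
      exact ⟨rfl, Quotient.exact (s := thetaSetoid p _ _) (eq_of_heq heq)⟩
    · rintro ⟨rfl, hγ⟩
      exact congrArg (Sigma.mk a₁) (Quotient.sound (s := thetaSetoid p _ _) hγ)
  have hfin : Fintype (heckeCosets θ N p) := (heckeCosets_finite hN).fintype
  -- the map is injective, and the terms outside its image vanish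
  let e : heckeCosets θ N p → Σ a : Cl, Theta p a.1 b.1 := fun c =>
    ⟨a c.1, Quotient.mk _ ⟨u c.1, hu c.1 c.2⟩⟩
  rw [← finsum_set_coe_eq_finsum_mem (heckeCosets θ N p), finsum_eq_sum_of_fintype]
  refine Eq.trans ?_ (Fintype.sum_sigma' fun (a : Cl) (c : Theta p a.1 b.1) =>
    slash θ N k v j ((c.out : Bˣ) : B) (component hN (hαN a) (hα a) f).1 (pointOf hN g))
  refine Finset.sum_of_injOn e ?_ (fun _ _ => Finset.mem_coe.2 (Finset.mem_univ _)) ?_ ?_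
  · rintro ⟨c, hc⟩ - ⟨c', hc'⟩ - heq
    obtain ⟨ha, γ, hγ, huγ⟩ := hsigma.1 heq
    dsimp only at ha hγ huγ
    refine Subtype.ext ?_
    change c = c'
    rw [← QuotientGroup.out_eq' c, ← QuotientGroup.out_eq' c', mk_eq_mk_iff]
    have h1 := hhecke c hc
    have h2 := hhecke c' hc'
    rw [← hx] at h1 h2
    refine h1.mem_gammaZero hN h2 ?_ (mul_inv_cancel_right _ _).symm
    rw [hα, mem_leftOrderUnits_latticeOf] at hγ
    have h3 : (unitsEquiv θ c.out)⁻¹ * unitsEquiv θ c'.out =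
        (h c).1⁻¹ * ((α (a c))⁻¹ * rationalGL θ γ * α (a c))⁻¹ * (h c').1 := by
      rw [← inv_inv (unitsEquiv θ c'.out), hx, hx, huγ, ← ha, map_mul]
      group
    rw [h3]
    exact mul_mem (mul_mem (inv_mem (h c).2) (inv_mem hγ)) (h c').2
  · rintro ⟨A, w⟩ - hw
    by_contra hne
    obtain ⟨hint, hdet⟩ := (hmem A (w.out : Bˣ)).1 w.out.2
    have hcol : (reduceB θ N ((w.out : Bˣ) : B)).mulVec ((reduceMatrix N g.1.1).col 0) =
        (reduceMatrix N ((α A)⁻¹ * rationalGL θ (w.out : Bˣ) * α b * g.1).1).col 0 := by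
      rw [reduceB_eq (hαN A) (hαN b), mulVec_col_zero hN hint g.2.1, ← Units.val_mul]
    have hcop : IsCoprime
        ((reduceMatrix N ((α A)⁻¹ * rationalGL θ (w.out : Bˣ) * α b * g.1).1).col 0 0)
        ((reduceMatrix N ((α A)⁻¹ * rationalGL θ (w.out : Bˣ) * α b * g.1).1).col 0 1) := by
      by_contra hcop
      refine hne ?_
      dsimp only
      rw [slash_pointOf, hcol, P1.extend_of_not_isCoprime _ hcop, map_zero]
    have hint' : IsIntegralMatrix
        ((α A)⁻¹ * rationalGL θ (w.out : Bˣ) * α b * g.1).1 := hint.mul g.2.1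
    have hdet' : ∀ v, Valued.v (((α A)⁻¹ * rationalGL θ (w.out : Bˣ) * α b * g.1).1.det v) =
        Valued.v ((uniformizerIdele p : Ad F) v) := fun v => by
      rw [Units.val_mul _ g.1, Matrix.det_mul, adele_mul_apply, map_mul, hdet,
        valued_det_of_mem_integralGL g.2, mul_one]
    obtain ⟨h', hh'⟩ := exists_isHeckeMatrix (p := p) hN hint' hdet' hcop
    let x : (AdB F B)ˣ := (unitsEquiv θ).symm
      (h'.1⁻¹ * ((α A)⁻¹ * rationalGL θ (w.out : Bˣ) * α b * g.1))⁻¹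
    have hex : unitsEquiv θ x = (h'.1⁻¹ * ((α A)⁻¹ * rationalGL θ (w.out : Bˣ) * α b * g.1))⁻¹ :=
      MulEquiv.apply_symm_apply _ _
    let q : (AdB F B)ˣ ⧸ U0 θ N := x
    have hq : q ∈ heckeCosets θ N p := by
      rw [mem_heckeCosets_iff hN, hex, inv_inv]
      exact hh'
    have h1 : (unitsEquiv θ x)⁻¹ * unitsEquiv θ q.out ∈ gammaZero N :=
      mk_eq_mk_iff.1 (QuotientGroup.out_eq' q).symm
    let κ : integralGL F := ⟨_, ((mem_gammaZero_iff hN).1 h1).1⟩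
    have h2 : rationalGL θ (w.out : Bˣ)⁻¹ * α A * (h' * κ).1 =
        rationalGL θ (u q)⁻¹ * α (a q) * (h q).1 := by
      rw [← hdec q]
      change _ * (h'.1 * ((unitsEquiv θ x)⁻¹ * unitsEquiv θ q.out)) = _
      rw [hex, map_inv]
      group
    obtain ⟨hA, hγ⟩ := decomposition_unique hR hθ hCl hα h2
    refine hw ⟨⟨q, hq⟩, Finset.mem_coe.2 (Finset.mem_univ _), ?_⟩
    refine Eq.symm ((congrArg (Sigma.mk A) (Quotient.out_eq w).symm).trans
      (hsigma.2 ⟨hA, _, by rw [hα]; exact hγ, ?_⟩))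
    dsimp only
    rw [inv_inv, inv_mul_cancel_right]
  · rintro ⟨c, hc⟩ -
    have h1 := hrep (a := a c) (w := ⟨u c, hu c hc⟩) (Quotient.out_eq (Quotient.mk
      (thetaSetoid p (a c).1 b.1) ⟨u c, hu c hc⟩)).symm
    refine Eq.trans ?_ (congrFun h1 (pointOf hN g))
    rw [slash_component_pointOf hN hα hαN f ((hmem _ _).1 (hu c hc)).1 (hhecke c hc), ← hdec,
      evalForm, map_mul _ (α b * g.1) (unitsEquiv θ c.out), MulEquiv.symm_apply_apply]
    refine congrArg f.1 ?_
    exact congrArg (fun z => (unitsEquiv θ).symm (α b * g.1) • z) (QuotientGroup.out_eq' c).symm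

end HeckeFormula

end BrandtHecke

end

theorem proposition1
    {F : Type*} [Field F] [NumberField F] [IsTotallyReal F] (hF : Even (Module.finrank ℚ F))
    {B : Type*} [Ring B] [Algebra F B] [Algebra.IsCentral F B] [IsSimpleRing B]
    (hB : Module.finrank F B = 4) (hdef : IsTotallyDefinite F B)
    (R : Subalgebra (𝓞 F) B) (hR : IsMaximalOrder R)
    (θ : AdB F B ≃ₐ[Ad F] Matrix (Fin 2) (Fin 2) (Ad F)) (hθ : SplitsOrder R θ)
    (j : (F →+* ℝ) → B →+* Matrix (Fin 2) (Fin 2) ℂ)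
    (hj : ∀ (τ : F →+* ℝ) (c : F), j τ (algebraMap F B c) = Matrix.scalar (Fin 2) ((τ c : ℝ) : ℂ))
    (N : Ideal (𝓞 F)) (hN : N ≠ ⊥)
    (k v : (F →+* ℝ) → ℕ) (hk : ∀ τ, 2 ≤ k τ) (hkpar : ∀ τ σ, k τ ≡ k σ [MOD 2])
    (hv : ∃ τ, v τ = 0) (μ : ℕ) (hμ : ∀ τ, (k τ - 2) + 2 * v τ = μ)
    (Cl : Set (Submodule (𝓞 F) B)) (hCl : IsRightClassReps R Cl)
    (hint : ∀ a ∈ Cl, a ≤ Subalgebra.toSubmodule R)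
    (hcop : ∀ a ∈ Cl, ∀ q : HeightOneSpectrum (𝓞 F), q.asIdeal ∣ N →
      ¬ idealNorm a ≤ toFrac q.asIdeal) :
    ∃ (T : HeightOneSpectrum (𝓞 F) →
          (AutForm θ N k v j →ₗ[ℂ] AutForm θ N k v j))
      (Tab : HeightOneSpectrum (𝓞 F) → ∀ a b : Cl,
          (OrderForm θ N k v j a.1 →ₗ[ℂ] OrderForm θ N k v j b.1)),
      (∀ p, IsHeckeOperator θ N k v j p (T p)) ∧
      (∀ p (a b : Cl), IsBrandtMap θ N k v j p a.1 b.1 (Tab p a b)) ∧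
      ∃ φ : AutForm θ N k v j ≃ₗ[ℂ] ⨁ a : Cl, OrderForm θ N k v j a.1,
        ∀ p (f : AutForm θ N k v j) (b : Cl), φ (T p f) b = ∑ᶠ a : Cl, Tab p a b (φ f a) := by
  have : Module.Finite F B := Module.finite_of_finrank_pos (by rw [hB]; exact four_pos)
  obtain ⟨τ, -⟩ := hv
  -- the finiteness makes the direct sum a product
  have hClfin : Finite Cl :=
    finite_classReps (fun _ hx => isUnit_of_isTotallyDefinite hdef τ hx) hR.1 hCl hint
  have := Fintype.ofFinite Cl
  choose α hα hαN using fun a : Cl => exists_trivial_generator hθ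
    (hCl.isRightFractionalIdeal a.1 a.2) (hint a.1 a.2) (hcop a.1 a.2)
  choose Tab hTab using fun (p : HeightOneSpectrum (𝓞 F)) (a b : Cl) =>
    exists_isBrandtMap (θ := θ) (k := k) (v := v) (j := j) hN (hαN a) (hαN b) (hα a) (hα b) p
  -- `Φ f` has the components `g (1 : 0) ↦ f(α_a g)`
  let Φ : AutForm θ N k v j →ₗ[ℂ] ∀ a : Cl, OrderForm θ N k v j a.1 :=
    LinearMap.pi fun a => component hN (hαN a) (hα a)
  have hΦ : Function.Bijective Φ := by
    refine ⟨fun f f' hf => ?_, fun G => ?_⟩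
    · exact component_injective hN hR.1 hθ hCl hα hαN fun a => congrFun hf a
    · obtain ⟨f, hf⟩ := component_surjective hN hR.1 hθ hCl hα hαN G
      exact ⟨f, funext hf⟩
  classical
  refine ⟨heckeOperator hN, Tab, isHeckeOperator_heckeOperator hN, hTab,
    (LinearEquiv.ofBijective Φ hΦ).trans (DirectSum.linearEquivFunOnFintype ℂ Cl
      fun a => OrderForm θ N k v j a.1).symm, fun p f b => ?_⟩
  have hφ : ∀ (f : AutForm θ N k v j) (a : Cl), ((LinearEquiv.ofBijective Φ hΦ).trans
      (DirectSum.linearEquivFunOnFintype ℂ Cl fun a => OrderForm θ N k v j a.1).symm) f a =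
        component hN (hαN a) (hα a) f := fun f a =>
    congrFun ((DirectSum.linearEquivFunOnFintype ℂ Cl
      fun a => OrderForm θ N k v j a.1).apply_symm_apply (Φ f)) a
  simp only [hφ]
  rw [finsum_eq_sum_of_fintype]
  refine Subtype.ext (funext fun x => ?_)
  obtain ⟨g, rfl⟩ := pointOf_surjective hN x
  have hfin : ∀ a : Cl, Fintype (Theta p a.1 b.1) := fun a =>
    have := (hTab p a b).1
    Fintype.ofFinite _
  rw [component_pointOf, evalForm, (isHeckeOperator_heckeOperator hN p).2,
    sum_heckeCosets_eq hN hR.1 hθ hCl hα hαN, Submodule.coe_sum, Finset.sum_apply]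
  refine Finset.sum_congr rfl fun a _ => ?_
  rw [(hTab p a b).2 Quotient.out Quotient.out_eq, finsum_eq_sum_of_fintype, Finset.sum_apply]
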